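/- **Setting.** Fix an integer $q\ge 1$ and real constants $\alpha_1,\dots,\alpha_q>1$. An instance of generalized network design (GND) consists of a finite non-empty resource set $E$, of $N\ge 1$ requests, where request $i$ has a reply collection $P_i\subseteq 2^E$ (described by $\mathrm{poly}(|E|)$ bits) and integer weights $w_i(e)\ge 1$, and of parameters $\sigma_e\ge 0$, $\xi_{e,j}\ge 0$ for $e\in E$, $j\in[q]$, where for each $e$ at least one $\xi_{e,j}$ is positive. The cost of a profile $p=(p_1,\dots,p_N)$ with $p_i\in P_i$ is $C(p)=\sum_{e}F_e\big(\sum_{i:e\in p_i}w_i(e)\big)$, where $F_e(0)=0$ and $F_e(l)=\sigma_e+\sum_j\xi_{e,j}l^{\alpha_j}$ for $l>0$; $C^*$ is the minimum of $C$. For $\varrho\ge 1$, a reply $\varrho$-oracle for a family of requests returns, given a request of the family with reply collection $R$ and tolls $\tau:E\to\mathbb R_{>0}$, some $r\in R$ with $\sum_{e\in r}\tau(e)\le\varrho\sum_{e\in r'}\tau(e)$ for all $r'\in R$. **Algorithm (Alg-ABRD with Shapley cost sharing).** Fix a sufficiently small constant $\epsilon>0$ (with $\epsilon<1$ and $\epsilon_1^2<2$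 for $\epsilon_1=\frac{1+\epsilon}{1-\epsilon}$) and a constant $b\in\mathbb Z_{\ge 0}$. The Shapley cost share $f_{i,e}(S)$ of a player (request) $i\in S$ is the expected increase of $F_e$ caused by $i$ when the players of $S$, the users of $e$, are added to $e$ in uniformly random order. It is estimated by $\sigma_e/|S|$ plus the median of $k$ independent means of $M=\lceil 16N^2/\epsilon^2\rceil$ random samples of the increase of $\sum_j\xi_{e,j}l^{\alpha_j}$, where $k=\lceil\log_2(2(TN|E|)^2(N+|E|)^b)\rceil$. Here, with $H_N$ the $N$-th harmonic number, $T=\big\lceil \frac{2\epsilon_1NH_N}{1-\epsilon_1^2/2}\ln\big(H_N\lceil\max_j\alpha_j\rceil N^{\max_j\alpha_j}\big)\big\rceil$. Start from the profile $p^0$ in which $p^0_i$ is the oracle's answer for request $i$ and tolls $F_e(w_i(e))$. At most $T$ times do the following, where $p$ is the current profile. For each $i$, estimate the shares $\tau_i(e)$ of $i$ in every resource $e$ when $e$ is used by $i$ and by the other users of $e$ under $p$; let $p'_i$ be the oracle's answer for request $i$ and tolls $\tau_i$; and let $\delta_i=\sum_{e\in p_i}\tau_i(e)-\epsilon_1\sum_{e\in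 p'_i}\tau_i(e)$. If all $\delta_i\le 0$, end the iteration. Otherwise replace $p_j$ by $p'_j$ for the first player $j$ with $\delta_j>0$ and $\delta_j\ge\frac1N\sum_i\delta_i$. The output is the cheapest profile encountered. **Theorem.** In the $O$-notation below the hidden constants depend only on $q,\alpha_1,\dots,\alpha_q,\epsilon$ and, for the running times only, on $b$. Consider a family of requests that admits a reply $\varrho$-oracle, and any GND instance as above whose requests belong to the family. Then every estimate of a Shapley cost share lies in $[(1-\epsilon)f_{i,e}(S),(1+\epsilon)f_{i,e}(S)]$ with probability at least $1-\frac{1}{2(TN|E|)^2}$. The algorithm always outputs a feasible profile $p$, and $$C(p)\le O\Big(\varrho^{\max_j\alpha_j+1}+\varrho\cdot\max_{e}\min_{j:\,\xi_{e,j}>0}\Big(\frac{\sigma_e}{\xi_{e,j}}\Big)^{1/\alpha_j}\Big)\cdot C^*$$ with probability at least $1-O\big(\frac{1}{N^2|E|\log^2(N+1)}\big)$ and with probability at least $1-\frac{1}{(|E|+N)^b}$. The algorithm only uses elementary operations: arithmetic operations and powers of real numbers, comparisons, uniformly random indices in $\{0,\dots,n\}$ with $n<N$, bookkeeping steps, and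 oracle calls. With unit cost for each of these, its worst-case running time is $O\big(N^5\log^2(N+1)\cdot|E|\log^2(N|E|+1)\big)$. If an oracle call takes $c$ steps instead, it is $O\big(N^5\log^2(N+1)\cdot|E|\log^2(N|E|+1)+N^2\log^2(N+1)\cdot c\big)$. Both bounds are independent of the weights and the cost parameters (strongly polynomial). -/

import Mathlib

/-! ### Generalized network design (GND) -/

/-- A family of succinctly represented requests. The resource set of size `m` is `Fin m`; a request
is described by a bit string `x ∈ codes m` of length polynomial in `m`, and `replies m x` is its
collection of replies (subsets of the resource set). -/
structure RequestFamily where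
  codes : (m : ℕ) → Set (List Bool)
  replies : (m : ℕ) → List Bool → Set (Finset (Fin m))
  succinct : ∃ c d : ℕ, ∀ m, ∀ x ∈ codes m, x.length ≤ c * m ^ d + c

/-- `O` is a reply `ϱ`-oracle for the family: given a request and a positive toll function, it
returns a reply whose total toll is minimal up to the factor `ϱ`. -/
def IsReplyOracle (R : RequestFamily) (ϱ : ℝ)
    (O : (m : ℕ) → List Bool → (Fin m → ℝ) → Finset (Fin m)) : Prop :=
  ∀ (m : ℕ), ∀ x ∈ R.codes m, ∀ τ : Fin m → ℝ, (∀ e, 0 < τ e) →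
    O m x τ ∈ R.replies m x ∧
      ∀ r ∈ R.replies m x, ∑ e ∈ O m x τ, τ e ≤ ϱ * ∑ e ∈ r, τ e

/-- An instance of the GND problem with requests from `R` and with `q` load exponents:
`N` requests with positive integral unrelated weights `w i e`, and `m` resources with startup costs
`σ e` and scaling factors `ξ e j`. -/
structure GNDInstance (R : RequestFamily) (q : ℕ) where
  N : ℕ
  m : ℕ
  req : Fin N → List Bool
  req_mem : ∀ i, req i ∈ R.codes m
  w : Fin N → Fin m → ℕ
  w_pos : ∀ i e, 1 ≤ w i e
  σ : Fin m → ℝ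
  σ_nonneg : ∀ e, 0 ≤ σ e
  ξ : Fin m → Fin q → ℝ
  ξ_nonneg : ∀ e j, 0 ≤ ξ e j
  ξ_pos : ∀ e, ∃ j, 0 < ξ e j

namespace GNDInstance

variable {R : RequestFamily} {q : ℕ} (I : GNDInstance R q)

/-- The strategy profile `p` serves every request by one of its replies. -/
def Feasible (p : Fin I.N → Finset (Fin I.m)) : Prop :=
  ∀ i, p i ∈ R.replies I.m (I.req i)

/-- The real exponent polynomial cost function `F_e`, with exponents `α`. -/
noncomputable def resourceCost (α : Fin q → ℝ) (e : Fin I.m) (l : ℕ) : ℝ :=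
  if l = 0 then 0 else I.σ e + ∑ j, I.ξ e j * (l : ℝ) ^ α j

/-- The set `S_e` of players using resource `e`. -/
def users (p : Fin I.N → Finset (Fin I.m)) (e : Fin I.m) : Finset (Fin I.N) :=
  Finset.univ.filter fun i => e ∈ p i

/-- The load on resource `e`. -/
def load (p : Fin I.N → Finset (Fin I.m)) (e : Fin I.m) : ℕ :=
  ∑ i ∈ I.users p e, I.w i e

/-- The total cost `C(p)`. -/
noncomputable def totalCost (α : Fin q → ℝ) (p : Fin I.N → Finset (Fin I.m)) : ℝ :=
  ∑ e, I.resourceCost α e (I.load p e)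

/-- The Shapley cost share `f_{i,e}(S)` of player `i` in resource `e` when `S` is the set of players
using `e`: the expected marginal contribution of `i` when the players of `S` are added one by one
in the order given by a uniformly random permutation of `S`. -/
noncomputable def shapleyShare (α : Fin q → ℝ) (e : Fin I.m) (S : Finset (Fin I.N))
    (i : Fin I.N) : ℝ :=
  if hi : i ∈ S then
    (∑ π : Equiv.Perm {x // x ∈ S},
      (I.resourceCost α e
          ((∑ k ∈ Finset.univ.filter (fun k => π k < π ⟨i, hi⟩), I.w k.1 e) + I.w i e) -
        I.resourceCost α e
          (∑ k ∈ Finset.univ.filter (fun k => π k < π ⟨i, hi⟩), I.w k.1 e))) /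
      (Nat.factorial S.card : ℝ)
  else 0

/-- `max_e min_j (σ_e / ξ_{e,j}) ^ (1 / α_j)`. An index `j` with `ξ_{e,j} = 0` contributes `∞` to
the minimum, so the minimum is over the indices with `ξ_{e,j} > 0`. -/
noncomputable def startupRatio (α : Fin q → ℝ) : ℝ :=
  ⨆ e : Fin I.m, ⨅ j : {j : Fin q // 0 < I.ξ e j}, (I.σ e / I.ξ e j.1) ^ (1 / α j.1)

end GNDInstance

/-! ### Machine model

A randomized program with a reply oracle, over an abstract type `V` of numbers: programs that are
polymorphic in `V` can access numbers only through the unit-cost operations below. -/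

inductive ArithOp where
  | add | sub | mul | div | pow

/-- The arithmetic operations on real numbers. -/
noncomputable def ArithOp.eval : ArithOp → ℝ → ℝ → ℝ
  | .add, x, y => x + y
  | .sub, x, y => x - y
  | .mul, x, y => x * y
  | .div, x, y => x / y
  | .pow, x, y => x ^ y

/-- Programs for `N` requests and `m` resources with an output in `A`. -/
inductive Prog (V : Type) (N m : ℕ) (A : Type) : Type where
  /-- output a result -/
  | ret (a : A) : Prog V N m A
  /-- one step of control, bookkeeping or memory access -/
  | tick (k : Prog V N m A) : Prog V N m A
  /-- load a natural number -/
  | nat (n : ℕ) (k : V → Prog V N m A) : Prog V N m A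
  /-- an arithmetic operation -/
  | arith (o : ArithOp) (x y : V) (k : V → Prog V N m A) : Prog V N m A
  /-- the comparison `x ≤ y` -/
  | le (x y : V) (k : Bool → Prog V N m A) : Prog V N m A
  /-- draw a uniformly random element of `{0, …, n}` -/
  | rand (n : ℕ) (k : Fin (n + 1) → Prog V N m A) : Prog V N m A
  /-- call the reply oracle on request `i` and a toll function -/
  | oracle (i : Fin N) (τ : Fin m → V) (k : Finset (Fin m) → Prog V N m A) : Prog V N m A

namespace Prog

variable {V : Type} {N m : ℕ} {A B : Type}

/-- Sequential composition. -/
def bind : Prog V N m A → (A → Prog V N m B) → Prog V N m B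
  | ret a, f => f a
  | tick k, f => tick (bind k f)
  | nat n k, f => nat n fun v => bind (k v) f
  | arith o x y k, f => arith o x y fun v => bind (k v) f
  | le x y k, f => le x y fun v => bind (k v) f
  | rand n k, f => rand n fun v => bind (k v) f
  | oracle i τ k, f => oracle i τ fun r => bind (k r) f

instance : Monad (Prog V N m) where
  pure := ret
  bind := bind

/-- The law of the output of a program over the real numbers, where `O i τ` is the answer of the
oracle on request `i` and tolls `τ`. -/
noncomputable def law (O : Fin N → (Fin m → ℝ) → Finset (Fin m)) : Prog ℝ N m A → PMF A
  | ret a => PMF.pure a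
  | tick k => law O k
  | nat n k => law O (k n)
  | arith o x y k => law O (k (o.eval x y))
  | le x y k => law O (k (open Classical in decide (x ≤ y)))
  | rand n k => (PMF.uniformOfFintype (Fin (n + 1))).bind fun v => law O (k v)
  | oracle i τ k => law O (k (O i τ))

/-- The worst case running time (over all outcomes of the random draws) of a program over the real
numbers, when every oracle call takes `c` steps and every other operation takes one step. -/
noncomputable def time (O : Fin N → (Fin m → ℝ) → Finset (Fin m)) (c : ℕ) : Prog ℝ N m A → ℕ
  | ret _ => 0
  | tick k => time O c k + 1
  | nat n k => time O c (k n) + 1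
  | arith o x y k => time O c (k (o.eval x y)) + 1
  | le x y k => time O c (k (open Classical in decide (x ≤ y))) + 1
  | rand n k => (Finset.univ.sup fun v : Fin (n + 1) => time O c (k v)) + 1
  | oracle i τ k => time O c (k (O i τ)) + c

/-! Elementary building blocks. -/

/-- `n` steps of bookkeeping. -/
def ticks : ℕ → Prog V N m Unit
  | 0 => ret ()
  | n + 1 => tick (ticks n)

def natP (n : ℕ) : Prog V N m V := nat n ret

def arithP (o : ArithOp) (x y : V) : Prog V N m V := arith o x y ret

def leP (x y : V) : Prog V N m Bool := le x y ret

def oracleP (i : Fin N) (τ : Fin m → V) : Prog V N m (Finset (Fin m)) := oracle i τ ret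

/-- Run `f 0, …, f (n - 1)` in this order and store the results in an array. -/
def forEach : (n : ℕ) → (Fin n → Prog V N m A) → Prog V N m (Fin n → A)
  | 0, _ => ret Fin.elim0
  | n + 1, f => tick do
      let a ← f 0
      let r ← forEach n fun i => f i.succ
      ret (Fin.cons a r)

/-- The sum of the results of `f 0, …, f (n - 1)`. -/
def sumEach : (n : ℕ) → (Fin n → Prog V N m V) → Prog V N m V
  | 0, _ => natP 0
  | n + 1, f => tick do
      let x ← f 0
      let s ← sumEach n fun i => f i.succ
      arithP .add x s

/-- The sum of the numbers `f i` over those `i` that pass the (one step) test `b i`. -/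
def sumIf (n : ℕ) (b : Fin n → Bool) (f : Fin n → V) : Prog V N m V :=
  sumEach n fun i => tick (if b i then ret (f i) else natP 0)

/-- The first index whose test succeeds, if there is one. -/
def findFirst : (n : ℕ) → (Fin n → Prog V N m Bool) → Prog V N m (Option (Fin n))
  | 0, _ => ret none
  | n + 1, f => tick do
      let b ← f 0
      if b then ret (some 0) else
        let r ← findFirst n fun i => f i.succ
        ret (r.map Fin.succ)

/-- A random permutation, generated by successive random transpositions (Fisher-Yates). -/
def randPerm : (n : ℕ) → Prog V N m (Equiv.Perm (Fin n))
  | 0 => ret 1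
  | n + 1 => rand n fun x => tick do
      let π ← randPerm n
      ret (Equiv.Perm.decomposeFin.symm (x, π))

/-- Insert a number into a sorted list. -/
def insertP (x : V) : List V → Prog V N m (List V)
  | [] => ret [x]
  | y :: ys => tick do
      let b ← leP x y
      if b then ret (x :: y :: ys) else
        let zs ← insertP x ys
        ret (y :: zs)

/-- Insertion sort. -/
def sortP : List V → Prog V N m (List V)
  | [] => ret []
  | x :: xs => tick do
      let ys ← sortP xs
      insertP x ys

/-- The median of the numbers `x 0, …, x (k - 1)`. -/
def median (k : ℕ) (x : Fin k → V) : Prog V N m V := do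
  ticks k
  let l ← sortP (List.ofFn x)
  match l.drop (k / 2) with
  | [] => natP 0
  | y :: _ => ret y

end Prog

/-! ### The algorithm -/

/-- The numerical part of the input. -/
structure NumInput (V : Type) (N m q : ℕ) where
  α : Fin q → V
  w : Fin N → Fin m → V
  σ : Fin m → V
  ξ : Fin m → Fin q → V

namespace NumInput

open Prog

variable {V : Type} {N m q : ℕ}

/-- `∑ j, ξ_{e,j} x ^ α_j` -/
def powerCost (D : NumInput V N m q) (e : Fin m) (x : V) : Prog V N m V :=
  sumEach q fun j => do
    let y ← arithP .pow x (D.α j)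
    arithP .mul (D.ξ e j) y

/-- `F_e(x)` for a positive load `x` -/
def positiveCost (D : NumInput V N m q) (e : Fin m) (x : V) : Prog V N m V := do
  let h ← D.powerCost e x
  arithP .add (D.σ e) h

/-- The total cost of a strategy profile. -/
def totalCost (D : NumInput V N m q) (p : Fin N → Finset (Fin m)) : Prog V N m V :=
  sumEach m fun e => do
    let l ← sumIf N (fun i => decide (e ∈ p i)) (fun i => D.w i e)
    let z ← natP 0
    let b ← leP l z
    if b then natP 0 else D.positiveCost e l

/-- One sample: the marginal contribution of player `i` to the cost `∑ j, ξ_{e,j} l ^ α_j` of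
resource `e`, when the players that use `e` according to `p`, and `i`, arrive in random order. -/
def marginalSample (D : NumInput V N m q) (p : Fin N → Finset (Fin m)) (i : Fin N) (e : Fin m) :
    Prog V N m V := do
  let π ← randPerm N
  let l ← sumIf N (fun k => decide (e ∈ p k ∧ π k < π i)) (fun k => D.w k e)
  let l' ← arithP .add l (D.w i e)
  let h ← D.powerCost e l
  let h' ← D.powerCost e l'
  arithP .sub h' h

/-- `SV-Sample`: the median of `reps` independent means of `samples` samples each. -/
def svSample (D : NumInput V N m q) (samples reps : ℕ) (p : Fin N → Finset (Fin m))
    (i : Fin N) (e : Fin m) : Prog V N m V := do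
  let x ← forEach reps fun _ => do
    let s ← sumEach samples fun _ => D.marginalSample p i e
    let c ← natP samples
    arithP .div s c
  median reps x

/-- `Shapley-APX`: an estimate of the Shapley cost share of player `i` in resource `e` when the
players using `e` are `i` and those that use it according to `p`. -/
def shapleyAPX (D : NumInput V N m q) (samples reps : ℕ) (p : Fin N → Finset (Fin m))
    (i : Fin N) (e : Fin m) : Prog V N m V := do
  let θ ← D.svSample samples reps p i e
  let s ← sumEach N fun k => tick (if e ∈ p k ∨ k = i then natP 1 else natP 0)
  let u ← arithP .div (D.σ e) s
  arithP .add u θ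

/-- The approximate best response step of player `i` to the other players' strategies in `p`, for
the cost shares estimated by `share`: the oracle is called with the estimated cost shares as tolls.
The result is the reply `p'_i` and
`δ_i = (estimated cost of p_i) - ε₁ * (estimated cost of p'_i)`. -/
def response (share : (Fin N → Finset (Fin m)) → Fin N → Fin m → Prog V N m V) (ε₁ : V)
    (p : Fin N → Finset (Fin m)) (i : Fin N) : Prog V N m (Finset (Fin m) × V) := do
  let τ ← forEach m fun e => share p i e
  let r ← oracleP i τ
  let old ← sumIf m (fun e => decide (e ∈ p i)) τ
  let new ← sumIf m (fun e => decide (e ∈ r)) τ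
  let s ← arithP .mul ε₁ new
  let δ ← arithP .sub old s
  ret (r, δ)

/-- The approximate best response dynamic: at most `T` further iterations from the profile `p`;
`best` is the cheapest profile so far and `c` is its total cost. -/
def dynamics (D : NumInput V N m q)
    (share : (Fin N → Finset (Fin m)) → Fin N → Fin m → Prog V N m V) (ε₁ : V) :
    (T : ℕ) → (p best : Fin N → Finset (Fin m)) → (c : V) → Prog V N m (Fin N → Finset (Fin m))
  | 0, _, best, _ => ret best
  | T + 1, p, best, c => tick do
      let x : Fin N → Finset (Fin m) × V ← forEach N fun i => response share ε₁ p i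
      let zero ← natP 0
      let improving ← findFirst N fun i => do
        let b ← leP (x i).2 zero
        ret (!b)
      match improving with
      | none => ret best
      | some _ => do
        let Δ ← sumEach N fun i => ret (x i).2
        let n ← natP N
        let avg ← arithP .div Δ n
        let pick ← findFirst N fun i => do
          let b ← leP (x i).2 zero
          let b' ← leP avg (x i).2
          ret (!b && b')
        match pick with
        | none => ret best
        | some j => do
          let p' := Function.update p j (x j).1
          ticks (2 * (N * m))
          let c' ← D.totalCost p'
          let b ← leP c c'
          if b then D.dynamics share ε₁ T p' best c
          else D.dynamics share ε₁ T p' p' c'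

/-- `Alg-ABRD`, for the cost shares estimated by `share` and at most `T` iterations. -/
def algABRD (D : NumInput V N m q)
    (share : (Fin N → Finset (Fin m)) → Fin N → Fin m → Prog V N m V) (ε₁ : V) (T : ℕ) :
    Prog V N m (Fin N → Finset (Fin m)) := do
  let p ← forEach N fun i => do
    let τ ← forEach m fun e => D.positiveCost e (D.w i e)
    oracleP i τ
  let c ← D.totalCost p
  D.dynamics share ε₁ T p p c

end NumInput

/-! ### The parameters of the algorithm for the Shapley cost sharing mechanism -/

/-- `ε₁ = (1 + ε) / (1 - ε)` -/
noncomputable def epsOne (ε : ℝ) : ℝ := (1 + ε) / (1 - ε)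

/-- The number of iterations `T = ⌈Q ln (A B N ^ (max_j α_j))⌉` with
`Q = 2 ε₁ N A / (1 - ϱ ε₁² μ)`, where `A = H_N`, `B = ⌈max_j α_j⌉` and `μ = 1 / (2 ϱ)`. -/
noncomputable def numIterations {q : ℕ} (α : Fin q → ℝ) (ε : ℝ) (N : ℕ) : ℕ :=
  ⌈2 * epsOne ε * N * (harmonic N : ℝ) / (1 - epsOne ε ^ 2 / 2) *
    Real.log ((harmonic N : ℝ) * (⌈⨆ j, α j⌉₊ : ℝ) * (N : ℝ) ^ (⨆ j, α j))⌉₊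

/-- The number of samples in a mean. -/
noncomputable def numSamples (ε : ℝ) (N : ℕ) : ℕ := ⌈16 * (N : ℝ) ^ 2 / ε ^ 2⌉₊

/-- The number of means, for a failure probability of `1 / (2 (T N m) ^ 2 (N + m) ^ b)`. -/
def numReps (T N m b : ℕ) : ℕ := Nat.clog 2 (2 * (T * N * m) ^ 2 * (N + m) ^ b)

namespace GNDInstance

open Prog

variable {R : RequestFamily} {q : ℕ} (I : GNDInstance R q)

/-- The numerical input of the algorithm. -/
noncomputable def numInput (α : Fin q → ℝ) : NumInput ℝ I.N I.m q where
  α := α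
  w := fun i e => (I.w i e : ℝ)
  σ := I.σ
  ξ := I.ξ

/-- The oracle, on the requests of the instance. -/
def oracleOn (O : (m : ℕ) → List Bool → (Fin m → ℝ) → Finset (Fin m)) :
    Fin I.N → (Fin I.m → ℝ) → Finset (Fin I.m) :=
  fun i τ => O I.m (I.req i) τ

/-- `Shapley-APX` with accuracy `ε` and confidence parameter `b`. -/
noncomputable def shapleyAPX (α : Fin q → ℝ) (ε : ℝ) (b : ℕ) (p : Fin I.N → Finset (Fin I.m))
    (i : Fin I.N) (e : Fin I.m) : Prog ℝ I.N I.m ℝ :=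
  (I.numInput α).shapleyAPX (numSamples ε I.N)
    (numReps (numIterations α ε I.N) I.N I.m b) p i e

/-- `Alg-ABRD` with the Shapley cost sharing mechanism. The loop bounds are determined first, by
counting. -/
noncomputable def algShapley (α : Fin q → ℝ) (ε : ℝ) (b : ℕ) :
    Prog ℝ I.N I.m (Fin I.N → Finset (Fin I.m)) := do
  ticks (I.N + numIterations α ε I.N + numSamples ε I.N +
    numReps (numIterations α ε I.N) I.N I.m b)
  (I.numInput α).algABRD (I.shapleyAPX α ε b) (epsOne ε) (numIterations α ε I.N)

/-- The output profiles whose total cost is within the factor `r` of the optimum. -/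
def approxOptimal (α : Fin q → ℝ) (r : ℝ) : Set (Fin I.N → Finset (Fin I.m)) :=
  {p | I.Feasible p ∧ ∀ p', I.Feasible p' → I.totalCost α p ≤ r * I.totalCost α p'}

end GNDInstance

/-! ### Expectations, failure probabilities and running times of programs -/

namespace Prog

variable {N m : ℕ} {A B : Type}

/-! On each resource the cost is a cooperative game on its users. The Shapley share of a player is
the discrete derivative of the Hart-Mas-Colell potential of that game, so the sum `potential` over
all resources is an exact potential: a unilateral move changes it by precisely the mover's change of
share (`potential_sub_update`). It is comparable to the cost, C ≤ BΦ and Φ ≤ H_N C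
(`totalCost_le_potential`, `potential_le`).

The game is also smooth (`sum_joinShare_le`): if every player evaluates its reply in p' against the
others' choices in p, the shares sum to at most λ C(p') + C(p)/(2ϱ), where λ is (5Aϱ)^A plus the
startup ratio. Hence, as long as C(p) exceeds the target, the estimated gains from the oracle's
replies add up to a constant fraction of C(p). A player with at least average gain then shrinks the
potential by a factor 1 - 1/Z with Z = O(N H_N). The initial profile costs at most ϱ N^A times the
optimum, so T = ⌈Z ln(H_N B N^A)⌉ rounds push the potential below the target unless a good profile
was met before or no player gains, in which case smoothness bounds the current cost
(`failProb_dynamics_le`).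

For the estimates, convexity makes the last arrival the most expensive one, and a given player
arrives last among the users with probability at least 1/N. A sample is therefore at most N times
its mean μ, its variance is at most Nμ², Chebyshev makes a mean of 16N²/ε² samples accurate with
probability 15/16, and the median of k means fails with probability at most 2^(-k)
(`failProb_shapleyAPX_le`). A union bound over the T·N·m estimates gives the success probabilities.
Feasibility needs no luck: every estimate is positive, and the oracle answers positive tolls by a
reply.

Probabilities are handled through the recursively defined `expect` and `failProb`;
`law_outerMeasure_toReal` links them to the law of a program. Running times follow from the additive
bound `time_bind_le` and the sizes of T, the samples and the repetitions. -/

@[simp] lemma bind_eq {V : Type} (P : Prog V N m A) (f : A → Prog V N m B) :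
    (P >>= f) = P.bind f := rfl

variable (O : Fin N → (Fin m → ℝ) → Finset (Fin m))

/-- The expectation of `g` over the output of a program. -/
noncomputable def expect : Prog ℝ N m A → (A → ℝ) → ℝ
  | ret a, g => g a
  | tick k, g => expect k g
  | nat n k, g => expect (k n) g
  | arith o x y k, g => expect (k (o.eval x y)) g
  | le x y k, g => expect (k (open Classical in decide (x ≤ y))) g
  | rand n k, g => (∑ v, expect (k v) g) / (n + 1)
  | oracle i τ k, g => expect (k (O i τ)) g

@[simp] lemma expect_ret (a : A) (g : A → ℝ) : expect O (ret a) g = g a := rfl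
@[simp] lemma expect_tick (k : Prog ℝ N m A) (g : A → ℝ) :
    expect O (tick k) g = expect O k g := rfl
@[simp] lemma expect_rand (n : ℕ) (k : Fin (n + 1) → Prog ℝ N m A) (g : A → ℝ) :
    expect O (rand n k) g = (∑ v, expect O (k v) g) / (n + 1) := rfl
@[simp] lemma expect_natP (n : ℕ) (g : ℝ → ℝ) : expect O (natP n) g = g n := rfl
@[simp] lemma expect_arithP (o : ArithOp) (x y : ℝ) (g : ℝ → ℝ) :
    expect O (arithP o x y) g = g (o.eval x y) := rfl
@[simp] lemma expect_leP (x y : ℝ) (g : Bool → ℝ) :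
    expect O (leP x y) g = g (decide (x ≤ y)) := by
  simp only [leP, expect]
@[simp] lemma expect_oracleP (i : Fin N) (τ : Fin m → ℝ) (g : Finset (Fin m) → ℝ) :
    expect O (oracleP i τ) g = g (O i τ) := rfl

@[simp] lemma expect_bind (P : Prog ℝ N m A) (f : A → Prog ℝ N m B) (g : B → ℝ) :
    expect O (P.bind f) g = expect O P fun a => expect O (f a) g := by
  induction P with
  | ret a => rfl
  | tick k ih => exact ih
  | nat n k ih => exact ih _
  | arith o x y k ih => exact ih _
  | le x y k ih => exact ih _
  | rand n k ih => simp only [bind, expect, ih]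
  | oracle i τ k ih => exact ih _

lemma expect_mono (P : Prog ℝ N m A) {g h : A → ℝ} (H : ∀ a, g a ≤ h a) :
    expect O P g ≤ expect O P h := by
  induction P with
  | ret a => exact H a
  | tick k ih => exact ih
  | nat n k ih => exact ih _
  | arith o x y k ih => exact ih _
  | le x y k ih => exact ih _
  | rand n k ih =>
    simp only [expect]
    gcongr with v
    exact ih v
  | oracle i τ k ih => exact ih _

lemma expect_add (P : Prog ℝ N m A) (g h : A → ℝ) :
    expect O P (fun a => g a + h a) = expect O P g + expect O P h := by
  induction P with
  | ret a => rfl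
  | tick k ih => exact ih
  | nat n k ih => exact ih _
  | arith o x y k ih => exact ih _
  | le x y k ih => exact ih _
  | rand n k ih => simp only [expect, ih, Finset.sum_add_distrib, add_div]
  | oracle i τ k ih => exact ih _

lemma expect_const_mul (P : Prog ℝ N m A) (c : ℝ) (g : A → ℝ) :
    expect O P (fun a => c * g a) = c * expect O P g := by
  induction P with
  | ret a => rfl
  | tick k ih => exact ih
  | nat n k ih => exact ih _
  | arith o x y k ih => exact ih _
  | le x y k ih => exact ih _
  | rand n k ih => simp only [expect, ih, ← Finset.mul_sum, mul_div_assoc]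
  | oracle i τ k ih => exact ih _

@[simp] lemma expect_const (P : Prog ℝ N m A) (c : ℝ) : expect O P (fun _ => c) = c := by
  induction P with
  | ret a => rfl
  | tick k ih => exact ih
  | nat n k ih => exact ih _
  | arith o x y k ih => exact ih _
  | le x y k ih => exact ih _
  | rand n k ih =>
    simp only [expect, ih, Finset.sum_const, Finset.card_univ, Fintype.card_fin, nsmul_eq_mul]
    push_cast
    field_simp
  | oracle i τ k ih => exact ih _

lemma expect_mul_const (P : Prog ℝ N m A) (c : ℝ) (g : A → ℝ) :
    expect O P (fun a => g a * c) = expect O P g * c := by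
  simpa only [mul_comm] using expect_const_mul O P c g

open Classical in
/-- The probability that the output of a program violates `Q`. -/
noncomputable def failProb (P : Prog ℝ N m A) (Q : A → Prop) : ℝ :=
  expect O P fun a => if Q a then 0 else 1

lemma failProb_nonneg (P : Prog ℝ N m A) (Q : A → Prop) : 0 ≤ failProb O P Q := by
  rw [← expect_const O P 0]
  exact expect_mono O P fun a => by split_ifs <;> norm_num

lemma failProb_le_one (P : Prog ℝ N m A) (Q : A → Prop) : failProb O P Q ≤ 1 := by
  rw [← expect_const O P 1]
  exact expect_mono O P fun a => by split_ifs <;> norm_num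

lemma failProb_mono (P : Prog ℝ N m A) {Q Q' : A → Prop} (h : ∀ a, Q a → Q' a) :
    failProb O P Q' ≤ failProb O P Q :=
  expect_mono O P fun a => by
    by_cases h1 : Q a
    · simp [h1, h a h1]
    · simp only [h1, if_false]; split_ifs <;> norm_num

lemma failProb_and_le (P : Prog ℝ N m A) (Q Q' : A → Prop) :
    failProb O P (fun a => Q a ∧ Q' a) ≤ failProb O P Q + failProb O P Q' := by
  unfold failProb
  rw [← expect_add]
  exact expect_mono O P fun a => by
    by_cases h1 : Q a <;> by_cases h2 : Q' a <;> simp [h1, h2]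

@[simp] lemma failProb_tick (P : Prog ℝ N m A) (Q : A → Prop) :
    failProb O (tick P) Q = failProb O P Q := rfl

lemma failProb_ret {a : A} {Q : A → Prop} (h : Q a) : failProb O (ret a) Q = 0 := by
  simp [failProb, h]

/-- The union bound for sequential composition. -/
lemma failProb_bind_le {P : Prog ℝ N m A} {f : A → Prog ℝ N m B} (Q : A → Prop) {Q' : B → Prop}
    {δ δ' : ℝ} (hP : failProb O P Q ≤ δ) (hf : ∀ a, Q a → failProb O (f a) Q' ≤ δ')
    (hδ' : 0 ≤ δ') : failProb O (P.bind f) Q' ≤ δ + δ' := by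
  unfold failProb at hP ⊢
  rw [expect_bind]
  refine le_trans (expect_mono O P (h := fun a => (open Classical in if Q a then 0 else 1) + δ')
    fun a => ?_) ?_
  · by_cases h : Q a
    · simpa [h, failProb] using hf a h
    · simp only [h, if_false]
      have := failProb_le_one O (f a) Q'
      unfold failProb at this
      linarith
  · rw [expect_add, expect_const]
    linarith

/-- If `P` deterministically outputs `a`, then `P.bind f` behaves like `f a`. -/
lemma failProb_bind_eq {P : Prog ℝ N m A} {f : A → Prog ℝ N m B} {a : A}
    (hP : ∀ g, expect O P g = g a) (Q : B → Prop) :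
    failProb O (P.bind f) Q = failProb O (f a) Q := by
  unfold failProb
  rw [expect_bind, hP]

lemma toReal_tsum_uniform {n : ℕ} (f : Fin (n + 1) → ENNReal) (hf : ∀ v, f v ≠ ⊤) :
    (∑' v, PMF.uniformOfFintype (Fin (n + 1)) v * f v).toReal = (∑ v, (f v).toReal) / (n + 1) := by
  rw [tsum_fintype, ENNReal.toReal_sum fun v _ => ENNReal.mul_ne_top (by simp) (hf v),
    Finset.sum_div]
  refine Finset.sum_congr rfl fun v _ => ?_
  rw [ENNReal.toReal_mul]
  simp only [PMF.uniformOfFintype_apply, Fintype.card_fin, ENNReal.toReal_inv]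
  rw [div_eq_inv_mul]
  congr 2
  norm_cast

lemma law_outerMeasure_toReal (P : Prog ℝ N m A) (s : Set A) :
    ((P.law O).toOuterMeasure s).toReal = 1 - failProb O P (· ∈ s) := by
  classical
  have key : ((P.law O).toOuterMeasure s).toReal =
      expect O P fun a => if a ∈ s then 1 else 0 := by
    induction P with
    | ret a =>
      simp only [law, expect, PMF.toOuterMeasure_pure_apply]
      split_ifs <;> simp
    | tick k ih => exact ih
    | nat n k ih => exact ih _
    | arith o x y k ih => exact ih _
    | le x y k ih => exact ih _
    | rand n k ih =>
      simp only [law, expect, PMF.toOuterMeasure_bind_apply]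
      rw [toReal_tsum_uniform]
      · simp only [ih]
      · intro v
        refine ne_top_of_le_ne_top ENNReal.one_ne_top ?_
        rw [PMF.toOuterMeasure_apply]
        refine le_trans (ENNReal.tsum_le_tsum fun a => Set.indicator_le_self _ _ a) ?_
        rw [PMF.tsum_coe]
    | oracle i τ k ih => exact ih _
  rw [key, eq_sub_iff_add_eq]
  unfold failProb
  rw [← expect_add, ← expect_const O P 1]
  congr 1
  funext a
  split_ifs <;> simp

/-- The complement of `{a}` has probability one if `a` violates `Q`, so it contains the support.
This turns failure probability zero into a statement about every possible output. -/
lemma of_mem_support_law {P : Prog ℝ N m A} {Q : A → Prop} (h : failProb O P Q = 0) {a : A}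
    (ha : a ∈ (P.law O).support) : Q a := by
  by_contra hQ
  have h1 := law_outerMeasure_toReal O P {a}ᶜ
  have h2 : failProb O P (· ∈ ({a}ᶜ : Set A)) = 0 :=
    le_antisymm (h ▸ failProb_mono O P fun x hx hxa => hQ (hxa ▸ hx)) (failProb_nonneg O P _)
  rw [h2, sub_zero, ENNReal.toReal_eq_one_iff, PMF.toOuterMeasure_apply_eq_one_iff] at h1
  exact h1 ha rfl

/-! #### Running times -/

/-- The worst case over draws sees only reachable outputs, so the continuation has to be bounded
only where a property of probability one holds. Sorting needs this: the cost of an insertion depends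
on the length of the list sorted so far. -/
lemma time_bind_le_of_failProb (c : ℕ) {P : Prog ℝ N m A} {f : A → Prog ℝ N m B} {Q : A → Prop}
    {b : ℕ} (hP : failProb O P Q = 0) (hf : ∀ a, Q a → time O c (f a) ≤ b) :
    time O c (P.bind f) ≤ time O c P + b := by
  induction P with
  | ret a =>
    simp only [bind, time, zero_add]
    refine hf a ?_
    by_contra h
    simp [failProb, h] at hP
  | tick k ih =>
    have := ih hP
    simp only [bind, time]; omega
  | nat n k ih =>
    have := ih _ hP
    simp only [bind, time]; omega
  | arith o x y k ih =>
    have := ih _ hP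
    simp only [bind, time]; omega
  | le x y k ih =>
    have := ih _ hP
    simp only [bind, time]; omega
  | rand n k ih =>
    -- An average of nonnegative numbers vanishes only if each of them does, so probability zero
    -- passes to every branch of the draw.
    have h0 : ∀ v, failProb O (k v) Q = 0 := by
      rw [failProb, expect_rand, div_eq_zero_iff, or_iff_left (by positivity)] at hP
      change ∑ v, failProb O (k v) Q = 0 at hP
      rw [Finset.sum_eq_zero_iff_of_nonneg fun v _ => failProb_nonneg O (k v) Q] at hP
      exact fun v => hP v (Finset.mem_univ v)
    have h1 : ∀ v, time O c ((k v).bind f) ≤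
        (Finset.univ.sup fun v => time O c (k v)) + b := fun v =>
      (ih v (h0 v)).trans (Nat.add_le_add_right
        (Finset.le_sup (f := fun v => time O c (k v)) (Finset.mem_univ v)) b)
    have h2 : (Finset.univ.sup fun v => time O c ((k v).bind f)) ≤
        (Finset.univ.sup fun v => time O c (k v)) + b := Finset.sup_le fun v _ => h1 v
    simp only [bind, time]
    omega
  | oracle i τ k ih =>
    have := ih _ hP
    simp only [bind, time]; omega

lemma time_bind_le (c : ℕ) {P : Prog ℝ N m A} {f : A → Prog ℝ N m B} {a b : ℕ}
    (hP : time O c P ≤ a) (hf : ∀ x, time O c (f x) ≤ b) : time O c (P.bind f) ≤ a + b :=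
  (time_bind_le_of_failProb O c (Q := fun _ => True) (by simp [failProb])
    fun x _ => hf x).trans (Nat.add_le_add_right hP b)

@[simp] lemma time_ret (c : ℕ) (a : A) : time O c (ret a) = 0 := rfl
@[simp] lemma time_tick (c : ℕ) (P : Prog ℝ N m A) : time O c (tick P) = time O c P + 1 := rfl
@[simp] lemma time_natP (c n : ℕ) : time O c (natP n) = 1 := rfl
@[simp] lemma time_arithP (c : ℕ) (o : ArithOp) (x y : ℝ) : time O c (arithP o x y) = 1 := rfl
@[simp] lemma time_leP (c : ℕ) (x y : ℝ) : time O c (leP x y) = 1 := rfl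
@[simp] lemma time_oracleP (c : ℕ) (i : Fin N) (τ : Fin m → ℝ) :
    time O c (oracleP i τ) = c := by simp [oracleP, time]

lemma time_ticks (c n : ℕ) : time O c (ticks n) = n := by
  induction n with
  | zero => rfl
  | succ n ih => simp [ticks, ih]

@[simp] lemma expect_ticks (n : ℕ) (g : Unit → ℝ) : expect O (ticks n) g = g () := by
  induction n with
  | zero => rfl
  | succ n ih => simpa [ticks] using ih

lemma time_forEach_le (c : ℕ) {a : ℕ} {n : ℕ} {f : Fin n → Prog ℝ N m A}
    (h : ∀ i, time O c (f i) ≤ a) : time O c (forEach n f) ≤ n * (a + 1) := by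
  induction n with
  | zero => simp [forEach]
  | succ n ih =>
    simp only [forEach, time_tick, bind_eq]
    have := time_bind_le O c (h 0) (f := fun x => (forEach n fun i => f i.succ).bind fun r =>
      (ret (Fin.cons x r : Fin (n + 1) → A))) (b := n * (a + 1)) fun x =>
        time_bind_le O c (b := 0) (ih fun i => h i.succ) fun r => le_rfl
    refine (Nat.succ_le_succ this).trans (le_of_eq ?_)
    simp only [Nat.succ_eq_add_one]
    ring

lemma time_sumEach_le (c : ℕ) {a : ℕ} {n : ℕ} {f : Fin n → Prog ℝ N m ℝ}
    (h : ∀ i, time O c (f i) ≤ a) : time O c (sumEach n f) ≤ n * (a + 2) + 1 := by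
  induction n with
  | zero => simp [sumEach]
  | succ n ih =>
    simp only [sumEach, time_tick, bind_eq]
    have := time_bind_le O c (h 0) (f := fun x => (sumEach n fun i => f i.succ).bind fun s =>
      arithP .add x s) (b := n * (a + 2) + 1 + 1) fun x =>
        time_bind_le O c (ih fun i => h i.succ) fun r => le_rfl
    refine (Nat.succ_le_succ this).trans (le_of_eq ?_)
    simp only [Nat.succ_eq_add_one]
    ring

lemma time_sumIf_le (c n : ℕ) (b : Fin n → Bool) (f : Fin n → ℝ) :
    time O c (sumIf n b f : Prog ℝ N m ℝ) ≤ 4 * n + 1 := by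
  have := time_sumEach_le O c (a := 2) (n := n)
    (f := fun i => tick (if b i then ret (f i) else natP 0)) fun i => by
      split_ifs <;> simp
  unfold sumIf
  omega

lemma time_findFirst_le (c : ℕ) {a : ℕ} {n : ℕ} {f : Fin n → Prog ℝ N m Bool}
    (h : ∀ i, time O c (f i) ≤ a) : time O c (findFirst n f) ≤ n * (a + 1) := by
  induction n with
  | zero => simp [findFirst]
  | succ n ih =>
    simp only [findFirst, time_tick, bind_eq]
    have := time_bind_le O c (h 0) (f := fun b => if b = true then ret (some 0) else
      (findFirst n fun i => f i.succ).bind fun r => (ret (r.map Fin.succ) : Prog ℝ N m _))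
      (b := n * (a + 1)) fun b => by
        split_ifs
        · simp
        · exact time_bind_le O c (b := 0) (ih fun i => h i.succ) fun r => le_rfl
    refine (Nat.succ_le_succ this).trans (le_of_eq ?_)
    simp only [Nat.succ_eq_add_one]
    ring

lemma time_randPerm_le (c n : ℕ) : time O c (randPerm n) ≤ 2 * n := by
  induction n with
  | zero => simp [randPerm]
  | succ n ih =>
    simp only [randPerm, bind_eq, time]
    have : (Finset.univ.sup fun v : Fin (n + 1) => time O c (((randPerm n).bind fun π =>
        (ret (Equiv.Perm.decomposeFin.symm (v, π)) : Prog ℝ N m _))) + 1) ≤ 2 * n + 1 := by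
      refine Finset.sup_le fun v _ => ?_
      have := time_bind_le O c ih (b := 0) (f := fun π =>
        (ret (Equiv.Perm.decomposeFin.symm (v, π)) : Prog ℝ N m _)) fun π => le_rfl
      omega
    omega

/-! #### Outputs of the deterministic building blocks -/

@[simp] lemma expect_sumIf (n : ℕ) (b : Fin n → Bool) (f : Fin n → ℝ) (g : ℝ → ℝ) :
    expect O (sumIf n b f) g = g (∑ i, if b i then f i else 0) := by
  unfold sumIf
  induction n generalizing g with
  | zero => simp [sumEach]
  | succ n ih =>
    simp only [sumEach, bind_eq, expect_tick, expect_bind]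
    cases h : b 0 <;> simp [ih, Fin.sum_univ_succ, h, ArithOp.eval]

lemma expect_sumEach_det {n : ℕ} {f : Fin n → Prog ℝ N m ℝ} {x : Fin n → ℝ}
    (h : ∀ i g, expect O (f i) g = g (x i)) (g : ℝ → ℝ) :
    expect O (sumEach n f) g = g (∑ i, x i) := by
  induction n generalizing g with
  | zero => simp [sumEach]
  | succ n ih =>
    simp only [sumEach, bind_eq, expect_tick, expect_bind, h]
    rw [ih fun i => h i.succ]
    simp [Fin.sum_univ_succ, ArithOp.eval]

lemma expect_forEach_det {n : ℕ} {f : Fin n → Prog ℝ N m A} {x : Fin n → A}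
    (h : ∀ i g, expect O (f i) g = g (x i)) (g : (Fin n → A) → ℝ) :
    expect O (forEach n f) g = g x := by
  induction n with
  | zero =>
    simp only [forEach, expect_ret]
    congr 1
    exact Subsingleton.elim _ _
  | succ n ih =>
    simp only [forEach, bind_eq, expect_tick, expect_bind, h, expect_ret]
    rw [ih fun i => h i.succ]
    congr 1
    exact Fin.cons_self_tail x

/-- Minimality of the index found is not recorded: the analysis of the dynamics only uses that it
passes the test, and that `none` means that all tests fail. -/
lemma expect_findFirst {n : ℕ} {f : Fin n → Prog ℝ N m Bool} {b : Fin n → Bool}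
    (h : ∀ i g, expect O (f i) g = g (b i)) :
    ∃ r : Option (Fin n), (r = none → ∀ i, b i = false) ∧ (∀ j, r = some j → b j = true) ∧
      ∀ g, expect O (findFirst n f) g = g r := by
  induction n with
  | zero => exact ⟨none, fun _ i => i.elim0, fun j => j.elim0, fun g => rfl⟩
  | succ n ih =>
    obtain ⟨r, h1, h2, h3⟩ := ih fun i => h i.succ
    cases hb : b 0 with
    | true =>
      exact ⟨some 0, by simp, by simp [hb], fun g => by
        simp [findFirst, h, hb]⟩
    | false =>
      refine ⟨r.map Fin.succ, fun hr i => ?_, fun j hj => ?_, fun g => by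
        simp [findFirst, h, hb, h3]⟩
      · refine Fin.cases hb (fun i => h1 (by simpa using hr) i) i
      · obtain ⟨j', hj', rfl⟩ := Option.map_eq_some_iff.1 hj
        exact h2 j' hj'

lemma failProb_forEach_le {n : ℕ} {f : Fin n → Prog ℝ N m A} {Q : Fin n → A → Prop} {δ : ℝ}
    (h : ∀ i, failProb O (f i) (Q i) ≤ δ) :
    failProb O (forEach n f) (fun x => ∀ i, Q i (x i)) ≤ n * δ := by
  induction n with
  | zero => simp [forEach, failProb]
  | succ n ih =>
    have hδ : 0 ≤ δ := (failProb_nonneg O _ _).trans (h 0)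
    simp only [forEach, bind_eq, failProb_tick]
    refine (failProb_bind_le O (Q 0) (h 0) (δ' := n * δ) (fun a ha => ?_) (by positivity)).trans
      (by push_cast; linarith)
    refine (failProb_bind_le O _ (ih fun i => h i.succ) (δ' := 0) (fun x hx => ?_) le_rfl).trans
      (by simp)
    exact (failProb_ret O (Fin.cases ha hx)).le

/-- `Equiv.Perm.decomposeFin` is a bijection between permutations of n + 1 points and pairs of an
index and a permutation of n points, so independent uniform components give a uniform permutation.
-/
lemma expect_randPerm (n : ℕ) (g : Equiv.Perm (Fin n) → ℝ) :
    expect O (randPerm n) g = (∑ π, g π) / (n.factorial : ℝ) := by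
  induction n with
  | zero =>
    simp only [randPerm, expect_ret, Nat.factorial_zero, Nat.cast_one, div_one]
    rw [Fintype.sum_subsingleton _ (1 : Equiv.Perm (Fin 0))]
  | succ n ih =>
    simp only [randPerm, bind_eq, expect_rand, expect_tick, expect_bind, expect_ret, ih]
    rw [← Finset.sum_div, div_div, Nat.factorial_succ, ← Fintype.sum_prod_type',
      Equiv.sum_comp Equiv.Perm.decomposeFin.symm g]
    push_cast
    rw [mul_comm]

/-! #### Sorting and medians -/

lemma expect_insertP (x : ℝ) (l : List ℝ) (g : List ℝ → ℝ) :
    expect O (insertP x l) g = g (l.orderedInsert (· ≤ ·) x) := by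
  induction l generalizing g with
  | nil => rfl
  | cons y ys ih =>
    simp only [insertP, bind_eq, expect_tick, expect_bind, expect_leP,
      List.orderedInsert_cons]
    by_cases h : x ≤ y <;> simp [h, ih]

lemma expect_sortP (l : List ℝ) (g : List ℝ → ℝ) :
    expect O (sortP l) g = g (l.insertionSort (· ≤ ·)) := by
  induction l generalizing g with
  | nil => rfl
  | cons x xs ih => simp [sortP, ih, expect_insertP]

lemma time_insertP_le (c : ℕ) (x : ℝ) (l : List ℝ) : time O c (insertP x l) ≤ 2 * l.length := by
  induction l with
  | nil => simp [insertP]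
  | cons y ys ih =>
    simp only [insertP, bind_eq, time_tick, List.length_cons]
    have := time_bind_le O c (P := leP x y) (a := 1) (b := 2 * ys.length) (by simp)
      (f := fun b => if b = true then ret (x :: y :: ys) else
        (insertP x ys).bind fun zs => (ret (y :: zs) : Prog ℝ N m _)) fun b => by
        split_ifs
        · simp
        · exact time_bind_le O c (b := 0) ih fun _ => le_rfl
    omega

lemma time_sortP_le (c : ℕ) (l : List ℝ) : time O c (sortP l) ≤ 3 * l.length ^ 2 := by
  induction l with
  | nil => simp [sortP]
  | cons x xs ih =>
    simp only [sortP, bind_eq, time_tick, List.length_cons]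
    have := time_bind_le_of_failProb O c (P := sortP xs) (f := fun ys => insertP x ys)
      (Q := fun l => l.length = xs.length) (b := 2 * xs.length)
      (by unfold failProb; rw [expect_sortP]; simp [List.length_insertionSort])
      fun l hl => hl ▸ time_insertP_le O c x l
    nlinarith

lemma time_median_le (c k : ℕ) (x : Fin k → ℝ) :
    time O c (median k x) ≤ k + 3 * k ^ 2 + 1 := by
  simp only [median, bind_eq]
  rw [add_assoc]
  refine time_bind_le O c (time_ticks O c k).le fun _ => time_bind_le O c ?_ fun l => ?_
  · simpa using time_sortP_le O c (List.ofFn x)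
  · cases l.drop (k / 2) <;> simp

/-- The median of `k` numbers lies in an order-connected set that contains more than half of
them. -/
lemma exists_median {k : ℕ} (hk : 0 < k) (x : Fin k → ℝ) :
    ∃ y ∈ Set.range x, (∀ g, expect O (median k x) g = g y) ∧
      ∀ lo hi : ℝ, 2 * (Finset.univ.filter fun i => x i ∉ Set.Icc lo hi).card < k →
        y ∈ Set.Icc lo hi := by
  set L := (List.ofFn x).insertionSort (· ≤ ·) with hL
  have hlen : L.length = k := by rw [hL, List.length_insertionSort, List.length_ofFn]
  have hk2 : k / 2 < L.length := by omega
  have hperm : L.Perm (List.ofFn x) := List.perm_insertionSort _ _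
  have hsort : L.Pairwise (· ≤ ·) := List.pairwise_insertionSort _ _
  have hcount : ∀ p : ℝ → Prop, [DecidablePred p] →
      (Finset.univ.filter fun i => p (x i)).card = L.countP (fun a => decide (p a)) := by
    intro p _
    rw [hperm.countP_eq, List.ofFn_eq_map, List.countP_map, List.countP_eq_length_filter,
      Finset.card_def, Finset.filter_val]
    simp only [Fin.univ_def]
    rfl
  refine ⟨L[k / 2], by simpa using hperm.mem_iff.1 (L.getElem_mem hk2), fun g => ?_, fun lo hi h => ?_⟩
  · simp only [median, bind_eq, expect_bind, expect_ticks, expect_sortP, ← hL]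
    rw [List.drop_eq_getElem_cons hk2]
    rfl
  · classical
    rw [hcount (fun a => a ∉ Set.Icc lo hi)] at h
    by_contra hy
    rw [Set.mem_Icc, not_and_or, not_le, not_le] at hy
    rcases hy with hy | hy
    -- A median below `lo` puts the first k/2 + 1 sorted entries outside the interval, and twice
    -- this number exceeds k. A median above `hi` puts the last k - k/2 entries outside, and twice
    -- this number is at least k.
    · have h1 : (L.take (k / 2 + 1)).countP (fun a => decide (a ∉ Set.Icc lo hi)) =
          (L.take (k / 2 + 1)).length := by
        rw [List.countP_eq_length]
        intro a ha
        obtain ⟨i, hi', rfl⟩ := List.mem_iff_getElem.1 ha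
        simp only [List.length_take] at hi'
        simp only [List.getElem_take, Set.mem_Icc, not_and_or, not_le, decide_eq_true_eq]
        left
        refine lt_of_le_of_lt ?_ hy
        exact hsort.rel_get_of_le (a := ⟨i, by omega⟩) (b := ⟨k / 2, hk2⟩)
          (by simp only [Fin.mk_le_mk]; omega)
      have h2 := (List.take_sublist (k / 2 + 1) L).countP_le
        (p := fun a => decide (a ∉ Set.Icc lo hi))
      rw [h1, List.length_take] at h2
      omega
    · have h1 : (L.drop (k / 2)).countP (fun a => decide (a ∉ Set.Icc lo hi)) =
          (L.drop (k / 2)).length := by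
        rw [List.countP_eq_length]
        intro a ha
        obtain ⟨i, hi', rfl⟩ := List.mem_iff_getElem.1 ha
        simp only [List.length_drop] at hi'
        simp only [List.getElem_drop, Set.mem_Icc, not_and_or, not_le, decide_eq_true_eq]
        right
        refine lt_of_lt_of_le hy ?_
        exact hsort.rel_get_of_le (a := ⟨k / 2, hk2⟩) (b := ⟨k / 2 + i, by omega⟩)
          (by simp only [Fin.mk_le_mk]; omega)
      have h2 := (List.drop_sublist (k / 2) L).countP_le
        (p := fun a => decide (a ∉ Set.Icc lo hi))
      rw [h1, List.length_drop] at h2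
      omega

end Prog

/-! ### Random orders and the Shapley value -/

section RandomOrder

open Finset

lemma card_filter_equiv_lt {X : Type*} [Fintype X] (f : Numbering X) (i : X) :
    (univ.filter fun k => f k < f i).card = f i := by
  rw [← Fin.card_Iio (f i)]
  refine card_bij (fun k _ => f k) (by simp) (fun a _ b _ h => f.injective h) fun b hb => ?_
  exact ⟨f.symm b, by simpa using hb, by simp⟩

/-- The right-hand side reduces the count of orders to numberings with a given prefix, which
`card_prefixed` counts. -/
lemma Numbering.filter_lt_eq_iff {X : Type*} [Fintype X] [DecidableEq X] (f : Numbering X)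
    {i : X} {T : Finset X} (hi : i ∉ T) (hT : T.card < Fintype.card X) :
    (univ.filter fun k => f k < f i) = T ↔
      f ∈ prefixed (insert i T) ∧ f.symm ⟨T.card, hT⟩ = i := by
  rw [mem_prefixed, IsPrefix, card_insert_of_notMem hi, Equiv.symm_apply_eq]
  constructor
  · intro h
    have h1 : (f i : ℕ) = T.card := by rw [← h, card_filter_equiv_lt]
    refine ⟨fun x => ?_, Fin.ext h1.symm⟩
    rw [Nat.lt_succ_iff, ← h1, ← h]
    simp only [mem_insert, mem_filter, mem_univ, true_and]
    rw [Fin.val_fin_le, le_iff_eq_or_lt, f.apply_eq_iff_eq]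
  · rintro ⟨h1, h2⟩
    ext x
    have hx := h1 x
    rw [mem_insert] at hx
    simp only [mem_filter, mem_univ, true_and]
    rw [← h2, Fin.lt_def]
    constructor
    · intro h
      rcases hx.2 (h.trans (Nat.lt_succ_self _)) with rfl | h3
      · rw [← h2] at h
        exact absurd h (lt_irrefl _)
      · exact h3
    · intro h
      refine lt_of_le_of_ne (Nat.lt_succ_iff.1 (hx.1 (Or.inr h))) fun h3 => hi ?_
      rw [← f.injective ((Fin.ext h3).trans h2)]
      exact h

/-- The number of numberings in which `T` is the set of predecessors of `i`. -/
lemma Numbering.card_filter_lt_eq {X : Type*} [Fintype X] [DecidableEq X]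
    {i : X} {T : Finset X} (hi : i ∉ T) :
    (univ.filter fun f : Numbering X => (univ.filter fun k => f k < f i) = T).card =
      T.card.factorial * (Fintype.card X - 1 - T.card).factorial := by
  have hT : T.card < Fintype.card X := by
    have := card_le_univ (insert i T)
    rw [card_insert_of_notMem hi] at this
    omega
  have h1 : (univ.filter fun f : Numbering X => (univ.filter fun k => f k < f i) = T) =
      (prefixed (insert i T)).filter fun f => f.symm ⟨T.card, hT⟩ = i := by
    ext f
    simp only [mem_filter, mem_univ, true_and]
    exact filter_lt_eq_iff f hi hT
  -- Numberings with prefix T ∪ {i} are classified by the element in position |T|. Swapping two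
  -- elements of the prefix shows that all |T| + 1 classes have the same size, so the class of i is
  -- the fraction 1/(|T| + 1) of `card_prefixed`.
  have h2 := card_eq_sum_card_fiberwise (s := prefixed (insert i T)) (t := insert i T)
    (f := fun f => f.symm ⟨T.card, hT⟩) fun f hf => by
      rw [mem_coe, (mem_prefixed.1 hf)]
      simp [card_insert_of_notMem hi]
  have h3 : ∀ j ∈ insert i T,
      ((prefixed (insert i T)).filter fun f => f.symm ⟨T.card, hT⟩ = j).card =
        ((prefixed (insert i T)).filter fun f => f.symm ⟨T.card, hT⟩ = i).card := by
    intro j hj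
    have hsw : ∀ x, Equiv.swap i j x ∈ insert i T ↔ x ∈ insert i T := by
      intro x
      rcases eq_or_ne x i with rfl | hxi
      · simpa using hj
      · rcases eq_or_ne x j with rfl | hxj
        · simp [hj]
        · rw [Equiv.swap_apply_of_ne_of_ne hxi hxj]
    have hpre : ∀ f : Numbering X, f ∈ prefixed (insert i T) →
        ((Equiv.swap i j).trans f : Numbering X) ∈ prefixed (insert i T) := by
      intro f hf
      rw [mem_prefixed] at hf ⊢
      intro x
      rw [← hsw x, hf]
      rfl
    refine card_bij' (fun f _ => (Equiv.swap i j).trans f) (fun f _ => (Equiv.swap i j).trans f)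
      (fun f hf => ?_) (fun f hf => ?_) (fun f _ => ?_) (fun f _ => ?_)
    · rw [mem_filter] at hf ⊢
      exact ⟨hpre f hf.1, by simp [hf.2]⟩
    · rw [mem_filter] at hf ⊢
      exact ⟨hpre f hf.1, by simp [hf.2]⟩
    · ext x; simp
    · ext x; simp
  rw [sum_congr rfl h3, sum_const, smul_eq_mul, card_prefixed, card_insert_of_notMem hi,
    Nat.factorial_succ, mul_assoc] at h2
  rw [h1, ← Nat.eq_of_mul_eq_mul_left (Nat.succ_pos _) h2, Nat.sub_sub, Nat.add_comm 1]

/-- The sum over all orders of a function of the set of predecessors of `i`. -/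
lemma sum_perm_filter_lt {X : Type*} [Fintype X] [LinearOrder X] (i : X) (G : Finset X → ℝ) :
    ∑ π : Equiv.Perm X, G (univ.filter fun k => π k < π i) =
      ∑ T ∈ (univ.erase i).powerset,
        ((T.card.factorial * (Fintype.card X - 1 - T.card).factorial : ℕ) : ℝ) * G T := by
  let e : Fin (Fintype.card X) ≃o X := monoEquivOfFin X rfl
  have h1 : ∑ π : Equiv.Perm X, G (univ.filter fun k => π k < π i) =
      ∑ f : Numbering X, G (univ.filter fun k => f k < f i) := by
    refine Fintype.sum_equiv (Equiv.equivCongr (Equiv.refl X) e.symm.toEquiv) _ _ fun π => ?_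
    congr 1
    ext k
    simp
  rw [h1, ← sum_fiberwise_of_maps_to (s := univ) (t := (univ.erase i).powerset)
    (g := fun f : Numbering X => univ.filter fun k => f k < f i)]
  · refine sum_congr rfl fun T hT => ?_
    have hi : i ∉ T := fun h => by simpa using mem_powerset.1 hT h
    rw [← Numbering.card_filter_lt_eq hi, ← nsmul_eq_mul]
    refine sum_eq_card_nsmul fun f hf => ?_
    rw [(mem_filter.1 hf).2]
  · intro f _
    rw [mem_powerset]
    intro k hk
    rw [mem_erase]
    refine ⟨fun h => ?_, mem_univ _⟩
    subst h
    simp at hk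

lemma sum_perm_subtype_filter_lt {N : ℕ} (S : Finset (Fin N)) {i : Fin N}
    (hi : i ∈ S) (G : Finset (Fin N) → ℝ) :
    ∑ π : Equiv.Perm {x // x ∈ S},
        G ((univ.filter fun k => π k < π ⟨i, hi⟩).map (Function.Embedding.subtype _)) =
      ∑ T ∈ (S.erase i).powerset,
        ((T.card.factorial * (S.card - 1 - T.card).factorial : ℕ) : ℝ) * G T := by
  have h := sum_perm_filter_lt (⟨i, hi⟩ : {x // x ∈ S})
    fun T => G (T.map (Function.Embedding.subtype _))
  rw [Fintype.card_coe] at h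
  refine Eq.trans (by congr!) (h.trans ?_)
  refine sum_nbij' (fun T => T.map (Function.Embedding.subtype _))
    (fun T => T.subtype (· ∈ S)) ?_ ?_ ?_ ?_ ?_
  · intro T hT
    rw [mem_powerset] at hT ⊢
    intro x hx
    obtain ⟨y, hy, rfl⟩ := mem_map.1 hx
    have := hT hy
    rw [mem_erase] at this ⊢
    exact ⟨fun h => this.1 (Subtype.ext h), y.2⟩
  · intro T hT
    rw [mem_powerset] at hT ⊢
    intro x hx
    rw [mem_subtype] at hx
    have := hT hx
    rw [mem_erase] at this ⊢
    exact ⟨fun h => this.1 (congrArg Subtype.val h), mem_univ _⟩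
  · intro T _
    ext x
    simp
  · intro T hT
    rw [subtype_map]
    exact filter_true_of_mem fun x hx => mem_of_mem_erase (mem_powerset.1 hT hx)
  · intro T _
    simp

/-- A uniformly random order of `V` induces a uniformly random order of `S`. -/
lemma sum_perm_eq_sum_perm_subtype {N : ℕ} (S : Finset (Fin N)) {i : Fin N} (hi : i ∈ S)
    (G : Finset (Fin N) → ℝ) :
    (∑ π : Equiv.Perm (Fin N), G (S.filter fun k => π k < π i)) / (N.factorial : ℝ) =
      (∑ π : Equiv.Perm {x // x ∈ S},
        G ((univ.filter fun k => π k < π ⟨i, hi⟩).map (Function.Embedding.subtype _))) /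
        (S.card.factorial : ℝ) := by
  -- Double counting over pairs (π, s), with the order π precomposed with a permutation s of S. For
  -- fixed π the induced orders of S run through all orders of S; for fixed s the products run
  -- through all permutations of `Fin N`.
  have h1 : ∀ π : Equiv.Perm (Fin N), ∑ s : Equiv.Perm {x // x ∈ S},
      G (S.filter fun k => (π * Equiv.Perm.ofSubtype s) k < (π * Equiv.Perm.ofSubtype s) i) =
      ∑ s : Equiv.Perm {x // x ∈ S},
        G ((univ.filter fun k => s k < s ⟨i, hi⟩).map (Function.Embedding.subtype _)) := by
    intro π
    have hc : (S.map π.toEmbedding).card = S.card := card_map _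
    let a : {x // x ∈ S} ≃ {x // x ∈ S.map π.toEmbedding} :=
      π.subtypeEquiv fun x => by simp
    -- The rank of π k within the image π(S), read as an element of S: it orders S exactly as π does
    -- and is a permutation of S, so it can be absorbed into s.
    let ρ : Equiv.Perm {x // x ∈ S} :=
      a.trans (((S.map π.toEmbedding).orderIsoOfFin hc).symm.trans
        (S.orderIsoOfFin rfl)).toEquiv
    have hρ : ∀ k l, ρ k < ρ l ↔ π k < π l := fun k l => by
      simp only [ρ, Equiv.trans_apply, RelIso.coe_fn_toEquiv, OrderIso.lt_iff_lt]
      rfl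
    conv_rhs => rw [← Equiv.sum_comp (Equiv.mulLeft ρ)]
    refine sum_congr rfl fun s _ => ?_
    congr 1
    ext k
    simp only [mem_filter, mem_map, mem_univ, true_and]
    have h4 : ∀ x (hx : x ∈ S), (π * Equiv.Perm.ofSubtype s) x = π (s ⟨x, hx⟩) := fun x hx => by
      rw [Equiv.Perm.mul_apply, Equiv.Perm.ofSubtype_apply_of_mem s hx]
    constructor
    · rintro ⟨hk, h⟩
      rw [h4 k hk, h4 i hi, ← hρ] at h
      exact ⟨⟨k, hk⟩, h, rfl⟩
    · rintro ⟨⟨k, hk⟩, h, rfl⟩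
      refine ⟨hk, ?_⟩
      rw [Function.Embedding.subtype_apply, h4 k hk, h4 i hi, ← hρ]
      exact h
  have h2 : ∀ s : Equiv.Perm {x // x ∈ S}, ∑ π : Equiv.Perm (Fin N),
      G (S.filter fun k => (π * Equiv.Perm.ofSubtype s) k < (π * Equiv.Perm.ofSubtype s) i) =
      ∑ π : Equiv.Perm (Fin N), G (S.filter fun k => π k < π i) := fun s =>
    Equiv.sum_comp (Equiv.mulRight (Equiv.Perm.ofSubtype s))
      fun π => G (S.filter fun k => π k < π i)
  have h3 := sum_comm (s := (univ : Finset (Equiv.Perm (Fin N))))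
    (t := (univ : Finset (Equiv.Perm {x // x ∈ S}))) (f := fun π s =>
      G (S.filter fun k => (π * Equiv.Perm.ofSubtype s) k < (π * Equiv.Perm.ofSubtype s) i))
  simp only [h1, h2, sum_const, card_univ, Fintype.card_perm, Fintype.card_coe, Fintype.card_fin,
    nsmul_eq_mul] at h3
  have : (N.factorial : ℝ) ≠ 0 := by positivity
  have : (S.card.factorial : ℝ) ≠ 0 := by positivity
  field_simp
  linarith

/-! ### The Shapley value and the Hart-Mas-Colell potential of a cooperative game -/

variable {V : Type*} [DecidableEq V]

/-- The Shapley value of the player `i` in the game `v` with player set `S`. -/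
noncomputable def shapleyValue (v : Finset V → ℝ) (S : Finset V) (i : V) : ℝ :=
  ∑ T ∈ (S.erase i).powerset,
    (T.card.factorial * (S.card - 1 - T.card).factorial / S.card.factorial : ℝ) *
      (v (insert i T) - v T)

/-- The Hart-Mas-Colell potential of the game `v` with player set `S`. -/
noncomputable def shapleyPotential (v : Finset V → ℝ) (S : Finset V) : ℝ :=
  ∑ T ∈ S.powerset,
    ((T.card - 1).factorial * (S.card - T.card).factorial / S.card.factorial : ℝ) * v T

/-- The Shapley value is the discrete derivative of the potential; this makes the cost sharing game
an exact potential game. It is a coefficient identity: the Shapley weight of T is the weight of T ∪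
{i} in the larger potential, and equally the drop in the weight of T when i joins. -/
lemma shapleyPotential_insert {v : Finset V → ℝ} (hv : v ∅ = 0) {S : Finset V} {i : V}
    (hi : i ∉ S) :
    shapleyPotential v (insert i S) = shapleyPotential v S + shapleyValue v (insert i S) i := by
  unfold shapleyPotential shapleyValue
  rw [sum_powerset_insert hi, erase_insert hi, ← sum_add_distrib, ← sum_add_distrib]
  refine sum_congr rfl fun T hT => ?_
  have hTS := mem_powerset.1 hT
  have hiT : i ∉ T := fun h => hi (hTS h)
  rw [card_insert_of_notMem hi, card_insert_of_notMem hiT, Nat.add_sub_cancel, Nat.add_sub_cancel,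
    Nat.add_sub_add_right]
  -- For T = ∅ the exponent-like term `T.card - 1` is truncated and the weight is meaningless; `v ∅
  -- = 0` removes it.
  rcases T.eq_empty_or_nonempty with rfl | hne
  · simp [hv]
  · obtain ⟨t, ht⟩ : ∃ t, T.card = t + 1 := ⟨T.card - 1, by have := hne.card_pos; omega⟩
    obtain ⟨r, hr⟩ : ∃ r, S.card = T.card + r := ⟨S.card - T.card, by
      have := card_le_card hTS; omega⟩
    rw [hr, ht, show t + 1 + r + 1 - (t + 1) = r + 1 by omega, show t + 1 + r - (t + 1) = r by omega,
      Nat.add_sub_cancel, Nat.factorial_succ (t + 1 + r), Nat.factorial_succ r,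
      Nat.factorial_succ t]
    push_cast
    have : ((t + 1 + r).factorial : ℝ) ≠ 0 := by positivity
    field_simp
    ring

/-- The recursion behind budget balance and both comparisons of the potential with `v`. After
exchanging the sums, a set T ≠ S is counted once for each of the |S| - |T| players outside it,
always with the same weight. -/
lemma card_mul_shapleyPotential {v : Finset V → ℝ} (hv : v ∅ = 0) (S : Finset V) :
    S.card * shapleyPotential v S = v S + ∑ i ∈ S, shapleyPotential v (S.erase i) := by
  unfold shapleyPotential
  rw [sum_comm' (s' := fun T => S \ T) (t' := S.powerset)]
  · rw [← add_sum_erase _ _ (mem_powerset_self S), ← add_sum_erase _ _ (mem_powerset_self S),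
      sdiff_self, bot_eq_empty, sum_empty, zero_add, mul_add, mul_sum]
    congr 1
    · rcases S.eq_empty_or_nonempty with rfl | hne
      · simp [hv]
      · obtain ⟨t, ht⟩ : ∃ t, S.card = t + 1 := ⟨S.card - 1, by have := hne.card_pos; omega⟩
        rw [ht, Nat.sub_self, Nat.add_sub_cancel, Nat.factorial_succ]
        push_cast
        simp only [Nat.factorial_zero, Nat.cast_one]
        field_simp
    · refine sum_congr rfl fun T hT => ?_
      rw [mem_erase, mem_powerset] at hT
      have hlt := card_lt_card (hT.2.ssubset_of_ne hT.1)
      have : ∀ i ∈ S \ T, ((T.card - 1).factorial * ((S.erase i).card - T.card).factorial /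
          (S.erase i).card.factorial : ℝ) * v T = ((T.card - 1).factorial *
          (S.card - 1 - T.card).factorial / (S.card - 1).factorial : ℝ) * v T := by
        intro i hi
        rw [card_erase_of_mem (mem_sdiff.1 hi).1]
      rw [sum_congr rfl this, sum_const, card_sdiff_of_subset hT.2, nsmul_eq_mul]
      obtain ⟨r, hr⟩ : ∃ r, S.card = T.card + r + 1 := ⟨S.card - T.card - 1, by omega⟩
      rw [hr, show T.card + r + 1 - T.card = r + 1 by omega,
        show T.card + r + 1 - 1 - T.card = r by omega, Nat.add_sub_cancel,
        Nat.factorial_succ (T.card + r), Nat.factorial_succ r]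
      push_cast
      have : ((T.card + r).factorial : ℝ) ≠ 0 := by positivity
      field_simp
  · intro i T
    simp only [mem_powerset, mem_sdiff, subset_erase]
    tauto

lemma shapleyPotential_eq_erase_add {v : Finset V → ℝ} (hv : v ∅ = 0) {S : Finset V} {i : V}
    (hi : i ∈ S) :
    shapleyPotential v S = shapleyPotential v (S.erase i) + shapleyValue v S i := by
  have := shapleyPotential_insert hv (notMem_erase i S)
  rwa [insert_erase hi] at this

/-- Budget balance. -/
lemma sum_shapleyValue {v : Finset V → ℝ} (hv : v ∅ = 0) (S : Finset V) :
    ∑ i ∈ S, shapleyValue v S i = v S := by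
  have h := card_mul_shapleyPotential hv S
  have h2 : ∑ i ∈ S, shapleyPotential v S =
      ∑ i ∈ S, (shapleyPotential v (S.erase i) + shapleyValue v S i) :=
    sum_congr rfl fun i hi => shapleyPotential_eq_erase_add hv hi
  rw [sum_const, nsmul_eq_mul, h, sum_add_distrib] at h2
  linarith

/-- By the recursion, P(S) is v(S)/|S| plus the average of the P(S - i). By monotonicity each
removal costs at most a further v(S)/(|S| - 1), and so on, which adds up to the harmonic number. -/
lemma shapleyPotential_le {v : Finset V → ℝ} (hv : v ∅ = 0)
    (hmono : ∀ S i, v (S.erase i) ≤ v S) (S : Finset V) :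
    shapleyPotential v S ≤ (harmonic S.card : ℝ) * v S := by
  induction hn : S.card generalizing S with
  | zero =>
    rw [card_eq_zero] at hn
    subst hn
    simp [shapleyPotential, hv]
  | succ n ih =>
    have h := card_mul_shapleyPotential hv S
    have h1 : ∑ i ∈ S, shapleyPotential v (S.erase i) ≤ ∑ i ∈ S, (harmonic n : ℝ) * v S := by
      refine sum_le_sum fun i hi => (ih (S.erase i) (by rw [card_erase_of_mem hi, hn]; rfl)).trans ?_
      refine mul_le_mul_of_nonneg_left (hmono S i) ?_
      rw [harmonic]
      push_cast
      positivity
    rw [sum_const, nsmul_eq_mul, hn] at h1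
    rw [hn] at h
    have hpos : (0 : ℝ) < (n + 1 : ℕ) := by positivity
    rw [harmonic_succ]
    push_cast at h h1 hpos ⊢
    rw [← mul_le_mul_iff_of_pos_left hpos, h]
    have : ((n : ℝ) + 1) * (((harmonic n : ℝ) + ((n : ℝ) + 1)⁻¹) * v S) =
        v S + ((n : ℝ) + 1) * ((harmonic n : ℝ) * v S) := by
      field_simp
      ring
    linarith

/-- The function B·P satisfies |S|·BP(S) = Bv(S) + Σ BP(S - i), and the hypothesis says that v
satisfies the same relation with ≤. Induction on |S| compares the two. -/
lemma le_mul_shapleyPotential {v : Finset V → ℝ} (hv : v ∅ = 0) {B : ℝ}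
    (hB : ∀ S, S.card * v S ≤ B * v S + ∑ i ∈ S, v (S.erase i)) (S : Finset V) :
    v S ≤ B * shapleyPotential v S := by
  induction hn : S.card generalizing S with
  | zero =>
    rw [card_eq_zero] at hn
    subst hn
    simp [shapleyPotential, hv]
  | succ n ih =>
    have h := card_mul_shapleyPotential hv S
    have h1 : ∑ i ∈ S, v (S.erase i) ≤ ∑ i ∈ S, B * shapleyPotential v (S.erase i) :=
      sum_le_sum fun i hi => ih (S.erase i) (by rw [card_erase_of_mem hi, hn]; rfl)
    rw [← mul_sum] at h1
    have hpos : (0 : ℝ) < S.card := by rw [hn]; positivity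
    rw [← mul_le_mul_iff_of_pos_left hpos, mul_left_comm, h]
    linarith [hB S]

end RandomOrder

/-! ### The cost shares of an instance as Shapley values -/

namespace GNDInstance

variable {R : RequestFamily} {q : ℕ} (I : GNDInstance R q)

/-- The cost of resource `e` as a function of the set of its users. -/
noncomputable def usersCost (α : Fin q → ℝ) (e : Fin I.m) (S : Finset (Fin I.N)) : ℝ :=
  I.resourceCost α e (∑ i ∈ S, I.w i e)

@[simp] lemma usersCost_empty (α : Fin q → ℝ) (e : Fin I.m) : I.usersCost α e ∅ = 0 := by
  simp [usersCost, resourceCost]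

lemma shapleyShare_eq_sum_perm (α : Fin q → ℝ) (e : Fin I.m) {S : Finset (Fin I.N)}
    {i : Fin I.N} (hi : i ∈ S) :
    I.shapleyShare α e S i = (∑ π : Equiv.Perm {x // x ∈ S},
      (fun T => I.resourceCost α e ((∑ k ∈ T, I.w k e) + I.w i e) -
          I.resourceCost α e (∑ k ∈ T, I.w k e))
        ((Finset.univ.filter fun k => π k < π ⟨i, hi⟩).map (Function.Embedding.subtype _))) /
      (S.card.factorial : ℝ) := by
  simp only [shapleyShare, hi, dif_pos, Finset.sum_map, Function.Embedding.subtype_apply]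

/-- This form matches the sampler, which permutes all requests and not only the users of the
resource. -/
lemma shapleyShare_eq_sum_perm_all (α : Fin q → ℝ) (e : Fin I.m) {S : Finset (Fin I.N)}
    {i : Fin I.N} (hi : i ∈ S) :
    I.shapleyShare α e S i = (∑ π : Equiv.Perm (Fin I.N),
      (I.resourceCost α e ((∑ k ∈ S.filter (fun k => π k < π i), I.w k e) + I.w i e) -
          I.resourceCost α e (∑ k ∈ S.filter (fun k => π k < π i), I.w k e))) /
      (I.N.factorial : ℝ) := by
  rw [shapleyShare_eq_sum_perm I α e hi, ← sum_perm_eq_sum_perm_subtype S hi fun T =>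
    I.resourceCost α e ((∑ k ∈ T, I.w k e) + I.w i e) - I.resourceCost α e (∑ k ∈ T, I.w k e)]

lemma shapleyShare_eq_shapleyValue (α : Fin q → ℝ) (e : Fin I.m) {S : Finset (Fin I.N)}
    {i : Fin I.N} (hi : i ∈ S) :
    I.shapleyShare α e S i = shapleyValue (I.usersCost α e) S i := by
  rw [shapleyShare_eq_sum_perm I α e hi, sum_perm_subtype_filter_lt S hi fun T =>
    I.resourceCost α e ((∑ k ∈ T, I.w k e) + I.w i e) - I.resourceCost α e (∑ k ∈ T, I.w k e),
    shapleyValue, Finset.sum_div]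
  refine Finset.sum_congr rfl fun T hT => ?_
  have : i ∉ T := fun h => by simpa using Finset.mem_powerset.1 hT h
  rw [usersCost, usersCost, Finset.sum_insert this, add_comm (I.w i e)]
  push_cast
  ring

end GNDInstance

/-! ### The estimates of the Shapley cost shares -/

namespace Prog

variable {N m : ℕ} {A : Type} (O : Fin N → (Fin m → ℝ) → Finset (Fin m))

/-- Means and variances of independent runs add up; independence is built in because the later runs
do not depend on the earlier outcomes. -/
lemma expect_sumEach_moments {P : Prog ℝ N m ℝ} {μ s : ℝ} (h1 : expect O P (fun x => x) = μ)
    (h2 : expect O P (fun x => (x - μ) ^ 2) ≤ s) (n : ℕ) :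
    expect O (sumEach n fun _ => P) (fun x => x) = n * μ ∧
      expect O (sumEach n fun _ => P) (fun x => (x - n * μ) ^ 2) ≤ n * s := by
  induction n with
  | zero => simp [sumEach]
  | succ n ih =>
    obtain ⟨ih1, ih2⟩ := ih
    have h0 : expect O P (fun x => x - μ) = 0 := by
      simp only [sub_eq_add_neg]
      rw [expect_add, expect_const, h1, add_neg_cancel]
    have ih0 : expect O (sumEach n fun _ => P) (fun x => x - n * μ) = 0 := by
      simp only [sub_eq_add_neg]
      rw [expect_add, expect_const, ih1, add_neg_cancel]
    constructor
    · have h3 : ∀ x : ℝ, expect O (sumEach n fun _ => P) (fun y => x + y) = x + n * μ := fun x => by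
        rw [expect_add, expect_const, ih1]
      simp only [sumEach, bind_eq, expect_tick, expect_bind, expect_arithP, ArithOp.eval, h3]
      rw [expect_add, expect_const, h1]
      push_cast
      ring
    · simp only [sumEach, bind_eq, expect_tick, expect_bind, expect_arithP, ArithOp.eval]
      -- The cross term has expectation zero, since y - nμ is centred for every fixed x.
      have e1 : ∀ x y : ℝ, (x + y - ((n + 1 : ℕ) : ℝ) * μ) ^ 2 =
          (x - μ) ^ 2 + ((2 * (x - μ)) * (y - n * μ) + (y - n * μ) ^ 2) := by
        intro x y
        push_cast
        ring
      simp only [e1, expect_add, expect_const, expect_const_mul, ih0, mul_zero, zero_add]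
      push_cast
      linarith

/-- Chebyshev's inequality for the mean of independent samples. -/
lemma failProb_mean_le {P : Prog ℝ N m ℝ} {μ s ε : ℝ} (hμ : 0 < μ) (hε : 0 < ε)
    (h1 : expect O P (fun x => x) = μ) (h2 : expect O P (fun x => (x - μ) ^ 2) ≤ s)
    {n : ℕ} (hn : 0 < n) :
    failProb O ((sumEach n fun _ => P).bind fun x => (natP n).bind fun c => arithP .div x c)
      (· ∈ Set.Icc ((1 - ε) * μ) ((1 + ε) * μ)) ≤ s / (n * (ε * μ) ^ 2) := by
  unfold failProb
  simp only [expect_bind, expect_natP, expect_arithP]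
  have hn' : (0 : ℝ) < n := by exact_mod_cast hn
  -- The indicator of a deviation beyond εμ is dominated by the normalised square (x - nμ)²/(nεμ)².
  refine le_trans (expect_mono O _ (h := fun x => (1 / (n * (ε * μ)) ^ 2) * (x - n * μ) ^ 2)
    fun x => ?_) ?_
  · by_cases hx : x / n ∈ Set.Icc ((1 - ε) * μ) ((1 + ε) * μ)
    · exact (if_pos hx).trans_le (by positivity)
    · refine (if_neg hx).trans_le ?_
      have hx' : ε * μ < |x / n - μ| := by
        by_contra h
        rw [not_lt, abs_le] at h
        exact hx ⟨by linarith [h.1], by linarith [h.2]⟩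
      have h3 : n * (ε * μ) ≤ |x - n * μ| := by
        have : x - n * μ = n * (x / n - μ) := by field_simp
        rw [this, abs_mul, abs_of_pos hn']
        exact mul_le_mul_of_nonneg_left hx'.le hn'.le
      rw [one_div_mul_eq_div, one_le_div (by positivity), ← sq_abs (x - n * μ)]
      exact pow_le_pow_left₀ (by positivity) h3 2
  · rw [expect_const_mul]
    refine (mul_le_mul_of_nonneg_left (expect_sumEach_moments O h1 h2 n).2
      (by positivity)).trans (le_of_eq ?_)
    field_simp

lemma expect_forEach_prod {P : Prog ℝ N m A} (u : A → ℝ) (n : ℕ) :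
    expect O (forEach n fun _ => P) (fun x => ∏ i, u (x i)) = expect O P u ^ n := by
  induction n with
  | zero => simp [forEach]
  | succ n ih =>
    simp only [forEach, bind_eq, expect_tick, expect_bind, expect_ret, Fin.prod_univ_succ,
      Fin.cons_zero, Fin.cons_succ, expect_const_mul, ih, expect_mul_const]
    rw [pow_succ']

/-- The median trick. -/
lemma failProb_median_le {P : Prog ℝ N m ℝ} {lo hi : ℝ}
    (h : failProb O P (· ∈ Set.Icc lo hi) ≤ 1 / 16) {k : ℕ} (hk : 0 < k) :
    failProb O ((forEach k fun _ => P).bind fun x => median k x) (· ∈ Set.Icc lo hi) ≤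
      1 / 2 ^ k := by
  classical
  -- Exponential Markov bound: each run outside the interval contributes a factor 16, so a run has
  -- expected factor at most 1 + 15/16 ≤ 2. If the median lies outside, at least half of the runs do
  -- and the product is at least 4^k. The quotient is 2^k/4^k.
  set u : ℝ → ℝ := fun x => if x ∈ Set.Icc lo hi then 1 else 16 with hu
  have hu1 : expect O P u ≤ 2 := by
    have : u = fun x => 1 + 15 * (if x ∈ Set.Icc lo hi then 0 else 1) := by
      funext x
      simp only [hu]
      split_ifs <;> norm_num
    rw [this, expect_add, expect_const, expect_const_mul]
    unfold failProb at h
    have h' : expect O P (fun x => if x ∈ Set.Icc lo hi then (0 : ℝ) else 1) ≤ 1 / 16 := by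
      convert h
    linarith
  have hu0 : 0 ≤ expect O P u := by
    rw [← expect_const O P 0]
    refine expect_mono O P fun x => ?_
    simp only [hu]
    split_ifs <;> norm_num
  unfold failProb
  rw [expect_bind]
  refine le_trans (expect_mono O _ (h := fun x => (1 / 4 ^ k) * ∏ i, u (x i)) fun x => ?_) ?_
  · obtain ⟨y, -, hy, hy'⟩ := exists_median O hk x
    rw [hy]
    have hprod : ∏ i, u (x i) =
        16 ^ (Finset.univ.filter fun i => x i ∉ Set.Icc lo hi).card := by
      simp only [hu]
      rw [Finset.prod_ite, Finset.prod_const_one, one_mul, Finset.prod_const]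
    rw [hprod]
    split_ifs with h1
    · positivity
    · have h2 : k ≤ 2 * (Finset.univ.filter fun i => x i ∉ Set.Icc lo hi).card := by
        by_contra h3
        exact h1 (hy' lo hi (not_le.1 h3))
      rw [one_div_mul_eq_div, one_le_div (by positivity), show (16 : ℝ) = 4 ^ 2 by norm_num,
        ← pow_mul]
      exact pow_le_pow_right₀ (by norm_num) h2
  · rw [expect_const_mul, expect_forEach_prod]
    calc 1 / 4 ^ k * expect O P u ^ k ≤ 1 / 4 ^ k * 2 ^ k := by gcongr
      _ = 1 / 2 ^ k := by
        rw [show (4 : ℝ) = 2 * 2 by norm_num, mul_pow]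
        field_simp

/-- Sure positivity of the estimates is what keeps every outcome feasible, because the oracle
promises nothing for nonpositive tolls. At least one summand is needed, since the empty sum is zero.
-/
lemma failProb_sumEach_pos {P : Prog ℝ N m ℝ} (h : failProb O P (0 < ·) = 0) {n : ℕ}
    (hn : 0 < n) : failProb O (sumEach n fun _ => P) (0 < ·) = 0 := by
  obtain ⟨n, rfl⟩ : ∃ k, n = k + 1 := ⟨n - 1, by omega⟩
  clear hn
  have key : ∀ (n : ℕ) (Q : ℝ → Prop), (∀ s, 0 ≤ s → Q s) →
      failProb O (sumEach n fun _ => P) Q = 0 := by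
    intro n
    induction n with
    | zero => intro Q hQ; simp [sumEach, failProb, hQ]
    | succ n ih =>
      intro Q hQ
      refine le_antisymm ?_ (failProb_nonneg O _ _)
      simp only [sumEach, bind_eq, failProb_tick]
      refine (failProb_bind_le O _ h.le (δ' := 0) (fun a ha => ?_) le_rfl).trans (by simp)
      refine (failProb_bind_le O _ (ih (0 ≤ ·) fun _ => id).le (δ' := 0) (fun s hs => ?_)
        le_rfl).trans (by simp)
      simp [failProb, ArithOp.eval, hQ (a + s) (by positivity)]
  refine le_antisymm ?_ (failProb_nonneg O _ _)
  simp only [sumEach, bind_eq, failProb_tick]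
  refine (failProb_bind_le O _ h.le (δ' := 0) (fun a ha => ?_) le_rfl).trans (by simp)
  refine (failProb_bind_le O _ (key n (0 ≤ ·) fun _ => id).le (δ' := 0) (fun s hs => ?_)
    le_rfl).trans (by simp)
  simp [failProb, ArithOp.eval, show 0 < a + s by positivity]

end Prog

/-- Both x + w and y are convex combinations of x and y + w, with the two weights exchanged. Adding
the two convexity inequalities gives f(x + w) + f(y) ≤ f(x) + f(y + w). -/
lemma ConvexOn.increment_mono {f : ℝ → ℝ} (hf : ConvexOn ℝ (Set.Ici 0) f) {x y w : ℝ}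
    (hx : 0 ≤ x) (hxy : x ≤ y) (hw : 0 ≤ w) : f (x + w) - f x ≤ f (y + w) - f y := by
  rcases hw.eq_or_lt with rfl | hw
  · simp
  have hd : 0 < y - x + w := by linarith
  have ht0 : 0 ≤ w / (y - x + w) := by positivity
  have ht1 : 0 ≤ (y - x) / (y - x + w) := div_nonneg (by linarith) hd.le
  have hsum : (y - x) / (y - x + w) + w / (y - x + w) = 1 := by
    rw [← add_div, div_self hd.ne']
  have hy : y + w ∈ Set.Ici (0 : ℝ) := by
    have : (0 : ℝ) ≤ y + w := by linarith
    exact this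
  have h1 := hf.2 (show x ∈ Set.Ici (0 : ℝ) from hx) hy ht1 ht0 hsum
  have h2 := hf.2 (show x ∈ Set.Ici (0 : ℝ) from hx) hy ht0 ht1 (by rw [add_comm, hsum])
  have e1 : ((y - x) / (y - x + w)) • x + (w / (y - x + w)) • (y + w) = x + w := by
    simp only [smul_eq_mul]; field_simp; ring
  have e2 : (w / (y - x + w)) • x + ((y - x) / (y - x + w)) • (y + w) = y := by
    simp only [smul_eq_mul]; field_simp; ring
  rw [e1] at h1
  rw [e2] at h2
  simp only [smul_eq_mul] at h1 h2
  have : f (x + w) + f y ≤ ((y - x) / (y - x + w) + w / (y - x + w)) * (f x + f (y + w)) := by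
    linarith
  rw [hsum] at this
  linarith

/-! ### Bias, variance and accuracy of the sampled marginal costs -/

namespace GNDInstance

open Prog

variable {R : RequestFamily} {q : ℕ} (I : GNDInstance R q) {α : Fin q → ℝ}

/-- The load dependent part of the cost of a resource. -/
noncomputable def powerCost (α : Fin q → ℝ) (e : Fin I.m) (x : ℝ) : ℝ :=
  ∑ j, I.ξ e j * x ^ α j

lemma powerCost_zero (hα : ∀ j, 1 < α j) (e : Fin I.m) : I.powerCost α e 0 = 0 :=
  Finset.sum_eq_zero fun j _ => by
    rw [Real.zero_rpow (by linarith [hα j]), mul_zero]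

lemma resourceCost_eq (hα : ∀ j, 1 < α j) (e : Fin I.m) (l : ℕ) :
    I.resourceCost α e l = (if l = 0 then 0 else I.σ e) + I.powerCost α e l := by
  unfold resourceCost
  split_ifs with h
  · simp [h, I.powerCost_zero hα]
  · rfl

lemma powerCost_nonneg (e : Fin I.m) {x : ℝ} (hx : 0 ≤ x) : 0 ≤ I.powerCost α e x :=
  Finset.sum_nonneg fun j _ => mul_nonneg (I.ξ_nonneg e j) (Real.rpow_nonneg hx _)

lemma powerCost_strictMono (hα : ∀ j, 1 < α j) (e : Fin I.m) {x y : ℝ} (hx : 0 ≤ x)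
    (hxy : x < y) : I.powerCost α e x < I.powerCost α e y := by
  obtain ⟨j, hj⟩ := I.ξ_pos e
  refine Finset.sum_lt_sum (fun k _ => ?_) ⟨j, Finset.mem_univ j, ?_⟩
  · exact mul_le_mul_of_nonneg_left
      (Real.rpow_le_rpow hx hxy.le (by linarith [hα k])) (I.ξ_nonneg e k)
  · exact mul_lt_mul_of_pos_left (Real.rpow_lt_rpow hx hxy (by linarith [hα j])) hj

lemma convexOn_powerCost (hα : ∀ j, 1 < α j) (e : Fin I.m) :
    ConvexOn ℝ (Set.Ici 0) (I.powerCost α e) := by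
  unfold powerCost
  refine ⟨convex_Ici 0, fun x hx y hy a b ha hb hab => ?_⟩
  simp only [smul_eq_mul, Finset.mul_sum, ← Finset.sum_add_distrib]
  refine Finset.sum_le_sum fun j _ => ?_
  have := (convexOn_rpow (hα j).le).2 hx hy ha hb hab
  simp only [smul_eq_mul] at this
  calc I.ξ e j * (a * x + b * y) ^ α j ≤ I.ξ e j * (a * x ^ α j + b * y ^ α j) :=
        mul_le_mul_of_nonneg_left this (I.ξ_nonneg e j)
    _ = _ := by ring

variable (O : Fin I.N → (Fin I.m → ℝ) → Finset (Fin I.m))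

@[simp] lemma expect_powerCost (e : Fin I.m) (x : ℝ) (g : ℝ → ℝ) :
    expect O ((I.numInput α).powerCost e x) g = g (I.powerCost α e x) := by
  unfold NumInput.powerCost
  rw [expect_sumEach_det O (x := fun j => I.ξ e j * x ^ α j)]
  · rfl
  · intro j g
    rfl

@[simp] lemma expect_positiveCost (e : Fin I.m) (x : ℝ) (g : ℝ → ℝ) :
    expect O ((I.numInput α).positiveCost e x) g = g (I.σ e + I.powerCost α e x) := by
  simp only [NumInput.positiveCost, bind_eq, expect_bind, expect_powerCost]
  rfl

/-- The players that use `e` under `p` and precede `i` in the order `π`. -/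
def predecessors (p : Fin I.N → Finset (Fin I.m)) (i : Fin I.N) (e : Fin I.m)
    (π : Equiv.Perm (Fin I.N)) : Finset (Fin I.N) :=
  (insert i (I.users p e)).filter fun k => π k < π i

/-- The increase of the load dependent cost when the player `i` arrives after the players in `T`. -/
noncomputable def marginalCost (α : Fin q → ℝ) (i : Fin I.N) (e : Fin I.m)
    (T : Finset (Fin I.N)) : ℝ :=
  I.powerCost α e ((∑ k ∈ T, (I.w k e : ℝ)) + I.w i e) - I.powerCost α e (∑ k ∈ T, (I.w k e : ℝ))

lemma expect_marginalSample (p : Fin I.N → Finset (Fin I.m)) (i : Fin I.N) (e : Fin I.m)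
    (g : ℝ → ℝ) :
    expect O ((I.numInput α).marginalSample p i e) g =
      (∑ π, g (I.marginalCost α i e (I.predecessors p i e π))) / (I.N.factorial : ℝ) := by
  simp only [NumInput.marginalSample, bind_eq, expect_bind, expect_randPerm, expect_sumIf,
    expect_arithP, expect_powerCost, ArithOp.eval]
  congr 1
  refine Finset.sum_congr rfl fun π _ => ?_
  have : ∑ k, (if decide (e ∈ p k ∧ π k < π i) = true then (I.numInput α).w k e else 0) =
      ∑ k ∈ I.predecessors p i e π, (I.w k e : ℝ) := by
    rw [← Finset.sum_filter]
    refine Finset.sum_congr ?_ fun _ _ => rfl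
    ext k
    simp only [predecessors, users, Finset.mem_filter, Finset.mem_univ, true_and, Finset.mem_insert,
      decide_eq_true_eq]
    constructor
    · exact fun h => ⟨Or.inr h.1, h.2⟩
    · rintro ⟨rfl | h1, h2⟩
      · exact absurd h2 (lt_irrefl _)
      · exact ⟨h1, h2⟩
  rw [this]
  rfl

lemma marginalCost_pos (hα : ∀ j, 1 < α j) (i : Fin I.N) (e : Fin I.m) (T : Finset (Fin I.N)) :
    0 < I.marginalCost α i e T := by
  have h : (0 : ℝ) < I.w i e := by exact_mod_cast I.w_pos i e
  exact sub_pos.2 (I.powerCost_strictMono hα e (by positivity) (by linarith))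

lemma marginalCost_mono (hα : ∀ j, 1 < α j) (i : Fin I.N) (e : Fin I.m)
    {T T' : Finset (Fin I.N)} (h : T ⊆ T') : I.marginalCost α i e T ≤ I.marginalCost α i e T' :=
  (I.convexOn_powerCost hα e).increment_mono (by positivity)
    (Finset.sum_le_sum_of_subset_of_nonneg h fun _ _ _ => by positivity) (by positivity)

/-- The probability that the predecessors of `i` in `S` are the players of `T`. -/
lemma average_ite_predecessors (p : Fin I.N → Finset (Fin I.m)) (i : Fin I.N) (e : Fin I.m)
    {T : Finset (Fin I.N)} (hT : T ⊆ (insert i (I.users p e)).erase i) (c : ℝ) :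
    (∑ π, if I.predecessors p i e π = T then c else 0) / (I.N.factorial : ℝ) =
      (T.card.factorial * ((insert i (I.users p e)).card - 1 - T.card).factorial : ℝ) /
        ((insert i (I.users p e)).card.factorial : ℝ) * c := by
  have hi := Finset.mem_insert_self i (I.users p e)
  have h := sum_perm_eq_sum_perm_subtype _ hi fun U => if U = T then c else 0
  rw [sum_perm_subtype_filter_lt _ hi fun U => if U = T then c else 0] at h
  refine h.trans ?_
  simp only [mul_ite, mul_zero]
  rw [Finset.sum_ite_eq' , if_pos (Finset.mem_powerset.2 hT)]
  push_cast
  ring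

lemma predecessors_subset (p : Fin I.N → Finset (Fin I.m)) (i : Fin I.N) (e : Fin I.m)
    (π : Equiv.Perm (Fin I.N)) :
    I.predecessors p i e π ⊆ (insert i (I.users p e)).erase i := by
  intro k hk
  have := Finset.mem_filter.1 hk
  refine Finset.mem_erase.2 ⟨?_, this.1⟩
  rintro rfl
  exact lt_irrefl _ this.2

/-- The samples are unbiased. -/
lemma shapleyShare_eq_add_average (hα : ∀ j, 1 < α j) (p : Fin I.N → Finset (Fin I.m))
    (i : Fin I.N) (e : Fin I.m) :
    I.shapleyShare α e (insert i (I.users p e)) i =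
      I.σ e / (insert i (I.users p e)).card +
        (∑ π, I.marginalCost α i e (I.predecessors p i e π)) / (I.N.factorial : ℝ) := by
  have hi := Finset.mem_insert_self i (I.users p e)
  have h := I.average_ite_predecessors p i e (Finset.empty_subset _) (I.σ e)
  obtain ⟨n, hn⟩ : ∃ n, (insert i (I.users p e)).card = n + 1 :=
    ⟨(insert i (I.users p e)).card - 1, by have := Finset.card_pos.2 ⟨i, hi⟩; omega⟩
  -- In a random order the startup cost falls on the first arrival. The player has no predecessors
  -- with probability 1/|S|, so σ/|S| is the exact expectation of the startup part.
  have h' : I.σ e / (insert i (I.users p e)).card =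
      (∑ π, if I.predecessors p i e π = ∅ then I.σ e else 0) / (I.N.factorial : ℝ) := by
    rw [h, hn, Finset.card_empty, Nat.add_sub_cancel, Nat.sub_zero, Nat.factorial_succ]
    push_cast
    simp only [Nat.factorial_zero, Nat.cast_one]
    field_simp
  rw [h', shapleyShare_eq_sum_perm_all I α e hi, ← add_div, ← Finset.sum_add_distrib]
  congr 1
  refine Finset.sum_congr rfl fun π _ => ?_
  change I.resourceCost α e (∑ k ∈ I.predecessors p i e π, I.w k e + I.w i e) -
    I.resourceCost α e (∑ k ∈ I.predecessors p i e π, I.w k e) = _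
  have hw := I.w_pos i e
  rw [resourceCost_eq I hα, resourceCost_eq I hα, if_neg (by omega), marginalCost]
  -- Since weights are at least 1, the load is zero only if nobody has arrived.
  have h0 : (∑ k ∈ I.predecessors p i e π, I.w k e = 0) ↔ I.predecessors p i e π = ∅ := by
    rw [Finset.sum_eq_zero_iff]
    constructor
    · intro h
      by_contra hne
      obtain ⟨k, hk⟩ := Finset.nonempty_iff_ne_empty.2 hne
      have := h k hk
      have := I.w_pos k e
      omega
    · intro h
      simp [h]
  simp only [h0]
  push_cast
  split_ifs <;> ring

/-- A sample is at most `N` times the expectation, since with probability at least `1 / N` the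
player arrives last. -/
lemma marginalCost_le (hα : ∀ j, 1 < α j) (p : Fin I.N → Finset (Fin I.m))
    (i : Fin I.N) (e : Fin I.m) (π : Equiv.Perm (Fin I.N)) :
    I.marginalCost α i e (I.predecessors p i e π) ≤
      I.N * ((∑ π, I.marginalCost α i e (I.predecessors p i e π)) / (I.N.factorial : ℝ)) := by
  have hi := Finset.mem_insert_self i (I.users p e)
  set S := insert i (I.users p e) with hS
  have h := I.average_ite_predecessors p i e (Finset.Subset.refl _)
    (I.marginalCost α i e (S.erase i))
  obtain ⟨n, hn⟩ : ∃ n, S.card = n + 1 :=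
    ⟨S.card - 1, by have := Finset.card_pos.2 ⟨i, hi⟩; omega⟩
  have hnN : (S.card : ℝ) ≤ I.N := by
    exact_mod_cast (Finset.card_le_univ S).trans_eq (Fintype.card_fin _)
  have h1 : I.marginalCost α i e (S.erase i) =
      S.card * ((∑ π, if I.predecessors p i e π = S.erase i then
        I.marginalCost α i e (S.erase i) else 0) / (I.N.factorial : ℝ)) := by
    rw [h, ← hS, Finset.card_erase_of_mem hi, hn, Nat.add_sub_cancel, Nat.sub_self,
      Nat.factorial_succ]
    push_cast
    simp only [Nat.factorial_zero, Nat.cast_one]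
    field_simp
  refine (I.marginalCost_mono hα i e (I.predecessors_subset p i e π)).trans ?_
  rw [← hS, h1]
  have h2 : ∀ π, (if I.predecessors p i e π = S.erase i then I.marginalCost α i e (S.erase i)
      else 0) ≤ I.marginalCost α i e (I.predecessors p i e π) := by
    intro π
    split_ifs with h2
    · rw [h2]
    · exact (I.marginalCost_pos hα i e _).le
  refine mul_le_mul hnN ?_ ?_ (by positivity)
  · gcongr with π _
    exact h2 π
  · refine div_nonneg (Finset.sum_nonneg fun π _ => ?_) (by positivity)
    split_ifs
    · exact (I.marginalCost_pos hα i e _).le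
    · exact le_rfl

lemma shapleyAPX_eq (b : ℕ) (ε : ℝ) (p : Fin I.N → Finset (Fin I.m)) (i : Fin I.N) (e : Fin I.m)
    (Q : ℝ → Prop) :
    failProb O (I.shapleyAPX α ε b p i e) Q =
      failProb O ((I.numInput α).svSample (numSamples ε I.N)
        (numReps (numIterations α ε I.N) I.N I.m b) p i e)
        (fun θ => Q (I.σ e / (insert i (I.users p e)).card + θ)) := by
  unfold failProb
  simp only [shapleyAPX, NumInput.shapleyAPX, bind_eq, expect_bind]
  congr 1
  funext θ
  rw [expect_sumEach_det O (x := fun k => if e ∈ p k ∨ k = i then (1 : ℝ) else 0)]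
  · have : ∑ k, (if e ∈ p k ∨ k = i then (1 : ℝ) else 0) = (insert i (I.users p e)).card := by
      rw [← Finset.sum_filter, Finset.sum_const, nsmul_eq_mul, mul_one]
      congr 2
      ext k
      simp [users, or_comm]
    rw [this]
    rfl
  · intro k g
    split_ifs <;> simp

lemma numSamples_pos {ε : ℝ} (hε : 0 < ε) (hN : 1 ≤ I.N) : 0 < numSamples ε I.N := by
  have : (0 : ℝ) < I.N := by exact_mod_cast hN
  exact Nat.ceil_pos.2 (by positivity)

/-- The estimates are always positive. -/
lemma failProb_shapleyAPX_pos (hα : ∀ j, 1 < α j) {ε : ℝ} (hε : 0 < ε) (b : ℕ)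
    (p : Fin I.N → Finset (Fin I.m)) (i : Fin I.N) (e : Fin I.m)
    (hk : 0 < numReps (numIterations α ε I.N) I.N I.m b) :
    failProb O (I.shapleyAPX α ε b p i e) (0 < ·) = 0 := by
  have hM := I.numSamples_pos hε (Fin.pos i)
  have hX : failProb O ((I.numInput α).marginalSample p i e) (0 < ·) = 0 := by
    unfold failProb
    rw [expect_marginalSample]
    simp [I.marginalCost_pos hα]
  have hσ : 0 ≤ I.σ e / (insert i (I.users p e)).card := div_nonneg (I.σ_nonneg e) (by positivity)
  rw [shapleyAPX_eq]
  refine le_antisymm ((failProb_mono O _ (Q := (0 < ·)) fun θ hθ => by positivity).trans ?_)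
    (failProb_nonneg O _ _)
  simp only [NumInput.svSample, bind_eq]
  refine (failProb_bind_le O (fun x => ∀ r, 0 < x r) (δ := 0) (δ' := 0) ?_ (fun x hx => ?_)
    le_rfl).trans (by simp)
  · refine (failProb_forEach_le O (Q := fun _ x => 0 < x) (δ := 0) fun r => ?_).trans (by simp)
    refine (failProb_bind_le O _ (failProb_sumEach_pos O hX hM).le (δ' := 0) (fun s hs => ?_)
      le_rfl).trans (by simp)
    have : 0 < s / numSamples ε I.N := by
      have : (0 : ℝ) < numSamples ε I.N := by exact_mod_cast hM
      positivity
    simp [failProb, ArithOp.eval, this]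
  · obtain ⟨y, ⟨r, rfl⟩, hy, -⟩ := exists_median O hk x
    simp [failProb, hy, hx r]

lemma shapleyShare_pos (hα : ∀ j, 1 < α j) (p : Fin I.N → Finset (Fin I.m)) (i : Fin I.N)
    (e : Fin I.m) : 0 < I.shapleyShare α e (insert i (I.users p e)) i := by
  rw [I.shapleyShare_eq_add_average hα]
  have h1 : 0 ≤ I.σ e / (insert i (I.users p e)).card := div_nonneg (I.σ_nonneg e) (by positivity)
  have h2 : 0 < ∑ π, I.marginalCost α i e (I.predecessors p i e π) :=
    Finset.sum_pos (fun π _ => I.marginalCost_pos hα i e _) Finset.univ_nonempty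
  positivity

/-- The estimates are accurate with high probability. -/
lemma failProb_shapleyAPX_le (hα : ∀ j, 1 < α j) {ε : ℝ} (hε : 0 < ε) (b : ℕ)
    (p : Fin I.N → Finset (Fin I.m)) (i : Fin I.N) (e : Fin I.m)
    (hk : 0 < numReps (numIterations α ε I.N) I.N I.m b) :
    failProb O (I.shapleyAPX α ε b p i e)
      (· ∈ Set.Icc ((1 - ε) * I.shapleyShare α e (insert i (I.users p e)) i)
        ((1 + ε) * I.shapleyShare α e (insert i (I.users p e)) i)) ≤
      1 / 2 ^ numReps (numIterations α ε I.N) I.N I.m b := by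
  have hM := I.numSamples_pos hε (Fin.pos i)
  have hσ : 0 ≤ I.σ e / (insert i (I.users p e)).card := div_nonneg (I.σ_nonneg e) (by positivity)
  set μ := (∑ π, I.marginalCost α i e (I.predecessors p i e π)) / (I.N.factorial : ℝ) with hμ
  have hμ0 : 0 < μ :=
    div_pos (Finset.sum_pos (fun π _ => I.marginalCost_pos hα i e _) Finset.univ_nonempty)
      (by positivity)
  have h1 : expect O ((I.numInput α).marginalSample p i e) (fun x => x) = μ := by
    rw [expect_marginalSample]
  have h2 : expect O ((I.numInput α).marginalSample p i e) (fun x => (x - μ) ^ 2) ≤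
      I.N * μ ^ 2 := by
    have h3 : ∀ x : ℝ, (x - μ) ^ 2 = x ^ 2 + ((-2 * μ) * x + μ ^ 2) := fun x => by ring
    simp only [h3]
    rw [expect_add, expect_add, expect_const_mul, h1, expect_const]
    -- A sample lies between 0 and Nμ, so its second moment is at most Nμ times its mean μ. This
    -- also bounds the variance by Nμ².
    have h4 : expect O ((I.numInput α).marginalSample p i e) (fun x => x ^ 2) ≤
        (I.N * μ) * μ := by
      rw [expect_marginalSample]
      nth_rw 2 [hμ]
      rw [← mul_div_assoc, Finset.mul_sum]
      gcongr with π _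
      rw [sq]
      exact mul_le_mul_of_nonneg_right (I.marginalCost_le hα p i e π)
        (I.marginalCost_pos hα i e _).le
    nlinarith
  rw [shapleyAPX_eq, I.shapleyShare_eq_add_average hα, ← hμ]
  -- The startup part is exact and nonnegative, so a relative error ε of the sampled part is a
  -- relative error of at most ε of the whole share.
  refine (failProb_mono O _ (Q := (· ∈ Set.Icc ((1 - ε) * μ) ((1 + ε) * μ)))
    fun θ hθ => ?_).trans ?_
  · have := mul_nonneg hε.le hσ
    exact ⟨by linarith [hθ.1], by linarith [hθ.2]⟩
  · simp only [NumInput.svSample, bind_eq]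
    refine failProb_median_le O ((failProb_mean_le O hμ0 hε h1 h2 hM).trans ?_) hk
    have hN : (1 : ℝ) ≤ I.N := by exact_mod_cast Fin.pos i
    -- Chebyshev leaves Nμ²/(M(εμ)²) = N/(Mε²). The choice M ≥ 16N²/ε² makes it at most 1/(16N),
    -- hence at most the 1/16 required for the median.
    have hM' : 16 * (I.N : ℝ) ^ 2 / ε ^ 2 ≤ numSamples ε I.N := Nat.le_ceil _
    have hM0 : (0 : ℝ) < numSamples ε I.N := by exact_mod_cast hM
    rw [div_le_iff₀ (by positivity)] at hM'
    rw [mul_pow, div_le_div_iff₀ (by positivity) (by norm_num)]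
    have h5 : 16 * (I.N : ℝ) ≤ numSamples ε I.N * ε ^ 2 := by nlinarith
    nlinarith [mul_le_mul_of_nonneg_right h5 (sq_nonneg μ)]

end GNDInstance

/-! ### The potential game and its smoothness -/

/-- Case distinction at x = 4Aϱy. For larger x, with θ = 1/(4Aϱ) the ratio ((x + y)/x)^a is at most
(1 + θ)^a ≤ e^(θa) ≤ e^(1/(4ϱ)) ≤ 1 + 1/(2ϱ). For smaller x, x + y ≤ 5Aϱy, so the y term alone
suffices. The factor 1/(2ϱ) is chosen so that the loss ϱ of the oracle still leaves only half of the
current cost. -/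
lemma Real.add_rpow_sub_rpow_le {a A ϱ x y : ℝ} (ha : 1 < a) (haA : a ≤ A) (hϱ : 1 ≤ ϱ)
    (hx : 0 ≤ x) (hy : 0 ≤ y) :
    (x + y) ^ a - x ^ a ≤ (5 * A * ϱ) ^ A * y ^ a + 1 / (2 * ϱ) * x ^ a := by
  have hA : 1 < A := ha.trans_le haA
  have hAϱ : 1 ≤ A * ϱ := by nlinarith
  have hxa : 0 ≤ x ^ a := Real.rpow_nonneg hx a
  have hya : 0 ≤ y ^ a := Real.rpow_nonneg hy a
  have hl : 0 ≤ (5 * A * ϱ) ^ A := Real.rpow_nonneg (by linarith) A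
  rcases le_or_gt (4 * (A * ϱ) * y) x with h | h
  · set θ : ℝ := 1 / (4 * (A * ϱ)) with hθ
    have hθ0 : 0 < θ := by positivity
    have hyx : y ≤ θ * x := by
      rw [hθ, one_div_mul_eq_div, le_div_iff₀ (by positivity)]
      linarith
    have h1 : x + y ≤ (1 + θ) * x := by linarith
    have h2 : (x + y) ^ a ≤ (1 + θ) ^ a * x ^ a := by
      rw [← Real.mul_rpow (by positivity) hx]
      exact Real.rpow_le_rpow (by positivity) h1 (by linarith)
    have h3 : (1 + θ) ^ a ≤ 1 + 1 / (2 * ϱ) := by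
      have e1 : (1 + θ) ^ a ≤ Real.exp (θ * a) := by
        rw [Real.exp_mul]
        exact Real.rpow_le_rpow (by positivity) (by linarith [Real.add_one_le_exp θ]) (by linarith)
      set t : ℝ := 1 / (4 * ϱ) with ht
      have ht0 : 0 < t := by positivity
      have ht1 : t ≤ 1 / 4 := by
        rw [ht, div_le_div_iff₀ (by positivity) (by norm_num)]
        linarith
      have e2 : θ * a ≤ t := by
        rw [hθ, ht, one_div_mul_eq_div, div_le_div_iff₀ (by positivity) (by positivity)]
        nlinarith
      have e3 : Real.exp t ≤ 1 + 2 * t := by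
        have := Real.add_one_le_exp (-t)
        rw [Real.exp_neg] at this
        have e4 := Real.exp_pos t
        have e5 : (-t + 1) * Real.exp t ≤ 1 := by
          calc (-t + 1) * Real.exp t ≤ (Real.exp t)⁻¹ * Real.exp t := by gcongr
            _ = 1 := inv_mul_cancel₀ e4.ne'
        -- From e^(-t) ≥ 1 - t one gets e^t ≤ 1/(1 - t), and 1/(1 - t) ≤ 1 + 2t for 0 ≤ t ≤ 1/2.
        have e6 : 1 ≤ (1 + 2 * t) * (-t + 1) := by nlinarith
        nlinarith
      have e7 : 2 * t = 1 / (2 * ϱ) := by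
        rw [ht]; field_simp; norm_num
      rw [← e7]
      exact e1.trans ((Real.exp_le_exp.2 e2).trans e3)
    have h4 := mul_le_mul_of_nonneg_right h3 hxa
    have h5 : 0 ≤ (5 * A * ϱ) ^ A * y ^ a := mul_nonneg hl hya
    linarith
  · have hy0 : 0 < y := by
      by_contra hneg
      have : y = 0 := le_antisymm (not_lt.1 hneg) hy
      subst this
      linarith
    have h1 : x + y ≤ (5 * A * ϱ) * y := by nlinarith
    have h2 : (x + y) ^ a ≤ (5 * A * ϱ) ^ a * y ^ a := by
      rw [← Real.mul_rpow (by linarith) hy]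
      exact Real.rpow_le_rpow (by positivity) h1 (by linarith)
    have h3 : (5 * A * ϱ) ^ a ≤ (5 * A * ϱ) ^ A :=
      Real.rpow_le_rpow_of_exponent_le (by linarith) haA
    have h4 := mul_le_mul_of_nonneg_right h3 hya
    have h5 : 0 ≤ 1 / (2 * ϱ) * x ^ a := by positivity
    linarith

namespace GNDInstance

open Finset

variable {R : RequestFamily} {q : ℕ} (I : GNDInstance R q) {α : Fin q → ℝ}

lemma usersCost_of_nonempty (hα : ∀ j, 1 < α j) (e : Fin I.m) {S : Finset (Fin I.N)}
    (hS : S.Nonempty) :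
    I.usersCost α e S = I.σ e + I.powerCost α e (∑ i ∈ S, (I.w i e : ℝ)) := by
  rw [usersCost, resourceCost_eq I hα, if_neg]
  · push_cast
    rfl
  · obtain ⟨i, hi⟩ := hS
    have := I.w_pos i e
    have := single_le_sum (f := fun i => I.w i e) (fun _ _ => Nat.zero_le _) hi
    omega

lemma powerCost_le_usersCost (hα : ∀ j, 1 < α j) (e : Fin I.m) (S : Finset (Fin I.N)) :
    I.powerCost α e (∑ i ∈ S, (I.w i e : ℝ)) ≤ I.usersCost α e S := by
  rcases S.eq_empty_or_nonempty with rfl | h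
  · simp [I.powerCost_zero hα]
  · rw [I.usersCost_of_nonempty hα e h]
    linarith [I.σ_nonneg e]

lemma usersCost_nonneg (hα : ∀ j, 1 < α j) (e : Fin I.m) (S : Finset (Fin I.N)) :
    0 ≤ I.usersCost α e S :=
  (I.powerCost_nonneg e (by positivity)).trans (I.powerCost_le_usersCost hα e S)

lemma powerCost_mono (hα : ∀ j, 1 < α j) (e : Fin I.m) {x y : ℝ} (hx : 0 ≤ x)
    (hxy : x ≤ y) : I.powerCost α e x ≤ I.powerCost α e y := by
  rcases hxy.eq_or_lt with rfl | h
  · exact le_rfl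
  · exact (I.powerCost_strictMono hα e hx h).le

lemma usersCost_mono (hα : ∀ j, 1 < α j) (e : Fin I.m) {S T : Finset (Fin I.N)} (h : S ⊆ T) :
    I.usersCost α e S ≤ I.usersCost α e T := by
  rcases S.eq_empty_or_nonempty with rfl | hS
  · simpa using I.usersCost_nonneg hα e T
  · rw [I.usersCost_of_nonempty hα e hS, I.usersCost_of_nonempty hα e (hS.mono h)]
    have := I.powerCost_mono hα e (x := ∑ i ∈ S, (I.w i e : ℝ)) (y := ∑ i ∈ T, (I.w i e : ℝ))
      (by positivity) (sum_le_sum_of_subset_of_nonneg h fun _ _ _ => by positivity)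
    linarith

/-- Bernoulli's inequality (1 - s)^α ≥ 1 - αs with s = w/W, applied to each power. -/
lemma powerCost_sub_ge {A : ℝ} (hα : ∀ j, 1 < α j) (hA : ∀ j, α j ≤ A) (e : Fin I.m)
    {W w : ℝ} (hW : 0 < W) (hw : 0 ≤ w) (hwW : w ≤ W) :
    (1 - A * (w / W)) * I.powerCost α e W ≤ I.powerCost α e (W - w) := by
  unfold powerCost
  rw [mul_sum]
  refine sum_le_sum fun j _ => ?_
  have hs : w / W ≤ 1 := (div_le_one hW).2 hwW
  have hs0 : 0 ≤ w / W := by positivity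
  have h1 := one_add_mul_self_le_rpow_one_add (s := -(w / W)) (by linarith) (hα j).le
  have h2 : (W - w) ^ α j = (1 + -(w / W)) ^ α j * W ^ α j := by
    rw [← Real.mul_rpow (by linarith) hW.le]
    congr 1
    field_simp
    ring
  have h3 : 1 - A * (w / W) ≤ (1 + -(w / W)) ^ α j := by
    have := mul_le_mul_of_nonneg_right (hA j) hs0
    linarith
  rw [h2]
  have h4 := mul_le_mul_of_nonneg_right h3
    (mul_nonneg (I.ξ_nonneg e j) (Real.rpow_nonneg hW.le (α j)))
  linarith

/-- This supplies the hypothesis of `le_mul_shapleyPotential`. Removing one of at least two users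
keeps the startup cost and loses at most the fraction B·w_i/W of the load dependent cost; these
fractions sum to B. With at most one user, |S| ≤ 1 ≤ B is enough. -/
lemma card_mul_usersCost_le {B : ℝ} (hα : ∀ j, 1 < α j) (hB : ∀ j, α j ≤ B) (hB1 : 1 ≤ B)
    (e : Fin I.m) (S : Finset (Fin I.N)) :
    S.card * I.usersCost α e S ≤ B * I.usersCost α e S + ∑ i ∈ S, I.usersCost α e (S.erase i) := by
  have hnn := I.usersCost_nonneg hα e S
  have hnn' : 0 ≤ ∑ i ∈ S, I.usersCost α e (S.erase i) :=
    sum_nonneg fun i _ => I.usersCost_nonneg hα e _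
  rcases Nat.lt_or_ge 1 S.card with h2 | h1
  · have hne : S.Nonempty := card_pos.1 (by omega)
    have hne' : ∀ i ∈ S, (S.erase i).Nonempty := fun i hi => card_pos.1 (by
      rw [card_erase_of_mem hi]; omega)
    set W := ∑ i ∈ S, (I.w i e : ℝ) with hW
    have hW0 : 0 < W := sum_pos (fun i _ => by exact_mod_cast I.w_pos i e) hne
    have h3 : ∑ i ∈ S, (I.σ e + (1 - B * ((I.w i e : ℝ) / W)) * I.powerCost α e W) ≤
        ∑ i ∈ S, I.usersCost α e (S.erase i) := by
      refine sum_le_sum fun i hi => ?_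
      rw [I.usersCost_of_nonempty hα e (hne' i hi), sum_erase_eq_sub hi]
      have := I.powerCost_sub_ge hα hB e hW0 (w := I.w i e) (by positivity)
        (single_le_sum (f := fun i => (I.w i e : ℝ)) (fun _ _ => by positivity) hi)
      linarith
    have h4 : ∑ i ∈ S, (I.σ e + (1 - B * ((I.w i e : ℝ) / W)) * I.powerCost α e W) =
        S.card * I.σ e + (S.card - B) * I.powerCost α e W := by
      rw [sum_add_distrib, sum_const, nsmul_eq_mul, ← sum_mul, sum_sub_distrib, sum_const,
        ← mul_sum, ← sum_div, ← hW, div_self hW0.ne', nsmul_eq_mul]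
      ring
    rw [I.usersCost_of_nonempty hα e hne, ← hW]
    have := mul_nonneg (zero_le_one.trans hB1) (I.σ_nonneg e)
    linarith
  · have : (S.card : ℝ) ≤ 1 := by exact_mod_cast h1
    nlinarith

/-- The share of player `i` in resource `e` if `i` uses `e` and the other players follow `p`. -/
noncomputable def joinShare (α : Fin q → ℝ) (p : Fin I.N → Finset (Fin I.m)) (i : Fin I.N)
    (e : Fin I.m) : ℝ :=
  I.shapleyShare α e (insert i (I.users p e)) i

/-- The exact potential of the cost sharing game. -/
noncomputable def potential (α : Fin q → ℝ) (p : Fin I.N → Finset (Fin I.m)) : ℝ :=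
  ∑ e, shapleyPotential (I.usersCost α e) (I.users p e)

lemma totalCost_eq (α : Fin q → ℝ) (p : Fin I.N → Finset (Fin I.m)) :
    I.totalCost α p = ∑ e, I.usersCost α e (I.users p e) := rfl

lemma totalCost_nonneg (hα : ∀ j, 1 < α j) (p : Fin I.N → Finset (Fin I.m)) :
    0 ≤ I.totalCost α p :=
  sum_nonneg fun e _ => I.usersCost_nonneg hα e _

lemma mem_users {p : Fin I.N → Finset (Fin I.m)} {e : Fin I.m} {i : Fin I.N} :
    i ∈ I.users p e ↔ e ∈ p i := by simp [users]

lemma sum_sum_mem_eq (p : Fin I.N → Finset (Fin I.m)) (f : Fin I.N → Fin I.m → ℝ) :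
    ∑ i, ∑ e ∈ p i, f i e = ∑ e, ∑ i ∈ I.users p e, f i e :=
  sum_comm' fun i e => by simp [users]

lemma joinShare_eq_shapleyValue (α : Fin q → ℝ) (p : Fin I.N → Finset (Fin I.m)) (i : Fin I.N)
    (e : Fin I.m) :
    I.joinShare α p i e = shapleyValue (I.usersCost α e) (insert i (I.users p e)) i :=
  I.shapleyShare_eq_shapleyValue α e (mem_insert_self _ _)

lemma sum_joinShare (α : Fin q → ℝ) (p : Fin I.N → Finset (Fin I.m)) :
    ∑ i, ∑ e ∈ p i, I.joinShare α p i e = I.totalCost α p := by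
  rw [sum_sum_mem_eq, totalCost_eq]
  refine sum_congr rfl fun e _ => ?_
  rw [← sum_shapleyValue (I.usersCost_empty α e)]
  refine sum_congr rfl fun i hi => ?_
  rw [joinShare_eq_shapleyValue, insert_eq_of_mem hi]

/-- Both profiles agree once j is removed. On each resource the potential is that of the remaining
users plus, if j uses it, the Shapley value of j there, and this value depends only on the other
users. -/
lemma potential_sub_update (α : Fin q → ℝ) (p : Fin I.N → Finset (Fin I.m)) (j : Fin I.N)
    (r : Finset (Fin I.m)) :
    I.potential α p - I.potential α (Function.update p j r) =
      ∑ e ∈ p j, I.joinShare α p j e - ∑ e ∈ r, I.joinShare α p j e := by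
  have h1 : ∀ e, shapleyPotential (I.usersCost α e) (I.users p e) =
      shapleyPotential (I.usersCost α e) ((I.users p e).erase j) +
        if e ∈ p j then I.joinShare α p j e else 0 := by
    intro e
    split_ifs with h
    · have hj : j ∈ I.users p e := I.mem_users.2 h
      rw [joinShare_eq_shapleyValue, insert_eq_of_mem hj,
        ← shapleyPotential_eq_erase_add (I.usersCost_empty α e) hj]
    · rw [erase_eq_of_notMem (fun hj => h (I.mem_users.1 hj)), add_zero]
  have h2 : ∀ e, shapleyPotential (I.usersCost α e) (I.users (Function.update p j r) e) =
      shapleyPotential (I.usersCost α e) ((I.users p e).erase j) +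
        if e ∈ r then I.joinShare α p j e else 0 := by
    intro e
    split_ifs with h
    · have : I.users (Function.update p j r) e = insert j ((I.users p e).erase j) := by
        ext k
        rw [mem_users, mem_insert, mem_erase, mem_users]
        by_cases hk : k = j
        · subst hk; simp [h]
        · simp [hk]
      rw [joinShare_eq_shapleyValue, this,
        shapleyPotential_insert (I.usersCost_empty α e) (notMem_erase _ _)]
      congr 2
      ext k
      by_cases hk : k = j <;> simp [hk]
    · have : I.users (Function.update p j r) e = (I.users p e).erase j := by
        ext k
        rw [mem_users, mem_erase, mem_users]
        by_cases hk : k = j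
        · subst hk; simp [h]
        · simp [hk]
      rw [this, add_zero]
  unfold potential
  simp only [h1, h2, sum_add_distrib, sum_ite_mem, univ_inter]
  ring

lemma potential_le (hα : ∀ j, 1 < α j) (p : Fin I.N → Finset (Fin I.m)) :
    I.potential α p ≤ (harmonic I.N : ℝ) * I.totalCost α p := by
  rw [potential, totalCost_eq, mul_sum]
  refine sum_le_sum fun e _ => (shapleyPotential_le (I.usersCost_empty α e)
    (fun S i => I.usersCost_mono hα e (erase_subset i S)) _).trans ?_
  refine mul_le_mul_of_nonneg_right ?_ (I.usersCost_nonneg hα e _)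
  have h : (I.users p e).card ≤ I.N := (card_le_univ _).trans_eq (Fintype.card_fin _)
  have : harmonic (I.users p e).card ≤ harmonic I.N :=
    sum_le_sum_of_subset_of_nonneg (range_subset_range.2 h) fun i _ _ => by positivity
  exact_mod_cast this

lemma totalCost_le_potential {B : ℝ} (hα : ∀ j, 1 < α j) (hB : ∀ j, α j ≤ B) (hB1 : 1 ≤ B)
    (p : Fin I.N → Finset (Fin I.m)) : I.totalCost α p ≤ B * I.potential α p := by
  rw [potential, totalCost_eq, mul_sum]
  exact sum_le_sum fun e _ => le_mul_shapleyPotential (I.usersCost_empty α e)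
    (I.card_mul_usersCost_le hα hB hB1 e) _

/-- The startup part is at most σ, and by convexity no arrival costs more than arriving after all
current users. -/
lemma joinShare_le (hα : ∀ j, 1 < α j) (p : Fin I.N → Finset (Fin I.m)) (i : Fin I.N)
    (e : Fin I.m) :
    I.joinShare α p i e ≤ I.σ e + I.marginalCost α i e (I.users p e) := by
  rw [joinShare, I.shapleyShare_eq_add_average hα]
  have h1 : I.σ e / (insert i (I.users p e)).card ≤ I.σ e :=
    div_le_self (I.σ_nonneg e) (by
      exact_mod_cast card_pos.2 ⟨i, mem_insert_self i (I.users p e)⟩)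
  have h2 : ∑ π, I.marginalCost α i e (I.predecessors p i e π) ≤
      ∑ _π : Equiv.Perm (Fin I.N), I.marginalCost α i e (I.users p e) := by
    refine sum_le_sum fun π _ => I.marginalCost_mono hα i e ?_
    refine (I.predecessors_subset p i e π).trans fun k hk => ?_
    rw [mem_erase, mem_insert] at hk
    exact hk.2.resolve_left hk.1
  rw [sum_const, card_univ, Fintype.card_perm, Fintype.card_fin, nsmul_eq_mul] at h2
  have h3 : (∑ π, I.marginalCost α i e (I.predecessors p i e π)) / (I.N.factorial : ℝ) ≤
      I.marginalCost α i e (I.users p e) := by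
    rw [div_le_iff₀ (by positivity)]
    linarith
  linarith

/-- Place the players of U one after the other on top of the load of S. By convexity each pays at
least its marginal cost at S, and the payments telescope. The loads are simply added, so S and U may
overlap. -/
lemma sum_marginalCost_le (hα : ∀ j, 1 < α j) (e : Fin I.m) (S U : Finset (Fin I.N)) :
    ∑ i ∈ U, I.marginalCost α i e S ≤
      I.powerCost α e ((∑ k ∈ S, (I.w k e : ℝ)) + ∑ k ∈ U, (I.w k e : ℝ)) -
        I.powerCost α e (∑ k ∈ S, (I.w k e : ℝ)) := by
  induction U using Finset.induction_on with
  | empty => simp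
  | insert i U hi ih =>
    rw [sum_insert hi, sum_insert hi]
    have h := (I.convexOn_powerCost hα e).increment_mono
      (x := ∑ k ∈ S, (I.w k e : ℝ)) (y := (∑ k ∈ S, (I.w k e : ℝ)) + ∑ k ∈ U, (I.w k e : ℝ))
      (w := I.w i e) (by positivity) (le_add_of_nonneg_right (by positivity)) (by positivity)
    rw [add_comm (I.w i e : ℝ), ← add_assoc]
    unfold marginalCost at ih ⊢
    linarith

/-- For the minimising j put r = (σ/ξ)^(1/α), so that ξ r^α = σ, and n = |U|. The cost is at least σ
+ ξ n^α because weights are at least 1. If n ≤ r then nσ ≤ rσ; if n > r then nσ = nξr^α ≤ rξn^α.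
This is the only source of the startup ratio in the guarantee: `joinShare_le` charges σ in full to
every player. -/
lemma card_mul_startup_le (hα : ∀ j, 1 < α j) (e : Fin I.m) (U : Finset (Fin I.N)) :
    U.card * I.σ e ≤ I.startupRatio α * I.usersCost α e U := by
  rcases U.eq_empty_or_nonempty with rfl | hU
  · simp
  obtain ⟨j₀, hj₀⟩ := I.ξ_pos e
  have : Nonempty {j : Fin q // 0 < I.ξ e j} := ⟨⟨j₀, hj₀⟩⟩
  obtain ⟨j, hj⟩ := exists_eq_ciInf_of_finite
    (f := fun j : {j : Fin q // 0 < I.ξ e j} => (I.σ e / I.ξ e j.1) ^ (1 / α j.1))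
  have hr : (I.σ e / I.ξ e j.1) ^ (1 / α j.1) ≤ I.startupRatio α := by
    rw [hj]
    exact le_ciSup (f := fun e : Fin I.m => ⨅ j : {j : Fin q // 0 < I.ξ e j},
      (I.σ e / I.ξ e j.1) ^ (1 / α j.1)) (Set.finite_range _).bddAbove e
  refine le_trans ?_ (mul_le_mul_of_nonneg_right hr (I.usersCost_nonneg hα e U))
  have hσ := I.σ_nonneg e
  have hξ := j.2
  have ha := hα j.1
  set a := α j.1
  set ξ := I.ξ e j.1
  set r := (I.σ e / ξ) ^ (1 / a) with hrdef
  have hr0 : 0 ≤ r := Real.rpow_nonneg (by positivity) _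
  have hra : ξ * r ^ a = I.σ e := by
    rw [hrdef, ← Real.rpow_mul (by positivity), one_div_mul_cancel (by linarith), Real.rpow_one]
    field_simp
  have hn1 : (1 : ℝ) ≤ U.card := by exact_mod_cast card_pos.2 hU
  have hF : I.σ e + ξ * (U.card : ℝ) ^ a ≤ I.usersCost α e U := by
    rw [I.usersCost_of_nonempty hα e hU]
    have h1 : (U.card : ℝ) ≤ ∑ i ∈ U, (I.w i e : ℝ) := by
      have : ∑ i ∈ U, (1 : ℝ) ≤ ∑ i ∈ U, (I.w i e : ℝ) :=
        sum_le_sum fun i _ => by exact_mod_cast I.w_pos i e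
      simpa using this
    have h2 : ξ * (U.card : ℝ) ^ a ≤ I.powerCost α e U.card := by
      unfold powerCost
      exact single_le_sum (f := fun j => I.ξ e j * (U.card : ℝ) ^ α j)
        (fun k _ => mul_nonneg (I.ξ_nonneg e k) (by positivity)) (mem_univ j.1)
    linarith [I.powerCost_mono hα e (by positivity) h1]
  refine le_trans ?_ (mul_le_mul_of_nonneg_left hF hr0)
  rcases le_or_gt (U.card : ℝ) r with h | h
  · have h1 : 0 ≤ r * (ξ * (U.card : ℝ) ^ a) := by positivity
    nlinarith
  · have h1 : r ^ a * U.card ≤ r * (U.card : ℝ) ^ a := by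
      rcases hr0.eq_or_lt with h0 | h0
      · rw [← h0, Real.zero_rpow (by linarith)]
        simp
      · have e1 : r ^ a = r ^ (a - 1) * r := by
          rw [← Real.rpow_add_one h0.ne', sub_add_cancel]
        have e2 : (U.card : ℝ) ^ a = (U.card : ℝ) ^ (a - 1) * U.card := by
          rw [← Real.rpow_add_one (by positivity), sub_add_cancel]
        have e3 : r ^ (a - 1) ≤ (U.card : ℝ) ^ (a - 1) :=
          Real.rpow_le_rpow hr0 h.le (by linarith)
        rw [e1, e2]
        have := mul_le_mul_of_nonneg_right e3 (show 0 ≤ r * (U.card : ℝ) by positivity)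
        linarith
    have h2 : 0 ≤ r * I.σ e := by positivity
    have h3 := mul_le_mul_of_nonneg_left h1 hξ.le
    calc U.card * I.σ e = ξ * (r ^ a * U.card) := by rw [← hra]; ring
      _ ≤ ξ * (r * (U.card : ℝ) ^ a) := h3
      _ ≤ r * (I.σ e + ξ * (U.card : ℝ) ^ a) := by linarith

/-- The smoothness of the cost sharing game. -/
lemma sum_joinShare_le {A ϱ : ℝ} (hα : ∀ j, 1 < α j) (hA : ∀ j, α j ≤ A) (hϱ : 1 ≤ ϱ)
    (p p' : Fin I.N → Finset (Fin I.m)) :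
    ∑ i, ∑ e ∈ p' i, I.joinShare α p i e ≤
      ((5 * A * ϱ) ^ A + I.startupRatio α) * I.totalCost α p' +
        1 / (2 * ϱ) * I.totalCost α p := by
  rw [sum_sum_mem_eq, totalCost_eq, totalCost_eq, mul_sum, mul_sum, ← sum_add_distrib]
  refine sum_le_sum fun e _ => ?_
  have h1 : ∑ i ∈ I.users p' e, I.joinShare α p i e ≤
      (I.users p' e).card * I.σ e + ∑ i ∈ I.users p' e, I.marginalCost α i e (I.users p e) := by
    rw [← nsmul_eq_mul, ← sum_const, ← sum_add_distrib]
    exact sum_le_sum fun i _ => I.joinShare_le hα p i e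
  have h2 := I.sum_marginalCost_le hα e (I.users p e) (I.users p' e)
  have h3 := I.card_mul_startup_le hα e (I.users p' e)
  set x := ∑ k ∈ I.users p e, (I.w k e : ℝ)
  set y := ∑ k ∈ I.users p' e, (I.w k e : ℝ)
  have hx : 0 ≤ x := by positivity
  have hy : 0 ≤ y := by positivity
  have h4 : I.powerCost α e (x + y) - I.powerCost α e x ≤
      (5 * A * ϱ) ^ A * I.powerCost α e y + 1 / (2 * ϱ) * I.powerCost α e x := by
    unfold powerCost
    rw [← sum_sub_distrib, mul_sum, mul_sum, ← sum_add_distrib]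
    refine sum_le_sum fun j _ => ?_
    have := mul_le_mul_of_nonneg_left
      (Real.add_rpow_sub_rpow_le (hα j) (hA j) hϱ hx hy) (I.ξ_nonneg e j)
    linarith
  obtain ⟨j, -⟩ := I.ξ_pos e
  have hA0 : 0 < A := by linarith [hα j, hA j]
  have h5 := mul_le_mul_of_nonneg_left (I.powerCost_le_usersCost hα e (I.users p' e))
    (show 0 ≤ (5 * A * ϱ) ^ A by positivity)
  have h6 := mul_le_mul_of_nonneg_left (I.powerCost_le_usersCost hα e (I.users p e))
    (show 0 ≤ 1 / (2 * ϱ) by positivity)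
  linarith

/-- The cost of a profile of replies that are almost optimal for lonely players. -/
lemma totalCost_le_of_lonely {A ϱ : ℝ} (hα : ∀ j, 1 < α j) (hA : ∀ j, α j ≤ A) (hA1 : 1 ≤ A)
    (hϱ : 1 ≤ ϱ) {p p' : Fin I.N → Finset (Fin I.m)}
    (h : ∀ i, ∑ e ∈ p i, (I.σ e + I.powerCost α e (I.w i e)) ≤
      ϱ * ∑ e ∈ p' i, (I.σ e + I.powerCost α e (I.w i e))) :
    I.totalCost α p ≤ ϱ * (I.N : ℝ) ^ A * I.totalCost α p' := by
  have hcard : ∀ p e, ((I.users p e).card : ℝ) ≤ I.N := fun p e => by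
    exact_mod_cast (card_le_univ _).trans_eq (Fintype.card_fin _)
  have hterm : ∀ i e, 0 ≤ I.σ e + I.powerCost α e (I.w i e) := fun i e =>
    add_nonneg (I.σ_nonneg e) (I.powerCost_nonneg e (by positivity))
  rcases Nat.eq_zero_or_pos I.N with hN | hN
  · have : ∀ p, I.totalCost α p = 0 := fun p => by
      rw [totalCost_eq]
      refine sum_eq_zero fun e _ => ?_
      have : I.users p e = ∅ := by
        ext i
        exact absurd i.2 (by omega)
      rw [this, usersCost_empty]
    rw [this, this, mul_zero]
  have hN1 : (1 : ℝ) ≤ I.N := by exact_mod_cast hN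
  -- Power mean inequality: (Σ w_i)^α ≤ n^(α-1) Σ w_i^α for n ≤ N users. In the other direction,
  -- each user's lonely cost on a resource is at most the resource's cost, which loses another
  -- factor N.
  have h1 : I.totalCost α p ≤
      (I.N : ℝ) ^ (A - 1) * ∑ i, ∑ e ∈ p i, (I.σ e + I.powerCost α e (I.w i e)) := by
    rw [sum_sum_mem_eq, totalCost_eq, mul_sum]
    refine sum_le_sum fun e _ => ?_
    rcases (I.users p e).eq_empty_or_nonempty with h0 | hne
    · simp [h0]
    rw [I.usersCost_of_nonempty hα e hne, sum_add_distrib, mul_add]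
    have hNA : 1 ≤ (I.N : ℝ) ^ (A - 1) := Real.one_le_rpow hN1 (by linarith)
    refine add_le_add ?_ ?_
    · rw [sum_const, nsmul_eq_mul]
      have hc : (1 : ℝ) ≤ (I.users p e).card := by exact_mod_cast card_pos.2 hne
      have := mul_le_mul hNA (mul_le_mul_of_nonneg_right hc (I.σ_nonneg e))
        (by linarith [I.σ_nonneg e]) (by positivity)
      linarith
    · unfold powerCost
      rw [sum_comm, mul_sum]
      refine sum_le_sum fun j _ => ?_
      rw [← mul_sum, mul_left_comm]
      refine mul_le_mul_of_nonneg_left ?_ (I.ξ_nonneg e j)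
      refine (Real.rpow_sum_le_const_mul_sum_rpow_of_nonneg _ (hα j).le
        fun i _ => by positivity).trans ?_
      refine mul_le_mul_of_nonneg_right ?_ (by positivity)
      exact (Real.rpow_le_rpow (by positivity) (hcard p e) (by linarith [hα j])).trans
        (Real.rpow_le_rpow_of_exponent_le hN1 (by linarith [hA j]))
  have h2 : ∑ i, ∑ e ∈ p' i, (I.σ e + I.powerCost α e (I.w i e)) ≤ I.N * I.totalCost α p' := by
    rw [sum_sum_mem_eq, totalCost_eq, mul_sum]
    refine sum_le_sum fun e _ => ?_
    have h3 : ∀ i ∈ I.users p' e, I.σ e + I.powerCost α e (I.w i e) ≤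
        I.usersCost α e (I.users p' e) := by
      intro i hi
      rw [I.usersCost_of_nonempty hα e ⟨i, hi⟩]
      have := I.powerCost_mono hα e (x := I.w i e) (by positivity)
        (single_le_sum (f := fun i => (I.w i e : ℝ)) (fun _ _ => by positivity) hi)
      linarith
    refine (sum_le_sum h3).trans ?_
    rw [sum_const, nsmul_eq_mul]
    exact mul_le_mul_of_nonneg_right (hcard p' e) (I.usersCost_nonneg hα e _)
  have h3 : ∑ i, ∑ e ∈ p i, (I.σ e + I.powerCost α e (I.w i e)) ≤
      ϱ * ∑ i, ∑ e ∈ p' i, (I.σ e + I.powerCost α e (I.w i e)) := by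
    rw [mul_sum]
    exact sum_le_sum fun i _ => h i
  calc I.totalCost α p ≤ (I.N : ℝ) ^ (A - 1) * (ϱ * (I.N * I.totalCost α p')) :=
        h1.trans (mul_le_mul_of_nonneg_left
          (h3.trans (mul_le_mul_of_nonneg_left h2 (by linarith))) (by positivity))
    _ = ϱ * ((I.N : ℝ) ^ (A - 1) * I.N) * I.totalCost α p' := by ring
    _ = ϱ * (I.N : ℝ) ^ A * I.totalCost α p' := by
        rw [← Real.rpow_add_one (by positivity), sub_add_cancel]

end GNDInstance

/-! ### The approximate best response dynamics -/

namespace GNDInstance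

open Prog

variable {R : RequestFamily} {q : ℕ} (I : GNDInstance R q) {α : Fin q → ℝ}
  (O : Fin I.N → (Fin I.m → ℝ) → Finset (Fin I.m))

@[simp] lemma expect_totalCost (p : Fin I.N → Finset (Fin I.m)) (g : ℝ → ℝ) :
    expect O ((I.numInput α).totalCost p) g = g (I.totalCost α p) := by
  unfold NumInput.totalCost
  rw [expect_sumEach_det O (x := fun e => I.resourceCost α e (I.load p e))]
  · rfl
  · intro e g
    have h1 : ∑ i, (if decide (e ∈ p i) = true then (I.numInput α).w i e else 0) =
        ((I.load p e : ℕ) : ℝ) := by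
      rw [← Finset.sum_filter, load]
      push_cast
      refine Finset.sum_congr ?_ fun _ _ => rfl
      ext i
      simp [users]
    simp only [bind_eq, expect_bind, expect_sumIf, h1, expect_natP, expect_leP]
    have h2 : ((I.load p e : ℕ) : ℝ) ≤ ((0 : ℕ) : ℝ) ↔ I.load p e = 0 := by
      rw [Nat.cast_le, Nat.le_zero]
    by_cases h : I.load p e = 0
    · simp [h, resourceCost]
    · rw [if_neg (by simpa [h2] using h), expect_positiveCost, resourceCost, if_neg h]
      rfl

/-- The reply and the estimated gain that player `i` obtains from the cost shares `τ`. -/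
noncomputable def replyAndGain (ε₁ : ℝ) (p : Fin I.N → Finset (Fin I.m)) (i : Fin I.N)
    (τ : Fin I.m → ℝ) : Finset (Fin I.m) × ℝ :=
  (O i τ, ∑ e ∈ p i, τ e - ε₁ * ∑ e ∈ O i τ, τ e)

/-- The requirement `Q` on single estimates is left open: positivity gives feasibility, and
ε-accuracy gives the approximation guarantee. -/
lemma failProb_response_le
    {share : (Fin I.N → Finset (Fin I.m)) → Fin I.N → Fin I.m → Prog ℝ I.N I.m ℝ}
    (ε₁ : ℝ) {p : Fin I.N → Finset (Fin I.m)} {i : Fin I.N} {Q : Fin I.m → ℝ → Prop} {η : ℝ}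
    (h : ∀ e, failProb O (share p i e) (Q e) ≤ η) :
    failProb O (NumInput.response share ε₁ p i)
      (fun x => ∃ τ, (∀ e, Q e (τ e)) ∧ x = I.replyAndGain O ε₁ p i τ) ≤ I.m * η := by
  simp only [NumInput.response, bind_eq]
  refine (failProb_bind_le O _ (failProb_forEach_le O h) (δ' := 0) (fun τ hτ => ?_) le_rfl).trans
    (by simp)
  unfold failProb
  simp only [expect_bind, expect_oracleP, expect_sumIf, expect_arithP, expect_ret]
  refine (if_pos ⟨τ, hτ, ?_⟩).le
  simp [replyAndGain, ArithOp.eval]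

/-- One step of the dynamics. -/
lemma failProb_dynamics_succ_le
    {share : (Fin I.N → Finset (Fin I.m)) → Fin I.N → Fin I.m → Prog ℝ I.N I.m ℝ} {ε₁ : ℝ}
    {T : ℕ} {p best : Fin I.N → Finset (Fin I.m)} {c : ℝ} (hN : 0 < I.N)
    {Qx : Fin I.N → Finset (Fin I.m) × ℝ → Prop} {Q : (Fin I.N → Finset (Fin I.m)) → Prop}
    {δ δ' : ℝ} (hδ' : 0 ≤ δ')
    (hx : ∀ i, failProb O (NumInput.response share ε₁ p i) (Qx i) ≤ δ)
    (hnone : ∀ x : Fin I.N → Finset (Fin I.m) × ℝ, (∀ i, Qx i (x i)) → (∀ i, (x i).2 ≤ 0) →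
      Q best)
    (hstep : ∀ (x : Fin I.N → Finset (Fin I.m) × ℝ) (j : Fin I.N), (∀ i, Qx i (x i)) →
      0 < (x j).2 → (∑ i, (x i).2) / I.N ≤ (x j).2 → ∀ best' c',
      (best' = best ∧ c' = c ∧ c ≤ I.totalCost α (Function.update p j (x j).1) ∨
        best' = Function.update p j (x j).1 ∧
          c' = I.totalCost α (Function.update p j (x j).1) ∧ c' ≤ c) →
      failProb O ((I.numInput α).dynamics share ε₁ T (Function.update p j (x j).1) best' c') Q ≤
        δ') :
    failProb O ((I.numInput α).dynamics share ε₁ (T + 1) p best c) Q ≤ I.N * δ + δ' := by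
  have hNr : (0 : ℝ) < I.N := by exact_mod_cast hN
  simp only [NumInput.dynamics, bind_eq, failProb_tick]
  refine failProb_bind_le O _ (failProb_forEach_le O hx) (fun x hQx => ?_) hδ'
  -- Once the responses are fixed, the rest of the round is deterministic, so only the responses
  -- enter the failure probability of the round.
  rw [failProb_bind_eq O (a := (0 : ℝ)) (fun g => by simp)]
  obtain ⟨r, hr1, hr2, hr3⟩ := expect_findFirst O (n := I.N) (f := fun i =>
    (leP (x i).2 (0 : ℝ)).bind fun b => ret (!b)) (b := fun i => !decide ((x i).2 ≤ 0))
    fun i g => by simp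
  rw [failProb_bind_eq O hr3]
  cases r with
  | none =>
    refine (failProb_ret O (hnone x hQx fun i => ?_)).trans_le hδ'
    simpa using hr1 rfl i
  | some i₀ =>
    have hi₀ : 0 < (x i₀).2 := by simpa using hr2 i₀ rfl
    simp only
    rw [failProb_bind_eq O (a := ∑ i, (x i).2)
      (fun g => expect_sumEach_det O (fun i g => by simp) g),
      failProb_bind_eq O (a := (I.N : ℝ)) (fun g => by simp),
      failProb_bind_eq O (a := (∑ i, (x i).2) / I.N) (fun g => by simp [ArithOp.eval])]
    obtain ⟨r, hr1, hr2, hr3⟩ := expect_findFirst O (n := I.N) (f := fun i =>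
      (leP (x i).2 (0 : ℝ)).bind fun b => (leP ((∑ i, (x i).2) / I.N) (x i).2).bind fun b' =>
        ret (!b && b'))
      (b := fun i => !decide ((x i).2 ≤ 0) && decide ((∑ i, (x i).2) / I.N ≤ (x i).2))
      fun i g => by simp
    rw [failProb_bind_eq O hr3]
    cases r with
    | none =>
      -- A player with the largest gain passes both tests: its gain is at least the average, and it
      -- is positive because some gain is.
      exfalso
      obtain ⟨j, -, hj⟩ := Finset.exists_max_image Finset.univ (fun i => (x i).2)
        ⟨i₀, Finset.mem_univ _⟩
      have h1 : 0 < (x j).2 := hi₀.trans_le (hj i₀ (Finset.mem_univ _))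
      have h2 : (∑ i, (x i).2) / I.N ≤ (x j).2 := by
        rw [div_le_iff₀ hNr, mul_comm]
        have := Finset.sum_le_card_nsmul Finset.univ (fun i => (x i).2) _ hj
        simpa using this
      have := hr1 rfl j
      simp [h2, not_le.2 h1] at this
    | some j =>
      have hj := hr2 j rfl
      simp only [Bool.and_eq_true, Bool.not_eq_true', decide_eq_false_iff_not, not_le,
        decide_eq_true_eq] at hj
      simp only
      rw [failProb_bind_eq O (a := ()) (fun g => by simp),
        failProb_bind_eq O (a := I.totalCost α (Function.update p j (x j).1)) (fun g => by simp),
        failProb_bind_eq O (a := decide (c ≤ I.totalCost α (Function.update p j (x j).1)))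
          (fun g => by simp)]
      split_ifs with h
      · exact hstep x j hQx hj.1 hj.2 _ _ (Or.inl ⟨rfl, rfl, by simpa using h⟩)
      · refine hstep x j hQx hj.1 hj.2 _ _ (Or.inr ⟨rfl, rfl, ?_⟩)
        simp only [decide_eq_true_eq, not_le] at h
        exact h.le

lemma Feasible.update {p : Fin I.N → Finset (Fin I.m)} (hp : I.Feasible p) {j : Fin I.N}
    {r : Finset (Fin I.m)} (hr : r ∈ R.replies I.m (I.req j)) :
    I.Feasible (Function.update p j r) := by
  intro i
  by_cases h : i = j
  · subst h; simpa using hr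
  · simpa [h] using hp i

/-- The dynamics only visits feasible profiles. -/
lemma failProb_dynamics_feasible
    {share : (Fin I.N → Finset (Fin I.m)) → Fin I.N → Fin I.m → Prog ℝ I.N I.m ℝ} {ε₁ : ℝ}
    (hO : ∀ i τ, (∀ e, 0 < τ e) → O i τ ∈ R.replies I.m (I.req i)) (hN : 0 < I.N)
    (hshare : ∀ p i e, failProb O (share p i e) (0 < ·) = 0) (T : ℕ)
    {p best : Fin I.N → Finset (Fin I.m)} {c : ℝ} (hp : I.Feasible p) (hbest : I.Feasible best) :
    failProb O ((I.numInput α).dynamics share ε₁ T p best c) I.Feasible = 0 := by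
  refine le_antisymm ?_ (failProb_nonneg O _ _)
  induction T generalizing p best c with
  | zero => exact (failProb_ret O hbest).le
  | succ T ih =>
    refine (I.failProb_dynamics_succ_le O hN le_rfl
      (fun i => I.failProb_response_le O ε₁ (Q := fun _ => (0 < ·)) (η := 0)
        fun e => (hshare p i e).le) (fun x _ _ => hbest) ?_).trans (by simp)
    intro x j hx _ _ best' c' hb
    obtain ⟨τ, hτ, hxj⟩ := hx j
    have hr : (x j).1 ∈ R.replies I.m (I.req j) := by
      rw [hxj]
      exact hO j τ hτ
    have hp' := Feasible.update I hp hr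
    rcases hb with ⟨rfl, -⟩ | ⟨rfl, -⟩
    · exact ih hp' hbest
    · exact ih hp' hp'

/-- The replies and gains of all players at `p`, computed from `ε`-accurate estimates. -/
def AccurateReply (α : Fin q → ℝ) (ε : ℝ) (p : Fin I.N → Finset (Fin I.m)) (i : Fin I.N)
    (x : Finset (Fin I.m) × ℝ) : Prop :=
  ∃ τ : Fin I.m → ℝ, (∀ e, τ e ∈ Set.Icc ((1 - ε) * I.joinShare α p i e)
    ((1 + ε) * I.joinShare α p i e)) ∧ x = I.replyAndGain O (epsOne ε) p i τ

section Accurate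

variable {A ε ϱ : ℝ} {p p' : Fin I.N → Finset (Fin I.m)}
  {x : Fin I.N → Finset (Fin I.m) × ℝ}

/-- A lower bound for the sum of the estimated gains. -/
lemma le_sum_gains (hα : ∀ j, 1 < α j) (hA : ∀ j, α j ≤ A) (hε : 0 < ε) (hε1 : ε < 1)
    (hϱ : 1 ≤ ϱ) (hO : ∀ i τ, (∀ e, 0 < τ e) →
      ∑ e ∈ O i τ, τ e ≤ ϱ * ∑ e ∈ p' i, τ e)
    (hx : ∀ i, I.AccurateReply O α ε p i (x i)) :
    (1 - ε) * ((1 - epsOne ε ^ 2 / 2) * I.totalCost α p - epsOne ε ^ 2 * ϱ *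
      ((5 * A * ϱ) ^ A + I.startupRatio α) * I.totalCost α p') ≤ ∑ i, (x i).2 := by
  have hε' : 0 < 1 - ε := by linarith
  have he : epsOne ε * (1 - ε) = 1 + ε := div_mul_cancel₀ _ hε'.ne'
  have he0 : 0 < epsOne ε := div_pos (by linarith) hε'
  -- Estimates of the current share lose 1 - ε. The reply loses ε₁, the oracle's ϱ and the
  -- overestimate 1 + ε = (1 - ε)ε₁², divided by ε₁; together these are (1 - ε)ε₁²ϱ.
  have h1 : ∀ i, (1 - ε) * ∑ e ∈ p i, I.joinShare α p i e -
      (1 - ε) * epsOne ε ^ 2 * ϱ * ∑ e ∈ p' i, I.joinShare α p i e ≤ (x i).2 := by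
    intro i
    obtain ⟨τ, hτ, hxi⟩ := hx i
    have hτ0 : ∀ e, 0 < τ e := fun e =>
      (mul_pos hε' (I.shapleyShare_pos hα p i e)).trans_le (hτ e).1
    have h2 : (1 - ε) * ∑ e ∈ p i, I.joinShare α p i e ≤ ∑ e ∈ p i, τ e := by
      rw [Finset.mul_sum]
      exact Finset.sum_le_sum fun e _ => (hτ e).1
    have h3 : ∑ e ∈ p' i, τ e ≤ (1 + ε) * ∑ e ∈ p' i, I.joinShare α p i e := by
      rw [Finset.mul_sum]
      exact Finset.sum_le_sum fun e _ => (hτ e).2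
    have h4 := mul_le_mul_of_nonneg_left ((hO i τ hτ0).trans
      (mul_le_mul_of_nonneg_left h3 (by linarith))) he0.le
    rw [hxi]
    simp only [replyAndGain]
    have h5 : epsOne ε * (ϱ * ((1 + ε) * ∑ e ∈ p' i, I.joinShare α p i e)) =
        (1 - ε) * epsOne ε ^ 2 * ϱ * ∑ e ∈ p' i, I.joinShare α p i e := by
      rw [← he]; ring
    linarith
  have h2 := Finset.sum_le_sum fun i (_ : i ∈ Finset.univ) => h1 i
  rw [Finset.sum_sub_distrib, ← Finset.mul_sum, ← Finset.mul_sum, I.sum_joinShare] at h2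
  have h3 := mul_le_mul_of_nonneg_left (I.sum_joinShare_le hα hA hϱ p p')
    (show 0 ≤ (1 - ε) * epsOne ε ^ 2 * ϱ by positivity)
  -- Here the smoothness coefficient 1/(2ϱ) cancels ϱ, which leaves the coefficient 1 - ε₁²/2 in
  -- front of C(p).
  have h4 : (1 - ε) * epsOne ε ^ 2 * ϱ * (1 / (2 * ϱ) * I.totalCost α p) =
      (1 - ε) * (epsOne ε ^ 2 / 2 * I.totalCost α p) := by
    field_simp
  linarith

/-- An improvement step decreases the potential. -/
lemma gain_le_potential_sub (hε : 0 < ε) (hε1 : ε < 1) {j : Fin I.N}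
    {x : Finset (Fin I.m) × ℝ} (hx : I.AccurateReply O α ε p j x) :
    x.2 ≤ (1 + ε) * (I.potential α p - I.potential α (Function.update p j x.1)) := by
  have hε' : 0 < 1 - ε := by linarith
  obtain ⟨τ, hτ, rfl⟩ := hx
  rw [I.potential_sub_update]
  simp only [replyAndGain]
  have h2 : ∑ e ∈ p j, τ e ≤ (1 + ε) * ∑ e ∈ p j, I.joinShare α p j e := by
    rw [Finset.mul_sum]
    exact Finset.sum_le_sum fun e _ => (hτ e).2
  have h3 : (1 - ε) * ∑ e ∈ O j τ, I.joinShare α p j e ≤ ∑ e ∈ O j τ, τ e := by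
    rw [Finset.mul_sum]
    exact Finset.sum_le_sum fun e _ => (hτ e).1
  have h4 := mul_le_mul_of_nonneg_left h3 (show 0 ≤ epsOne ε by
    exact div_nonneg (by linarith) hε'.le)
  -- The identity ε₁(1 - ε) = 1 + ε is the reason for the choice of ε₁: an overestimated old share
  -- and an underestimated new one then carry the same factor, so a positive estimated gain is a
  -- true decrease of the potential.
  rw [← mul_assoc, epsOne, div_mul_cancel₀ _ hε'.ne'] at h4
  unfold epsOne
  linarith

end Accurate

/-- With high probability, the dynamics finds a profile whose cost is within the factor `r` of
the cost of `p'`. -/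
lemma failProb_dynamics_le {A B ε ϱ r : ℝ}
    {share : (Fin I.N → Finset (Fin I.m)) → Fin I.N → Fin I.m → Prog ℝ I.N I.m ℝ} {η : ℝ}
    (hα : ∀ j, 1 < α j) (hA : ∀ j, α j ≤ A) (hAB : A ≤ B) (hA1 : 1 ≤ A)
    (hε : 0 < ε) (hε1 : ε < 1) (hε2 : epsOne ε ^ 2 < 2) (hϱ : 1 ≤ ϱ)
    {p' : Fin I.N → Finset (Fin I.m)}
    (hO : ∀ i τ, (∀ e, 0 < τ e) → ∑ e ∈ O i τ, τ e ≤ ϱ * ∑ e ∈ p' i, τ e) (hN : 0 < I.N)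
    (hη : 0 ≤ η)
    (hshare : ∀ p i e, failProb O (share p i e) (· ∈ Set.Icc ((1 - ε) * I.joinShare α p i e)
      ((1 + ε) * I.joinShare α p i e)) ≤ η)
    (hr : 2 * epsOne ε ^ 2 * ϱ * ((5 * A * ϱ) ^ A + I.startupRatio α) ≤
      (1 - epsOne ε ^ 2 / 2) * r)
    (T : ℕ) {p best : Fin I.N → Finset (Fin I.m)} {c : ℝ}
    (hc : c = I.totalCost α best) (hcp : c ≤ I.totalCost α p)
    (hinv : c ≤ r * I.totalCost α p' ∨ B * (I.potential α p *
      Real.exp (-(T / (2 * epsOne ε * I.N * (harmonic I.N : ℝ) / (1 - epsOne ε ^ 2 / 2))))) ≤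
        r * I.totalCost α p') :
    failProb O ((I.numInput α).dynamics share (epsOne ε) T p best c)
      (fun p => I.totalCost α p ≤ r * I.totalCost α p') ≤ T * (I.N * (I.m * η)) := by
  have hε' : 0 < 1 - ε := by linarith
  have hκ : 0 < 1 - epsOne ε ^ 2 / 2 := by linarith
  have he : epsOne ε * (1 - ε) = 1 + ε := div_mul_cancel₀ _ hε'.ne'
  have he0 : 0 < epsOne ε := div_pos (by linarith) hε'
  have hNr : (0 : ℝ) < I.N := by exact_mod_cast hN
  have hH : (0 : ℝ) < (harmonic I.N : ℝ) := by exact_mod_cast harmonic_pos hN.ne'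
  have hB0 : 0 < B := by linarith
  have hC' := I.totalCost_nonneg hα p'
  set κ := 1 - epsOne ε ^ 2 / 2 with hκdef
  set Z : ℝ := 2 * epsOne ε * I.N * (harmonic I.N : ℝ) / κ with hZ
  have hZ0 : 0 < Z := by positivity
  have hle : ∀ p, I.totalCost α p ≤ B * I.potential α p := fun p =>
    I.totalCost_le_potential hα (fun j => (hA j).trans hAB) (hA1.trans hAB) p
  -- The invariant: the best profile is already good enough, or the potential, shrunk by e^(-1/Z) in
  -- each of the T remaining rounds, ends below the target. At T = 0 the second case bounds the cost
  -- by C ≤ BΦ.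
  induction T generalizing p best c with
  | zero =>
    refine (failProb_ret O ?_).le.trans (by simp)
    rw [← hc]
    rcases hinv with h | h
    · exact h
    · simp only [Nat.cast_zero, zero_div, neg_zero, Real.exp_zero, mul_one] at h
      exact hcp.trans ((hle p).trans h)
  | succ T ih =>
    refine (I.failProb_dynamics_succ_le O hN (δ' := T * (I.N * (I.m * η))) (by positivity)
      (fun i => I.failProb_response_le O (epsOne ε) fun e => hshare p i e) ?_ ?_).trans
        (by push_cast; linarith)
    · intro x hx hx0
      have h1 := I.le_sum_gains O hα hA hε hε1 hϱ hO hx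
      rw [← hκdef] at h1
      have h2 : ∑ i, (x i).2 ≤ 0 := Finset.sum_nonpos fun i _ => hx0 i
      -- Nobody gains, so κC(p) is at most the λ-term of `le_sum_gains`, which `hr` bounds by κ/2
      -- times the target.
      have h3 := nonpos_of_mul_nonpos_right (h1.trans h2) hε'
      rw [← hc]
      refine hcp.trans ?_
      have h4 := mul_le_mul_of_nonneg_right hr hC'
      have h5 : κ * I.totalCost α p ≤ κ * (r * I.totalCost α p') := by
        have h6 : 0 ≤ epsOne ε ^ 2 * ϱ * ((5 * A * ϱ) ^ A + I.startupRatio α) *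
            I.totalCost α p' := by
          by_contra hneg
          rw [not_le] at hneg
          have := mul_nonneg hκ.le (I.totalCost_nonneg hα p)
          linarith
        linarith
      exact le_of_mul_le_mul_left h5 hκ
    · intro x j hx hj0 hj best' c' hb
      have hc' : c' = I.totalCost α best' ∧
          c' ≤ I.totalCost α (Function.update p j (x j).1) ∧ c' ≤ c := by
        rcases hb with ⟨rfl, rfl, h⟩ | ⟨rfl, rfl, h⟩
        · exact ⟨hc, h, le_rfl⟩
        · exact ⟨rfl, le_rfl, h⟩
      refine ih hc'.1 hc'.2.1 ?_
      by_cases hdone : c ≤ r * I.totalCost α p'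
      · exact Or.inl (hc'.2.2.trans hdone)
      right
      have hinv' := hinv.resolve_left hdone
      rw [not_le] at hdone
      have h1 := I.le_sum_gains O hα hA hε hε1 hϱ hO hx
      rw [← hκdef] at h1
      have h2 := I.gain_le_potential_sub O hε hε1 (hx j)
      have h3 := mul_le_mul_of_nonneg_right hr hC'
      have h4 : κ * (r * I.totalCost α p') ≤ κ * I.totalCost α p :=
        mul_le_mul_of_nonneg_left (hdone.le.trans hcp) hκ.le
      -- Since even the best cost exceeds the target, the factor 2 in `hr` lets half of κC(p) absorb
      -- the λ-term. The other half is a lower bound for the sum of the gains.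
      have h5 : (1 - ε) * (κ / 2 * I.totalCost α p) ≤ ∑ i, (x i).2 :=
        (mul_le_mul_of_nonneg_left (by linarith) hε'.le).trans h1
      rw [div_le_iff₀ hNr] at hj
      have h6 : (1 - ε) * (κ / 2 * I.totalCost α p) ≤ (1 + ε) *
          (I.potential α p - I.potential α (Function.update p j (x j).1)) * I.N :=
        h5.trans (hj.trans (mul_le_mul_of_nonneg_right h2 hNr.le))
      rw [← he] at h6
      have h7 : κ / 2 * I.totalCost α p ≤ epsOne ε *
          (I.potential α p - I.potential α (Function.update p j (x j).1)) * I.N := by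
        refine le_of_mul_le_mul_left ?_ hε'
        linarith
      have h8 := mul_le_mul_of_nonneg_left (I.potential_le hα p) (show 0 ≤ κ / 2 by positivity)
      -- The chosen gain is at least the average and Φ ≤ H_N C, so one move removes at least the
      -- fraction 1/Z of the potential.
      have h9 : I.potential α p ≤
          Z * (I.potential α p - I.potential α (Function.update p j (x j).1)) := by
        have e1 : Z * (I.potential α p - I.potential α (Function.update p j (x j).1)) =
            (2 * (harmonic I.N : ℝ) / κ) * (epsOne ε *
              (I.potential α p - I.potential α (Function.update p j (x j).1)) * I.N) := by
          rw [hZ]; ring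
        have e2 : I.potential α p = (2 / κ) * (κ / 2 * I.potential α p) := by
          field_simp
        rw [e1]
        calc I.potential α p = (2 / κ) * (κ / 2 * I.potential α p) := e2
          _ ≤ (2 / κ) * (κ / 2 * ((harmonic I.N : ℝ) * I.totalCost α p)) := by gcongr
          _ = (2 * (harmonic I.N : ℝ) / κ) * (κ / 2 * I.totalCost α p) := by ring
          _ ≤ _ := by gcongr
      have hΦ : 0 ≤ I.potential α p := by
        have := (I.totalCost_nonneg hα p).trans (hle p)
        exact nonneg_of_mul_nonneg_right this hB0
      have h10 : I.potential α (Function.update p j (x j).1) ≤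
          I.potential α p * Real.exp (-(1 / Z)) := by
        have e1 := Real.add_one_le_exp (-(1 / Z))
        have e2 : I.potential α p / Z ≤
            I.potential α p - I.potential α (Function.update p j (x j).1) := by
          rw [div_le_iff₀ hZ0]; linarith
        have e3 := mul_le_mul_of_nonneg_left e1 hΦ
        have e4 : I.potential α p * (-(1 / Z) + 1) = I.potential α p - I.potential α p / Z := by
          ring
        linarith
      refine le_trans ?_ hinv'
      have e5 : Real.exp (-(((T + 1 : ℕ) : ℝ) / Z)) = Real.exp (-(1 / Z)) * Real.exp (-(T / Z)) := by
        rw [← Real.exp_add]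
        congr 1
        push_cast
        ring
      rw [e5, ← mul_assoc (I.potential α p)]
      gcongr

/-- Enough iterations suffice to reduce the potential of the initial profile. -/
lemma potential_mul_exp_le {A ϱ : ℝ} {T : ℕ} {Z : ℝ} {B : ℝ} (hZ : 0 < Z)
    (hα : ∀ j, 1 < α j) (hA : ∀ j, α j ≤ A) (hB : 0 < B) (hA1 : 1 ≤ A) (hϱ : 1 ≤ ϱ) (hN : 0 < I.N)
    (hT : Z * Real.log ((harmonic I.N : ℝ) * B * (I.N : ℝ) ^ A) ≤ T)
    {p p' : Fin I.N → Finset (Fin I.m)}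
    (h : ∀ i, ∑ e ∈ p i, (I.σ e + I.powerCost α e (I.w i e)) ≤
      ϱ * ∑ e ∈ p' i, (I.σ e + I.powerCost α e (I.w i e))) :
    B * (I.potential α p * Real.exp (-(T / Z))) ≤ ϱ * I.totalCost α p' := by
  have hNr : (0 : ℝ) < I.N := by exact_mod_cast hN
  have hH : (0 : ℝ) < (harmonic I.N : ℝ) := by exact_mod_cast harmonic_pos hN.ne'
  have h1 := I.totalCost_le_of_lonely hα hA hA1 hϱ h
  have h2 := I.potential_le hα p
  have hC := I.totalCost_nonneg hα p
  have h3 : Real.exp (-(T / Z)) ≤ ((harmonic I.N : ℝ) * B * (I.N : ℝ) ^ A)⁻¹ := by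
    rw [Real.exp_neg]
    refine inv_anti₀ (by positivity) ?_
    rw [← Real.log_le_iff_le_exp (by positivity), le_div_iff₀ hZ]
    linarith
  calc B * (I.potential α p * Real.exp (-(T / Z)))
      ≤ B * (((harmonic I.N : ℝ) * I.totalCost α p) *
          ((harmonic I.N : ℝ) * B * (I.N : ℝ) ^ A)⁻¹) := by
        gcongr
    _ = I.totalCost α p / (I.N : ℝ) ^ A := by field_simp
    _ ≤ ϱ * I.totalCost α p' := by
        rw [div_le_iff₀ (by positivity)]
        linarith

end GNDInstance

/-! ### The parameters -/

section Parameters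

variable {q : ℕ} {α : Fin q → ℝ} {ε : ℝ} {N m : ℕ}

lemma le_iSup_exponent (j : Fin q) : α j ≤ ⨆ j, α j := le_ciSup (Set.finite_range α).bddAbove j

/-- Allows constants to be absorbed into the logarithmic factors, including the smallest instances
with N = m = 1. -/
lemma half_le_log_add_one {x : ℝ} (hx : 1 ≤ x) : 1 / 2 ≤ Real.log (x + 1) := by
  have h1 := Real.log_two_gt_d9
  have h2 := Real.log_le_log (by norm_num) (show (2 : ℝ) ≤ x + 1 by linarith)
  linarith

lemma one_le_epsOne (hε : 0 < ε) (hε1 : ε < 1) : 1 ≤ epsOne ε := by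
  rw [epsOne, one_le_div (by linarith)]
  linarith

lemma one_le_harmonic (hN : 1 ≤ N) : (1 : ℝ) ≤ (harmonic N : ℝ) := by
  have : harmonic 1 ≤ harmonic N :=
    Finset.sum_le_sum_of_subset_of_nonneg (Finset.range_subset_range.2 hN)
      fun i _ _ => by positivity
  have h1 : harmonic 1 = 1 := by norm_num [harmonic]
  rw [h1] at this
  exact_mod_cast this

/-- A lower bound on T is needed for the success probability, which is 1 minus a multiple of
1/(T·N·m). One logarithm comes from H_N ≥ log(N + 1), the other from the argument H_N·B·N^A ≥ 2N ≥ N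
+ 1, as ⌈max α⌉ ≥ 2. -/
lemma le_numIterations (hα : 1 < ⨆ j, α j) (hε : 0 < ε) (hε1 : ε < 1) (hε2 : epsOne ε ^ 2 < 2)
    (hN : 1 ≤ N) : 2 * N * Real.log (N + 1) ^ 2 ≤ numIterations α ε N := by
  have hN1 : (1 : ℝ) ≤ N := by exact_mod_cast hN
  have hL := half_le_log_add_one hN1
  have he := one_le_epsOne hε hε1
  have hH := one_le_harmonic hN
  have hHL : Real.log (N + 1) ≤ (harmonic N : ℝ) := by
    exact_mod_cast log_add_one_le_harmonic N
  have hB : (2 : ℝ) ≤ (⌈⨆ j, α j⌉₊ : ℝ) := by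
    have : 1 < ⌈⨆ j, α j⌉₊ := Nat.lt_ceil.2 (by exact_mod_cast hα)
    exact_mod_cast this
  have hNA : (N : ℝ) ≤ (N : ℝ) ^ (⨆ j, α j) := by
    simpa using Real.rpow_le_rpow_of_exponent_le hN1 hα.le
  have hκ : 0 < 1 - epsOne ε ^ 2 / 2 := by linarith
  have hκ1 : 1 - epsOne ε ^ 2 / 2 ≤ 1 := by linarith [sq_nonneg (epsOne ε)]
  have h1 : Real.log (N + 1) ≤
      Real.log ((harmonic N : ℝ) * (⌈⨆ j, α j⌉₊ : ℝ) * (N : ℝ) ^ (⨆ j, α j)) := by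
    refine Real.log_le_log (by linarith) ?_
    calc (N : ℝ) + 1 ≤ 1 * 2 * N := by linarith
      _ ≤ _ := by gcongr
  have h2 : 2 * N * Real.log (N + 1) ≤
      2 * epsOne ε * N * (harmonic N : ℝ) / (1 - epsOne ε ^ 2 / 2) := by
    rw [le_div_iff₀ hκ]
    calc 2 * N * Real.log (N + 1) * (1 - epsOne ε ^ 2 / 2)
        ≤ 2 * N * Real.log (N + 1) * 1 := by gcongr
      _ = 2 * 1 * N * Real.log (N + 1) := by ring
      _ ≤ 2 * epsOne ε * N * (harmonic N : ℝ) := by gcongr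
  refine le_trans ?_ (Nat.le_ceil _)
  calc 2 * N * Real.log (N + 1) ^ 2 = 2 * N * Real.log (N + 1) * Real.log (N + 1) := by ring
    _ ≤ _ := by gcongr

lemma numIterations_pos (hα : 1 < ⨆ j, α j) (hε : 0 < ε) (hε1 : ε < 1) (hε2 : epsOne ε ^ 2 < 2)
    (hN : 1 ≤ N) : 0 < numIterations α ε N := by
  have hN1 : (1 : ℝ) ≤ N := by exact_mod_cast hN
  have hL := half_le_log_add_one hN1
  have h := le_numIterations hα hε hε1 hε2 hN
  have : (0 : ℝ) < numIterations α ε N := lt_of_lt_of_le (by positivity) h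
  exact_mod_cast this

lemma numIterations_le (hα : 1 < ⨆ j, α j) (hε : 0 < ε) (hε1 : ε < 1) (hε2 : epsOne ε ^ 2 < 2) :
    ∃ K : ℝ, 1 ≤ K ∧ ∀ N : ℕ, 1 ≤ N →
      (numIterations α ε N : ℝ) ≤ K * (N * Real.log (N + 1) ^ 2) := by
  have he := one_le_epsOne hε hε1
  have hκ : 0 < 1 - epsOne ε ^ 2 / 2 := by linarith
  set κ := 1 - epsOne ε ^ 2 / 2
  set A := ⨆ j, α j
  set B : ℝ := (⌈A⌉₊ : ℝ)
  have hB : 1 ≤ B := by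
    have : 1 ≤ ⌈A⌉₊ := Nat.one_le_ceil_iff.2 (by linarith)
    exact Nat.one_le_cast.2 this
  have hK : 0 ≤ 6 * epsOne ε / κ * (3 + 2 * B + A) := by positivity
  refine ⟨6 * epsOne ε / κ * (3 + 2 * B + A) + 4, by linarith, fun N hN => ?_⟩
  have hN1 : (1 : ℝ) ≤ N := by exact_mod_cast hN
  have hL := half_le_log_add_one hN1
  set L := Real.log (N + 1)
  have hlogN : Real.log N ≤ L := Real.log_le_log (by linarith) (by linarith)
  have hlogN0 : 0 ≤ Real.log N := Real.log_nonneg hN1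
  have hH1 := one_le_harmonic hN
  have hH : (harmonic N : ℝ) ≤ 3 * L := by
    have := harmonic_le_one_add_log N
    linarith
  -- The three summands bound log H_N ≤ H_N ≤ 3L, log B ≤ B ≤ 2BL and A log N ≤ AL, using L ≥ 1/2.
  have hlog : Real.log ((harmonic N : ℝ) * B * (N : ℝ) ^ A) ≤ (3 + 2 * B + A) * L := by
    rw [Real.log_mul (by positivity) (by positivity), Real.log_mul (by positivity) (by positivity),
      Real.log_rpow (by linarith)]
    have h1 := Real.log_le_sub_one_of_pos (show 0 < (harmonic N : ℝ) by linarith)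
    have h2 := Real.log_le_sub_one_of_pos (show 0 < B by linarith)
    have h3 : A * Real.log N ≤ A * L := by gcongr
    have h4 : B * (1 / 2) ≤ B * L := by gcongr
    linarith
  have hlog0 : 0 ≤ Real.log ((harmonic N : ℝ) * B * (N : ℝ) ^ A) := by
    refine Real.log_nonneg ?_
    have : 1 ≤ (N : ℝ) ^ A := Real.one_le_rpow hN1 (by linarith)
    calc (1 : ℝ) = 1 * 1 * 1 := by norm_num
      _ ≤ _ := by gcongr
  refine (Nat.ceil_lt_add_one (mul_nonneg (by positivity) hlog0)).le.trans ?_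
  have h1 : 2 * epsOne ε * N * (harmonic N : ℝ) / κ *
      Real.log ((harmonic N : ℝ) * B * (N : ℝ) ^ A) ≤
      2 * epsOne ε * N * (3 * L) / κ * ((3 + 2 * B + A) * L) := by
    exact mul_le_mul (by gcongr) hlog hlog0 (by positivity)
  have h2 : 2 * epsOne ε * N * (3 * L) / κ * ((3 + 2 * B + A) * L) =
      6 * epsOne ε / κ * (3 + 2 * B + A) * (N * L ^ 2) := by ring
  have h3 : 1 ≤ 4 * (N * L ^ 2) := by nlinarith
  linarith

lemma numSamples_le (hε : 0 < ε) (hN : 1 ≤ N) :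
    (numSamples ε N : ℝ) ≤ (16 / ε ^ 2 + 1) * (N : ℝ) ^ 2 := by
  have hN1 : (1 : ℝ) ≤ N := by exact_mod_cast hN
  refine (Nat.ceil_lt_add_one (by positivity)).le.trans ?_
  have : 16 * (N : ℝ) ^ 2 / ε ^ 2 = 16 / ε ^ 2 * (N : ℝ) ^ 2 := by ring
  rw [this]
  nlinarith

lemma numReps_pos {T : ℕ} (b : ℕ) (hT : 0 < T) (hN : 1 ≤ N) (hm : 1 ≤ m) :
    0 < numReps T N m b := by
  refine Nat.clog_pos one_lt_two ?_
  have h1 : 0 < (T * N * m) ^ 2 * (N + m) ^ b := by positivity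
  calc 2 ≤ 2 * ((T * N * m) ^ 2 * (N + m) ^ b) := by omega
    _ = _ := by ring

lemma one_div_two_pow_numReps_le {T : ℕ} (b : ℕ) (hT : 0 < T) (hN : 1 ≤ N) (hm : 1 ≤ m) :
    1 / (2 : ℝ) ^ numReps T N m b ≤
      1 / (2 * ((T : ℝ) * N * m) ^ 2 * ((N : ℝ) + m) ^ b) := by
  have h : 2 * (T * N * m) ^ 2 * (N + m) ^ b ≤ 2 ^ numReps T N m b :=
    Nat.le_pow_clog one_lt_two _
  have h' : 2 * ((T : ℝ) * N * m) ^ 2 * ((N : ℝ) + m) ^ b ≤ 2 ^ numReps T N m b := by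
    exact_mod_cast h
  have h0 : 0 < 2 * ((T : ℝ) * N * m) ^ 2 * ((N : ℝ) + m) ^ b := by positivity
  exact one_div_le_one_div_of_le h0 h'

/-- With l = log(Nm + 1), log T ≤ K + 3l and N + m ≤ Nm + 1, the argument of the binary logarithm
has logarithm at most 1 + 2K + 8l + bl. Since log 2 ≥ 1/2, this gives k ≤ 3 + 4K + 16l + 2bl, and l
≥ 1/2 absorbs the constants. -/
lemma numReps_le {T : ℕ} {K : ℝ} (b : ℕ) (hK : 1 ≤ K) (hT : 0 < T) (hN : 1 ≤ N) (hm : 1 ≤ m)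
    (hTK : (T : ℝ) ≤ K * (N * Real.log (N + 1) ^ 2)) :
    (numReps T N m b : ℝ) ≤ (22 + 8 * K + 2 * b) * Real.log (N * m + 1) := by
  have hN1 : (1 : ℝ) ≤ N := by exact_mod_cast hN
  have hm1 : (1 : ℝ) ≤ m := by exact_mod_cast hm
  have hT1 : (1 : ℝ) ≤ T := by exact_mod_cast hT
  have hNm : (1 : ℝ) ≤ N * m := by nlinarith
  have hl := half_le_log_add_one hNm
  set l := Real.log (N * m + 1)
  have hx : 1 < 2 * (T * N * m) ^ 2 * (N + m) ^ b := by
    have h1 : 0 < (T * N * m) ^ 2 * (N + m) ^ b := by positivity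
    calc 1 < 2 * ((T * N * m) ^ 2 * (N + m) ^ b) := by omega
      _ = _ := by ring
  have h1 : 2 ^ (numReps T N m b - 1) < 2 * (T * N * m) ^ 2 * (N + m) ^ b :=
    Nat.pow_pred_clog_lt_self one_lt_two hx
  have h2 : (2 : ℝ) ^ (numReps T N m b - 1) ≤ 2 * ((T : ℝ) * N * m) ^ 2 * ((N : ℝ) + m) ^ b := by
    exact_mod_cast h1.le
  have h3 := Real.log_le_log (by positivity) h2
  rw [Real.log_pow, Real.log_mul (by positivity) (by positivity),
    Real.log_mul (by positivity) (by positivity), Real.log_pow, Real.log_pow,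
    mul_assoc (T : ℝ), Real.log_mul (by positivity) (by positivity)] at h3
  have hk := numReps_pos b hT hN hm
  rw [Nat.cast_sub hk] at h3
  have e1 : Real.log (N * m) ≤ l := Real.log_le_log (by positivity) (by linarith)
  have e2 : Real.log (N + m) ≤ l := Real.log_le_log (by positivity) (by nlinarith)
  have e3 : Real.log N ≤ l := Real.log_le_log (by positivity) (by nlinarith)
  have e4 : Real.log T ≤ K + 3 * l := by
    have hL0 : 0 ≤ Real.log (N + 1) := Real.log_nonneg (by linarith)
    have hL : Real.log (N + 1) ≤ N := by
      have := Real.log_le_sub_one_of_pos (show (0 : ℝ) < N + 1 by positivity)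
      linarith
    have h4 : (T : ℝ) ≤ K * (N : ℝ) ^ 3 := by
      calc (T : ℝ) ≤ K * (N * Real.log (N + 1) ^ 2) := hTK
        _ ≤ K * (N * (N : ℝ) ^ 2) := by gcongr
        _ = K * (N : ℝ) ^ 3 := by ring
    have h5 := Real.log_le_log (by positivity) h4
    rw [Real.log_mul (by positivity) (by positivity), Real.log_pow] at h5
    have h6 := Real.log_le_sub_one_of_pos (show 0 < K by linarith)
    push_cast at h5
    linarith
  have e5 : Real.log 2 ≤ 1 := by linarith [Real.log_two_lt_d9]
  have e6 : 1 / 2 ≤ Real.log 2 := by linarith [Real.log_two_gt_d9]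
  have e7 : (b : ℝ) * Real.log (N + m) ≤ b * l := by gcongr
  have e8 : K * (1 / 2) ≤ K * l := by gcongr
  have hk1 : (0 : ℝ) ≤ (numReps T N m b : ℝ) - 1 := by
    have : (1 : ℝ) ≤ numReps T N m b := by exact_mod_cast hk
    linarith
  have e9 : ((numReps T N m b : ℝ) - 1) * (1 / 2) ≤ ((numReps T N m b : ℝ) - 1) * Real.log 2 := by
    gcongr
  push_cast at h3
  nlinarith

end Parameters

/-! ### The running time -/

namespace GNDInstance

open Prog

variable {R : RequestFamily} {q : ℕ} (I : GNDInstance R q) {α : Fin q → ℝ}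
  (O : Fin I.N → (Fin I.m → ℝ) → Finset (Fin I.m)) (c : ℕ)

lemma time_powerCost_le (e : Fin I.m) (x : ℝ) :
    time O c ((I.numInput α).powerCost e x) ≤ 4 * q + 1 := by
  have := time_sumEach_le O c (a := 2) (n := q)
    (f := fun j => (arithP .pow x ((I.numInput α).α j)).bind fun y =>
      arithP .mul ((I.numInput α).ξ e j) y) fun j =>
        time_bind_le O c (a := 1) (b := 1) le_rfl fun _ => le_rfl
  refine this.trans (by omega)

lemma time_positiveCost_le (e : Fin I.m) (x : ℝ) :
    time O c ((I.numInput α).positiveCost e x) ≤ 4 * q + 2 :=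
  time_bind_le O c (b := 1) (I.time_powerCost_le O c e x) fun _ => le_rfl

lemma time_totalCost_le (p : Fin I.N → Finset (Fin I.m)) :
    time O c ((I.numInput α).totalCost p) ≤ I.m * (4 * I.N + 4 * q + 7) + 1 := by
  refine time_sumEach_le O c (a := 4 * I.N + 4 * q + 5) fun e => ?_
  refine (time_bind_le O c (time_sumIf_le O c _ _ _) (b := 1 + (1 + (4 * q + 2))) fun l =>
    time_bind_le O c (time_natP O c 0).le fun z => time_bind_le O c (time_leP O c _ _).le
      fun b => ?_).trans (by omega)
  split_ifs
  · simp
  · exact I.time_positiveCost_le O c e l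

lemma time_marginalSample_le (p : Fin I.N → Finset (Fin I.m)) (i : Fin I.N) (e : Fin I.m) :
    time O c ((I.numInput α).marginalSample p i e) ≤ 6 * I.N + 8 * q + 5 :=
  (time_bind_le O c (time_randPerm_le O c I.N)
    (b := 4 * I.N + 1 + (1 + (4 * q + 1 + (4 * q + 1 + 1)))) fun _ =>
    time_bind_le O c (time_sumIf_le O c _ _ _) fun _ =>
    time_bind_le O c (time_arithP O c _ _ _).le fun _ =>
    time_bind_le O c (I.time_powerCost_le O c e _) fun _ =>
    time_bind_le O c (I.time_powerCost_le O c e _) fun _ =>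
    (time_arithP O c _ _ _).le).trans (by omega)

lemma time_shapleyAPX_le (M k : ℕ) (p : Fin I.N → Finset (Fin I.m)) (i : Fin I.N)
    (e : Fin I.m) :
    time O c ((I.numInput α).shapleyAPX M k p i e) ≤
      k * (M * (6 * I.N + 8 * q + 7) + 4) + (k + 3 * k ^ 2 + 1) + (4 * I.N + 3) := by
  refine time_bind_le O c (time_bind_le O c (time_forEach_le O c fun _ =>
    time_bind_le O c (b := 2) (time_sumEach_le O c fun _ => I.time_marginalSample_le O c p i e)
      fun s => time_bind_le O c (time_natP O c _).le fun _ => (time_arithP O c _ _ _).le)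
      fun x => time_median_le O c k x) fun θ => ?_
  refine (time_bind_le O c (b := 2) (time_sumEach_le O c (a := 2) fun k => ?_) fun _ =>
    time_bind_le O c (time_arithP O c _ _ _).le fun _ => (time_arithP O c _ _ _).le).trans
      (by omega)
  split_ifs <;> simp

variable {share : (Fin I.N → Finset (Fin I.m)) → Fin I.N → Fin I.m → Prog ℝ I.N I.m ℝ} {s : ℕ}

lemma time_response_le (hs : ∀ p i e, time O c (share p i e) ≤ s) (ε₁ : ℝ) (p : Fin I.N → Finset (Fin I.m)) (i : Fin I.N) :
    time O c (NumInput.response share ε₁ p i) ≤ I.m * (s + 9) + c + 4 :=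
  (time_bind_le O c (time_forEach_le O c fun e => hs p i e)
    (b := c + (4 * I.m + 1 + (4 * I.m + 1 + (1 + (1 + 0))))) fun _ =>
    time_bind_le O c (time_oracleP O c _ _).le fun _ =>
    time_bind_le O c (time_sumIf_le O c _ _ _) fun _ =>
    time_bind_le O c (time_sumIf_le O c _ _ _) fun _ =>
    time_bind_le O c (time_arithP O c _ _ _).le fun _ =>
    time_bind_le O c (time_arithP O c _ _ _).le fun _ => le_rfl).trans (by
      rw [show I.m * (s + 9) = I.m * (s + 1) + 8 * I.m by ring]
      omega)

lemma time_dynamics_le (hs : ∀ p i e, time O c (share p i e) ≤ s) (ε₁ : ℝ) (T : ℕ) (p best : Fin I.N → Finset (Fin I.m)) (x : ℝ) :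
    time O c ((I.numInput α).dynamics share ε₁ T p best x) ≤
      T * (I.N * (I.m * (s + 9) + c + 5) + 7 * I.N + 2 * (I.N * I.m) +
        (I.m * (4 * I.N + 4 * q + 7) + 1) + 6) := by
  induction T generalizing p best x with
  | zero => simp [NumInput.dynamics]
  | succ T ih =>
    rw [add_mul, one_mul]
    set rest := T * (I.N * (I.m * (s + 9) + c + 5) + 7 * I.N + 2 * (I.N * I.m) +
        (I.m * (4 * I.N + 4 * q + 7) + 1) + 6)
    refine (Nat.succ_le_succ (time_bind_le O c
      (time_forEach_le O c fun i => I.time_response_le O c hs ε₁ p i)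
      (b := 1 + (I.N * 2 + (I.N * 2 + 1 + (1 + (1 + (I.N * 3 + (2 * (I.N * I.m) +
        (I.m * (4 * I.N + 4 * q + 7) + 1 + (1 + rest))))))))) fun x =>
      time_bind_le O c (time_natP O c 0).le fun z =>
      time_bind_le O c (time_findFirst_le O c (a := 1) fun i =>
        time_bind_le O c (b := 0) (time_leP O c _ _).le fun _ => le_rfl) fun improving => ?_)).trans
      (by
        simp only [Nat.succ_eq_add_one]
        rw [show I.N * (I.m * (s + 9) + c + 4 + 1) = I.N * (I.m * (s + 9) + c + 5) by rfl]
        omega)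
    cases improving with
    | none => exact Nat.zero_le _
    | some i₀ =>
      refine time_bind_le O c ((time_sumEach_le O c (a := 0) fun i => le_rfl).trans (by omega))
        fun Δ => time_bind_le O c (time_natP O c _).le fun n =>
        time_bind_le O c (time_arithP O c _ _ _).le fun avg =>
        time_bind_le O c (time_findFirst_le O c (a := 2) fun i =>
          time_bind_le O c (b := 1) (time_leP O c _ _).le fun _ =>
          time_bind_le O c (b := 0) (time_leP O c _ _).le fun _ => le_rfl) fun pick => ?_
      cases pick with
      | none => exact Nat.zero_le _
      | some j =>
        refine time_bind_le O c (time_ticks O c _).le fun _ =>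
          time_bind_le O c (I.time_totalCost_le O c _) fun c' =>
          time_bind_le O c (time_leP O c _ _).le fun b => ?_
        split_ifs
        · exact ih _ _ _
        · exact ih _ _ _

lemma time_algABRD_le (hs : ∀ p i e, time O c (share p i e) ≤ s) (ε₁ : ℝ) (T : ℕ) :
    time O c ((I.numInput α).algABRD share ε₁ T) ≤
      I.N * (I.m * (4 * q + 3) + c + 1) + (I.m * (4 * I.N + 4 * q + 7) + 1) +
      T * (I.N * (I.m * (s + 9) + c + 5) + 7 * I.N + 2 * (I.N * I.m) +
        (I.m * (4 * I.N + 4 * q + 7) + 1) + 6) := by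
  rw [add_assoc]
  exact time_bind_le O c (time_forEach_le O c fun i =>
    time_bind_le O c (time_forEach_le O c fun e => I.time_positiveCost_le O c e _) fun τ =>
      (time_oracleP O c _ _).le) fun p =>
    time_bind_le O c (I.time_totalCost_le O c p) fun x => I.time_dynamics_le O c hs ε₁ T p p x

end GNDInstance

/-- The dominant terms of one estimate are kMn for the samples and k² for the insertion sort. The
remaining terms, including the setup M + k and the overhead 59 + 12q used in `total_time_le`, are
absorbed because n, M, k ≥ 1. -/
lemma estimate_time_le {n M k q : ℝ} (hn : 1 ≤ n) (hM : 1 ≤ M) (hk : 1 ≤ k) (hq : 0 ≤ q) :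
    k * (M * (6 * n + 8 * q + 7) + 4) + (k + 3 * k ^ 2 + 1) + (4 * n + 3) + M + k +
      (59 + 12 * q) ≤ (91 + 20 * q) * (k * M * n + k ^ 2) := by
  have hkM : 1 ≤ k * M := one_le_mul_of_one_le_of_one_le hk hM
  have h1 : k * M ≤ k * M * n := le_mul_of_one_le_right (by linarith) hn
  have h2 : k ≤ k * M := le_mul_of_one_le_right (by linarith) hM
  have h3 : M ≤ k * M := le_mul_of_one_le_left (by linarith) hk
  have h4 : n ≤ k * M * n := le_mul_of_one_le_left (by linarith) hkM
  have h5 : q * (k * M) ≤ q * (k * M * n) := mul_le_mul_of_nonneg_left h1 hq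
  have h6 : q * 1 ≤ q * (k * M * n) := mul_le_mul_of_nonneg_left (hkM.trans h1) hq
  have h7 : 0 ≤ q * k ^ 2 := by positivity
  have h8 : 0 ≤ k ^ 2 := by positivity
  linarith

/-- Here s is the cost of one estimate and W the cost of counting out the sample and repetition
bounds. Everything but the oracle calls is charged to the T·n·r estimates at price Y; the initial
oracle calls cost no more than those of the rounds. -/
lemma total_time_le {n r T s c q Y W : ℝ} (hn : 1 ≤ n) (hr : 1 ≤ r) (hT : 1 ≤ T)
    (hc : 0 ≤ c) (hq : 0 ≤ q) (hW : 0 ≤ W) (hY : s + W + (59 + 12 * q) ≤ Y) :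
    n + T + W + (n * (r * (4 * q + 3) + c + 1) + (r * (4 * n + 4 * q + 7) + 1) +
      T * (n * (r * (s + 9) + c + 5) + 7 * n + 2 * (n * r) + (r * (4 * n + 4 * q + 7) + 1) + 6)) ≤
      T * (n * r) * Y + 2 * (T * (n * c)) := by
  have hn_nr : n ≤ n * r := le_mul_of_one_le_right (by linarith) hr
  have hr_nr : r ≤ n * r := le_mul_of_one_le_left (by linarith) hn
  have hnr : 1 ≤ n * r := hn.trans hn_nr
  have hqr : q * r ≤ q * (n * r) := mul_le_mul_of_nonneg_left hr_nr hq
  have hTnr : n * r ≤ T * (n * r) := le_mul_of_one_le_left (by linarith) hT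
  have hTT : T ≤ T * (n * r) := le_mul_of_one_le_right (by linarith) hnr
  have hnc : n * c ≤ T * (n * c) := le_mul_of_one_le_left (by positivity) hT
  have hstep : n * (r * (s + 9) + c + 5) + 7 * n + 2 * (n * r) + (r * (4 * n + 4 * q + 7) + 1) + 6 ≤
      n * r * (s + 41 + 4 * q) + n * c := by linarith
  have h1 := mul_le_mul_of_nonneg_left hstep (show 0 ≤ T by linarith)
  have h2 : W ≤ T * (n * r) * W := le_mul_of_one_le_left hW (by linarith)
  have h3 := mul_le_mul_of_nonneg_left hY (show 0 ≤ T * (n * r) by positivity)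
  have h4 : q * (n * r) ≤ q * (T * (n * r)) := mul_le_mul_of_nonneg_left hTnr hq
  linarith

/-- There are T·N·m estimates of cost O(kMN + k²), where T = O(N log²(N+1)), M = O(N²) and k is
logarithmic. This gives N⁵ and the squared logarithms; the oracle is called O(T·N) times. -/
lemma exists_time_algShapley_le {q : ℕ} {α : Fin q → ℝ} (hα : 1 < ⨆ j, α j) {ε : ℝ}
    (hε : 0 < ε) (hε1 : ε < 1) (hε2 : epsOne ε ^ 2 < 2) (b : ℕ) :
    ∃ K : ℝ, 0 < K ∧ ∀ (R : RequestFamily) (I : GNDInstance R q)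
      (O : Fin I.N → (Fin I.m → ℝ) → Finset (Fin I.m)) (c : ℕ), 1 ≤ I.N → 1 ≤ I.m →
      ((I.algShapley α ε b).time O c : ℝ) ≤
        K * ((I.N : ℝ) ^ 5 * Real.log (I.N + 1) ^ 2 * I.m *
            Real.log ((I.N : ℝ) * I.m + 1) ^ 2 +
          (I.N : ℝ) ^ 2 * Real.log (I.N + 1) ^ 2 * c) := by
  obtain ⟨K₁, hK₁, hT⟩ := numIterations_le hα hε hε1 hε2
  obtain ⟨K₂, hK₂⟩ : ∃ K₂ : ℝ, K₂ = 22 + 8 * K₁ + 2 * b := ⟨_, rfl⟩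
  obtain ⟨K₃, hK₃⟩ : ∃ K₃ : ℝ, K₃ = 16 / ε ^ 2 + 1 := ⟨_, rfl⟩
  have hK₂0 : 0 < K₂ := by rw [hK₂]; positivity
  have hK₃0 : 0 < K₃ := by rw [hK₃]; positivity
  refine ⟨K₁ * ((91 + 20 * q) * (2 * K₂ * K₃ + K₂ ^ 2)) + 2 * K₁, by positivity,
    fun R I O c hN hm => ?_⟩
  have hTle := hT I.N hN
  have hTpos := numIterations_pos hα hε hε1 hε2 hN
  have hkle := numReps_le b hK₁ hTpos hN hm hTle
  have hkpos := numReps_pos b hTpos hN hm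
  have hMle := numSamples_le hε hN
  have hMpos := I.numSamples_pos hε hN
  have htime : (I.algShapley α ε b).time O c ≤ _ :=
    Prog.time_bind_le O c (Prog.time_ticks O c _).le fun _ =>
      I.time_algABRD_le O c (fun p i e => I.time_shapleyAPX_le O c _ _ p i e) (epsOne ε) _
  rw [← hK₂] at hkle
  rw [← hK₃] at hMle
  have htime' := (Nat.cast_le (α := ℝ)).2 htime
  push_cast at htime'
  have hN1 : (1 : ℝ) ≤ I.N := by exact_mod_cast hN
  have hm1 : (1 : ℝ) ≤ I.m := by exact_mod_cast hm
  have hT1 : (1 : ℝ) ≤ numIterations α ε I.N := by exact_mod_cast hTpos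
  have hk1 : (1 : ℝ) ≤ numReps (numIterations α ε I.N) I.N I.m b := by exact_mod_cast hkpos
  have hM1 : (1 : ℝ) ≤ numSamples ε I.N := by exact_mod_cast hMpos
  have hl := half_le_log_add_one (show (1 : ℝ) ≤ I.N * I.m by nlinarith)
  have hq0 : (0 : ℝ) ≤ q := by positivity
  have hc0 : (0 : ℝ) ≤ c := by positivity
  generalize (((I.algShapley α ε b).time O c : ℕ) : ℝ) = t at *
  generalize ((numReps (numIterations α ε I.N) I.N I.m b : ℕ) : ℝ) = k at *
  generalize (numIterations α ε I.N : ℝ) = T at *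
  generalize (numSamples ε I.N : ℝ) = M at *
  generalize Real.log ((I.N : ℝ) * I.m + 1) = l at *
  generalize Real.log ((I.N : ℝ) + 1) = L at *
  generalize (I.N : ℝ) = n at *
  generalize (I.m : ℝ) = r at *
  generalize (c : ℝ) = c at *
  have h1 := total_time_le (c := c) (W := M + k) hN1 hm1 hT1
    (s := k * (M * (6 * n + 8 * q + 7) + 4) + (k + 3 * k ^ 2 + 1) + (4 * n + 3))
    hc0 hq0 (by linarith)
    (Y := (91 + 20 * q) * (k * M * n + k ^ 2))
    (by linarith [estimate_time_le hN1 hM1 hk1 hq0])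
  have hY : k * M * n + k ^ 2 ≤ (2 * K₂ * K₃ + K₂ ^ 2) * (n ^ 3 * l ^ 2) := by
    have h1 : k * M * n ≤ (K₂ * l) * (K₃ * n ^ 2) * n := by gcongr
    have h2 : k ^ 2 ≤ (K₂ * l) ^ 2 := by gcongr
    have h3 : l ≤ 2 * l ^ 2 := by nlinarith
    have h4 := mul_le_mul_of_nonneg_left h3 (show 0 ≤ K₂ * K₃ * n ^ 3 by positivity)
    have h6 : 1 ≤ n ^ 3 := one_le_pow₀ hN1
    have h7 := mul_le_mul_of_nonneg_right h6 (show 0 ≤ K₂ ^ 2 * l ^ 2 by positivity)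
    linarith
  calc t ≤ T * (n * r) * ((91 + 20 * q) * (k * M * n + k ^ 2)) + 2 * (T * (n * c)) := by linarith
    _ ≤ (K₁ * (n * L ^ 2)) * (n * r) * ((91 + 20 * q) * ((2 * K₂ * K₃ + K₂ ^ 2) *
          (n ^ 3 * l ^ 2))) + 2 * ((K₁ * (n * L ^ 2)) * (n * c)) := by gcongr
    _ = K₁ * ((91 + 20 * q) * (2 * K₂ * K₃ + K₂ ^ 2)) * (n ^ 5 * L ^ 2 * r * l ^ 2) +
          2 * K₁ * (n ^ 2 * L ^ 2 * c) := by ring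
    _ ≤ (K₁ * ((91 + 20 * q) * (2 * K₂ * K₃ + K₂ ^ 2)) + 2 * K₁) *
          (n ^ 5 * L ^ 2 * r * l ^ 2 + n ^ 2 * L ^ 2 * c) := by
        have h1 : 0 ≤ K₁ * ((91 + 20 * q) * (2 * K₂ * K₃ + K₂ ^ 2)) * (n ^ 2 * L ^ 2 * c) := by
          positivity
        have h2 : 0 ≤ 2 * K₁ * (n ^ 5 * L ^ 2 * r * l ^ 2) := by positivity
        linarith

/-! ### The output of the algorithm -/

namespace GNDInstance

open Prog

variable {R : RequestFamily} {q : ℕ} (I : GNDInstance R q) {α : Fin q → ℝ} {ε : ℝ}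
  (O : Fin I.N → (Fin I.m → ℝ) → Finset (Fin I.m))

lemma startupRatio_nonneg (α : Fin q → ℝ) : 0 ≤ I.startupRatio α :=
  Real.iSup_nonneg fun e => Real.iInf_nonneg fun j =>
    Real.rpow_nonneg (div_nonneg (I.σ_nonneg e) j.2.le) _

/-- The profile from which the dynamics starts. -/
noncomputable def initialProfile (α : Fin q → ℝ) (i : Fin I.N) : Finset (Fin I.m) :=
  O i fun e => I.σ e + I.powerCost α e (I.w i e)

lemma lonelyCost_pos (hα : ∀ j, 1 < α j) (i : Fin I.N) (e : Fin I.m) :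
    0 < I.σ e + I.powerCost α e (I.w i e) := by
  have h : (0 : ℝ) < I.w i e := by exact_mod_cast I.w_pos i e
  have := I.powerCost_strictMono hα e le_rfl h
  rw [I.powerCost_zero hα] at this
  linarith [I.σ_nonneg e]

/-- The computation of the initial profile and its cost is deterministic, so only the dynamics can
fail. -/
lemma failProb_algShapley (b : ℕ) (Q : (Fin I.N → Finset (Fin I.m)) → Prop) :
    failProb O (I.algShapley α ε b) Q =
      failProb O ((I.numInput α).dynamics (I.shapleyAPX α ε b) (epsOne ε) (numIterations α ε I.N)
        (I.initialProfile O α) (I.initialProfile O α) (I.totalCost α (I.initialProfile O α))) Q := by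
  rw [algShapley, bind_eq, failProb_bind_eq O (a := ()) (fun g => expect_ticks O _ g),
    NumInput.algABRD, bind_eq, failProb_bind_eq O (a := I.initialProfile O α), bind_eq,
    failProb_bind_eq O fun g => I.expect_totalCost O _ g]
  refine fun g => expect_forEach_det O (fun i g => ?_) g
  rw [bind_eq, expect_bind, expect_forEach_det O fun e g => I.expect_positiveCost O e _ g]
  rfl

lemma failProb_algShapley_feasible (hα : ∀ j, 1 < α j) (hε : 0 < ε) (b : ℕ)
    (hO : ∀ i τ, (∀ e, 0 < τ e) → O i τ ∈ R.replies I.m (I.req i)) (hN : 0 < I.N)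
    (hk : 0 < numReps (numIterations α ε I.N) I.N I.m b) :
    failProb O (I.algShapley α ε b) I.Feasible = 0 := by
  rw [failProb_algShapley]
  have h0 : I.Feasible (I.initialProfile O α) := fun i => hO i _ (I.lonelyCost_pos hα i)
  exact I.failProb_dynamics_feasible O hO hN
    (fun p i e => I.failProb_shapleyAPX_pos O hα hε b p i e hk) _ h0 h0

/-- The approximation guarantee. -/
lemma failProb_algShapley_le {ϱ r : ℝ} (hα : ∀ j, 1 < α j) (hA : 1 < ⨆ j, α j)
    (hε : 0 < ε) (hε1 : ε < 1) (hε2 : epsOne ε ^ 2 < 2) (b : ℕ) (hϱ : 1 ≤ ϱ)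
    (hO : ∀ i τ, (∀ e, 0 < τ e) → O i τ ∈ R.replies I.m (I.req i) ∧
      ∀ r ∈ R.replies I.m (I.req i), ∑ e ∈ O i τ, τ e ≤ ϱ * ∑ e ∈ r, τ e)
    (hN : 1 ≤ I.N) (hm : 1 ≤ I.m)
    (hr : 2 * epsOne ε ^ 2 * ϱ * ((5 * (⨆ j, α j) * ϱ) ^ (⨆ j, α j) + I.startupRatio α) ≤
      (1 - epsOne ε ^ 2 / 2) * r) (hϱr : ϱ ≤ r) :
    failProb O (I.algShapley α ε b) (· ∈ I.approxOptimal α r) ≤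
      1 / (2 * ((numIterations α ε I.N : ℝ) * I.N * I.m) * ((I.N : ℝ) + I.m) ^ b) := by
  have hT := numIterations_pos hA hε hε1 hε2 hN
  have hk := numReps_pos b hT hN hm
  have hfeas := I.failProb_algShapley_feasible O hα hε b (fun i τ h => (hO i τ h).1) hN hk
  have h0 : I.Feasible (I.initialProfile O α) := fun i => (hO i _ (I.lonelyCost_pos hα i)).1
  classical
  -- There are finitely many profiles and the initial one is feasible, so an optimum exists and can
  -- serve as the comparison profile.
  obtain ⟨p', hp', hmin⟩ := Finset.exists_min_image (Finset.univ.filter I.Feasible)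
    (I.totalCost α) ⟨_, Finset.mem_filter.2 ⟨Finset.mem_univ _, h0⟩⟩
  have hp'f : I.Feasible p' := (Finset.mem_filter.1 hp').2
  have hC' := I.totalCost_nonneg hα p'
  have hNr : (0 : ℝ) < I.N := by exact_mod_cast hN
  have hmr : (0 : ℝ) < I.m := by exact_mod_cast hm
  have hTr : (0 : ℝ) < numIterations α ε I.N := by exact_mod_cast hT
  have hκ : 0 < 1 - epsOne ε ^ 2 / 2 := by linarith
  have he0 : 0 < epsOne ε := by linarith [one_le_epsOne hε hε1]
  have hH : (0 : ℝ) < (harmonic I.N : ℝ) := by linarith [one_le_harmonic hN]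
  have hB : (⨆ j, α j) ≤ (⌈⨆ j, α j⌉₊ : ℝ) := Nat.le_ceil _
  have hcost : failProb O (I.algShapley α ε b)
      (fun p => I.totalCost α p ≤ r * I.totalCost α p') ≤
      numIterations α ε I.N * (I.N * (I.m *
        (1 / 2 ^ numReps (numIterations α ε I.N) I.N I.m b))) := by
    rw [failProb_algShapley]
    refine I.failProb_dynamics_le O (A := ⨆ j, α j) (B := ⌈⨆ j, α j⌉₊) hα le_iSup_exponent hB
      hA.le hε hε1 hε2 hϱ (fun i τ hτ => (hO i τ hτ).2 _ (hp'f i)) hN (by positivity)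
      (fun p i e => I.failProb_shapleyAPX_le O hα hε b p i e hk) hr _ rfl le_rfl (Or.inr ?_)
    refine (I.potential_mul_exp_le (ϱ := ϱ) (p' := p') (by positivity) hα le_iSup_exponent
      (by linarith) hA.le hϱ hN (Nat.le_ceil _)
      fun i => (hO i _ (I.lonelyCost_pos hα i)).2 _ (hp'f i)).trans ?_
    exact mul_le_mul_of_nonneg_right hϱr hC'
  have hsub : failProb O (I.algShapley α ε b) (· ∈ I.approxOptimal α r) ≤
      failProb O (I.algShapley α ε b)
        (fun p => I.Feasible p ∧ I.totalCost α p ≤ r * I.totalCost α p') := by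
    refine failProb_mono O _ fun p hp => ⟨hp.1, fun p'' hp'' => hp.2.trans ?_⟩
    exact mul_le_mul_of_nonneg_left
      (hmin p'' (Finset.mem_filter.2 ⟨Finset.mem_univ _, hp''⟩)) (by linarith)
  refine hsub.trans ((failProb_and_le O _ _ _).trans ?_)
  rw [hfeas, zero_add]
  refine hcost.trans ?_
  -- The union bound multiplies the failure probability of one estimate by TNm, which cancels one of
  -- the two factors TNm in its denominator.
  have h1 := one_div_two_pow_numReps_le b hT hN hm
  have h2 : (numIterations α ε I.N : ℝ) * (I.N * (I.m *
      (1 / 2 ^ numReps (numIterations α ε I.N) I.N I.m b))) ≤ numIterations α ε I.N * (I.N * (I.m *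
      (1 / (2 * ((numIterations α ε I.N : ℝ) * I.N * I.m) ^ 2 * ((I.N : ℝ) + I.m) ^ b)))) := by
    gcongr
  refine h2.trans (le_of_eq ?_)
  field_simp

end GNDInstance

/-! ### Choice of the constants and proof of the main theorem -/

theorem theorem1 (q : ℕ) (hq : 1 ≤ q) (α : Fin q → ℝ) (hα : ∀ j, 1 < α j)
    (ε : ℝ) (hε : 0 < ε) (hε1 : ε < 1) (hε2 : epsOne ε ^ 2 < 2) :
    ∃ K : ℝ, 0 < K ∧ ∀ b : ℕ, ∃ K' : ℝ, 0 < K' ∧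
      ∀ (R : RequestFamily) (ϱ : ℝ) (_ : 1 ≤ ϱ)
        (O : (m : ℕ) → List Bool → (Fin m → ℝ) → Finset (Fin m)) (_ : IsReplyOracle R ϱ O)
        (I : GNDInstance R q) (_ : 1 ≤ I.N) (_ : 1 ≤ I.m),
        -- the algorithm uses estimates of the Shapley cost shares
        (∀ (p : Fin I.N → Finset (Fin I.m)) (i : Fin I.N) (e : Fin I.m),
          1 - 1 / (2 * ((numIterations α ε I.N : ℝ) * I.N * I.m) ^ 2) ≤
            (((I.shapleyAPX α ε b p i e).law (I.oracleOn O)).toOuterMeasure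
              (Set.Icc ((1 - ε) * I.shapleyShare α e (insert i (I.users p e)) i)
                ((1 + ε) * I.shapleyShare α e (insert i (I.users p e)) i))).toReal) ∧
        -- every output is feasible
        (∀ p ∈ ((I.algShapley α ε b).law (I.oracleOn O)).support, I.Feasible p) ∧
        -- the approximation ratio, with explicit success probability
        1 - K / ((I.N : ℝ) ^ 2 * I.m * Real.log (I.N + 1) ^ 2) ≤
          (((I.algShapley α ε b).law (I.oracleOn O)).toOuterMeasure
            (I.approxOptimal α
              (K * (ϱ ^ ((⨆ j, α j) + 1) + ϱ * I.startupRatio α)))).toReal ∧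
        -- the approximation ratio, with high probability
        1 - 1 / ((I.m : ℝ) + I.N) ^ b ≤
          (((I.algShapley α ε b).law (I.oracleOn O)).toOuterMeasure
            (I.approxOptimal α
              (K * (ϱ ^ ((⨆ j, α j) + 1) + ϱ * I.startupRatio α)))).toReal ∧
        -- the running time, with free access to the oracle
        ((I.algShapley α ε b).time (I.oracleOn O) 1 : ℝ) ≤
          K' * ((I.N : ℝ) ^ 5 * Real.log (I.N + 1) ^ 2 * I.m *
            Real.log ((I.N : ℝ) * I.m + 1) ^ 2) ∧
        -- the running time, when an oracle call takes `c` steps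
        ∀ c : ℕ, ((I.algShapley α ε b).time (I.oracleOn O) c : ℝ) ≤
          K' * ((I.N : ℝ) ^ 5 * Real.log (I.N + 1) ^ 2 * I.m *
              Real.log ((I.N : ℝ) * I.m + 1) ^ 2 +
            (I.N : ℝ) ^ 2 * Real.log (I.N + 1) ^ 2 * c) := by
  have hA : 1 < ⨆ j, α j := (hα ⟨0, hq⟩).trans_le (le_iSup_exponent _)
  have he := one_le_epsOne hε hε1
  have hκ : 0 < 1 - epsOne ε ^ 2 / 2 := by linarith
  obtain ⟨A, hAdef⟩ : ∃ A, A = ⨆ j, α j := ⟨_, rfl⟩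
  have h5A : 1 ≤ (5 * A) ^ A := Real.one_le_rpow (by linarith) (by linarith)
  have hX : 0 ≤ 2 * epsOne ε ^ 2 / (1 - epsOne ε ^ 2 / 2) * (5 * A) ^ A := by positivity
  -- The first summand is what the condition on r demands after division by 1 - ε₁²/2. The summand 1
  -- ensures r ≥ ϱ, so that the target is not below the bound reached from the initial profile.
  -- Neither depends on b.
  obtain ⟨K, hK⟩ : ∃ K, K = 2 * epsOne ε ^ 2 / (1 - epsOne ε ^ 2 / 2) * (5 * A) ^ A + 1 :=
    ⟨_, rfl⟩
  have hK1 : 1 ≤ K := by linarith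
  refine ⟨K, by linarith, fun b => ?_⟩
  obtain ⟨K', hK', htime⟩ := exists_time_algShapley_le hA hε hε1 hε2 b
  refine ⟨5 * K', by positivity, fun R ϱ hϱ O hO I hN hm => ?_⟩
  have hNr : (1 : ℝ) ≤ I.N := by exact_mod_cast hN
  have hmr : (1 : ℝ) ≤ I.m := by exact_mod_cast hm
  have hNm : (1 : ℝ) ≤ I.N * I.m := one_le_mul_of_one_le_of_one_le hNr hmr
  have hT := numIterations_pos hA hε hε1 hε2 hN
  have hTr : (1 : ℝ) ≤ numIterations α ε I.N := by exact_mod_cast hT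
  have hk := numReps_pos b hT hN hm
  have hL := half_le_log_add_one hNr
  have hl := half_le_log_add_one hNm
  have hpow : (1 : ℝ) ≤ ((I.N : ℝ) + I.m) ^ b := one_le_pow₀ (by linarith)
  have hTNm : (1 : ℝ) ≤ (numIterations α ε I.N : ℝ) * I.N * I.m :=
    one_le_mul_of_one_le_of_one_le (one_le_mul_of_one_le_of_one_le hTr hNr) hmr
  have hOI : ∀ i τ, (∀ e, 0 < τ e) → I.oracleOn O i τ ∈ R.replies I.m (I.req i) ∧
      ∀ r ∈ R.replies I.m (I.req i), ∑ e ∈ I.oracleOn O i τ, τ e ≤ ϱ * ∑ e ∈ r, τ e :=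
    fun i τ hτ => hO I.m (I.req i) (I.req_mem i) τ hτ
  have hratio := I.startupRatio_nonneg α
  have hϱA : ϱ ≤ ϱ ^ (A + 1) := by
    simpa using Real.rpow_le_rpow_of_exponent_le hϱ (show 1 ≤ A + 1 by linarith)
  have hKκ : (1 - epsOne ε ^ 2 / 2) * K =
      2 * epsOne ε ^ 2 * (5 * A) ^ A + (1 - epsOne ε ^ 2 / 2) := by
    have h : ∀ κ x y : ℝ, κ ≠ 0 → κ * (x / κ * y + 1) = x * y + κ := fun κ x y h => by
      field_simp
    rw [hK, h _ _ _ hκ.ne']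
  have hr1 : ϱ ≤ K * (ϱ ^ (A + 1) + ϱ * I.startupRatio α) := by
    have h1 : 0 ≤ ϱ * I.startupRatio α := mul_nonneg (by linarith) hratio
    nlinarith
  have hr2 : 2 * epsOne ε ^ 2 * ϱ * ((5 * A * ϱ) ^ A + I.startupRatio α) ≤
      (1 - epsOne ε ^ 2 / 2) * (K * (ϱ ^ (A + 1) + ϱ * I.startupRatio α)) := by
    -- Splitting (5Aϱ)^A·ϱ as (5A)^A·ϱ^(A+1) gives the exponent A + 1; the startup term is covered
    -- because (5A)^A ≥ 1.
    rw [Real.mul_rpow (by linarith) (by linarith), ← mul_assoc (1 - epsOne ε ^ 2 / 2), hKκ,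
      Real.rpow_add_one (by linarith)]
    have h1 : 0 ≤ 2 * epsOne ε ^ 2 * (ϱ * I.startupRatio α) := by positivity
    have h2 := mul_le_mul_of_nonneg_right h5A h1
    have h3 : 0 ≤ (1 - epsOne ε ^ 2 / 2) * (ϱ ^ A * ϱ + ϱ * I.startupRatio α) := by positivity
    linarith
  have hfail := I.failProb_algShapley_le (I.oracleOn O) hα hA hε hε1 hε2 b hϱ hOI hN hm
    (r := K * (ϱ ^ ((⨆ j, α j) + 1) + ϱ * I.startupRatio α)) (hAdef ▸ hr2) (hAdef ▸ hr1)
  refine ⟨fun p i e => ?_, fun p hp => ?_, ?_, ?_, ?_, fun c => ?_⟩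
  · rw [Prog.law_outerMeasure_toReal]
    have h1 := I.failProb_shapleyAPX_le (I.oracleOn O) hα hε b p i e hk
    have h2 := one_div_two_pow_numReps_le b hT hN hm
    have h3 : 1 / (2 * ((numIterations α ε I.N : ℝ) * I.N * I.m) ^ 2 * ((I.N : ℝ) + I.m) ^ b) ≤
        1 / (2 * ((numIterations α ε I.N : ℝ) * I.N * I.m) ^ 2) :=
      one_div_le_one_div_of_le (by positivity) (le_mul_of_one_le_right (by positivity) hpow)
    linarith
  · exact Prog.of_mem_support_law (I.oracleOn O) (I.failProb_algShapley_feasible (I.oracleOn O)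
      hα hε b (fun i τ hτ => (hOI i τ hτ).1) hN hk) hp
  · rw [Prog.law_outerMeasure_toReal]
    have h1 := le_numIterations hA hε hε1 hε2 hN
    -- One failure bound serves both probability claims: here the factor (N + m)^b is dropped and T
    -- is bounded below; for the other claim T·N·m is dropped and (N + m)^b is kept.
    have h2 : 1 / (2 * ((numIterations α ε I.N : ℝ) * I.N * I.m) * ((I.N : ℝ) + I.m) ^ b) ≤
        1 / ((I.N : ℝ) ^ 2 * I.m * Real.log (I.N + 1) ^ 2) := by
      refine one_div_le_one_div_of_le (by positivity) ?_
      calc (I.N : ℝ) ^ 2 * I.m * Real.log (I.N + 1) ^ 2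
          = (I.N * Real.log (I.N + 1) ^ 2) * (I.N * I.m) := by ring
        _ ≤ (2 * I.N * Real.log (I.N + 1) ^ 2) * (I.N * I.m) := by
            gcongr
            linarith
        _ ≤ numIterations α ε I.N * (I.N * I.m) := by gcongr
        _ = (numIterations α ε I.N : ℝ) * I.N * I.m := by ring
        _ ≤ 2 * ((numIterations α ε I.N : ℝ) * I.N * I.m) := by linarith
        _ ≤ _ := le_mul_of_one_le_right (by positivity) hpow
    have h3 : 1 / ((I.N : ℝ) ^ 2 * I.m * Real.log (I.N + 1) ^ 2) ≤
        K / ((I.N : ℝ) ^ 2 * I.m * Real.log (I.N + 1) ^ 2) := by gcongr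
    linarith
  · rw [Prog.law_outerMeasure_toReal]
    have h2 : 1 / (2 * ((numIterations α ε I.N : ℝ) * I.N * I.m) * ((I.N : ℝ) + I.m) ^ b) ≤
        1 / ((I.m : ℝ) + I.N) ^ b := by
      rw [add_comm (I.m : ℝ)]
      exact one_div_le_one_div_of_le (by positivity)
        (le_mul_of_one_le_left (by positivity) (by linarith))
    linarith
  · refine (htime R I (I.oracleOn O) 1 hN hm).trans ?_
    -- With unit cost the oracle term is dominated by the main term up to a factor 4, since 4
    -- log²(Nm + 1) ≥ 1. This explains the constant 5K'.
    have h1 : (I.N : ℝ) ^ 2 * Real.log (I.N + 1) ^ 2 * 1 ≤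
        4 * ((I.N : ℝ) ^ 5 * Real.log (I.N + 1) ^ 2 * I.m *
          Real.log ((I.N : ℝ) * I.m + 1) ^ 2) := by
      have h2 : 1 ≤ 4 * Real.log ((I.N : ℝ) * I.m + 1) ^ 2 := by nlinarith
      have h3 : (I.N : ℝ) ^ 2 ≤ (I.N : ℝ) ^ 5 := pow_le_pow_right₀ hNr (by norm_num)
      calc (I.N : ℝ) ^ 2 * Real.log (I.N + 1) ^ 2 * 1
          ≤ (I.N : ℝ) ^ 5 * Real.log (I.N + 1) ^ 2 *
            (I.m * (4 * Real.log ((I.N : ℝ) * I.m + 1) ^ 2)) := by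
            gcongr
            exact one_le_mul_of_one_le_of_one_le hmr h2
        _ = _ := by ring
    have h2 := mul_le_mul_of_nonneg_left h1 hK'.le
    push_cast
    linarith
  · refine (htime R I (I.oracleOn O) c hN hm).trans ?_
    gcongr
    linarith
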